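/- Let $K\ge 0$, let $\mu\in(0,\infty)^2$, let $\alpha_1,\dots,\alpha_K$ be $2\times 2$ matrices with entries $\alpha_{ijk}\ge 0$, and let $\beta_k=\mathrm{Dg}(\beta_{k1},\beta_{k2})$ with $\beta_{ki}>0$, where $\mathrm{Dg}(x)$ denotes the diagonal matrix with diagonal $x$. Let $N=(N_1,N_2)^\top$ be a bivariate multi-kernel exponential Hawkes process on $\mathbb R$ with these parameters, that is, a simple, locally finite bivariate point process without common events, adapted to a filtration $(\mathcal F_t)_{t\in\mathbb R}$, whose stochastic intensity with respect to that filtration is $$\lambda_t=\mu+\sum_{k=1}^K\lambda_k(t),\qquad \lambda_k(t)=\int_{(-\infty,t)}h_k(t-u)\,dN_u,\qquad h_k(t)_{ij}=\alpha_{ijk}e^{-\beta_{ki}t},$$ where the integrals converge almost surely. (The stochastic intensity property means that $\mathbb E\int C_t\,dN_i(t)=\mathbb E\int C_t\,\lambda_{t,i}\,dt$ for every nonnegative predictable process $C$ and $i=1,2$.) Let $N_t$ denote the vector of the numbers of events of the two types in $(0,t]$. Assume that the process is in steady state from time $0$ on: the law of $(\lambda_1(t),\dots,\lambda_K(t))$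 does not depend on $t\ge 0$. Then the matrix $I-\sum_{k}\beta_k^{-1}\alpha_k$ is invertible, the random variables $\lambda_t$, $\lambda_k(t)\lambda_t^\top$ and $\lambda_tN_t^\top$ are integrable for all $t\ge 0$ and all $k$, the moments $\mathbb E[\lambda_t]$ and $\mathbb E[\lambda_k(t)\lambda_t^\top]$ may be evaluated at any time $t\ge 0$ in the formulas $$A=\Bigl(I-\sum_{k=1}^K\beta_k^{-1}\alpha_k\Bigr)^{-1}\mu\,\mathbb E[\lambda_t^\top]=\mathbb E[\lambda_t]\,\mathbb E[\lambda_t^\top],$$ $$B=\Bigl(I-\sum_{k=1}^K\beta_k^{-1}\alpha_k\Bigr)^{-1}\sum_{k=1}^K\beta_k^{-1}\Bigl(-\beta_k^{-1}\alpha_kA+\mathbb E[\lambda_k(t)\lambda_t^\top]+\alpha_k\,\mathrm{Dg}(\mathbb E[\lambda_t])\Bigr),$$ and the cross moment is asymptotically affine in $t$: $$\mathbb E[\lambda_tN_t^\top]-(At+B)\longrightarrow 0\qquad\text{as } t\to\infty .$$ -/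

import Mathlib

open MeasureTheory ProbabilityTheory Filter Topology Set
open scoped ENNReal Matrix

noncomputable section

namespace MultiKernelHawkes

/-- Parameters of a bivariate Hawkes model with `K` exponential kernels: the baseline `μ`, the
matrices `α k`, and the decay rates `β k i` (the rate depends only on the kernel and on the row). -/
structure Params (K : ℕ) where
  μ : Fin 2 → ℝ
  α : Fin K → Matrix (Fin 2) (Fin 2) ℝ
  β : Fin K → Fin 2 → ℝ

/-- The diagonal matrix `β_k`. -/
def Params.βMat {K : ℕ} (θ : Params K) (k : Fin K) : Matrix (Fin 2) (Fin 2) ℝ :=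
  Matrix.diagonal (θ.β k)

/-- The matrix `∑ k, β_k⁻¹ α_k`. -/
def Params.branching {K : ℕ} (θ : Params K) : Matrix (Fin 2) (Fin 2) ℝ :=
  ∑ k, (θ.βMat k)⁻¹ * θ.α k

/-- The `k`-th kernel `h_k(t)`, with entries `α_{ijk} exp (-β_{ki} t)`. -/
def Params.kernel {K : ℕ} (θ : Params K) (k : Fin K) (t : ℝ) : Matrix (Fin 2) (Fin 2) ℝ :=
  Matrix.of fun i j => θ.α k i j * Real.exp (-θ.β k i * t)

variable {Ω : Type*} {mΩ : MeasurableSpace Ω}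

/-- A bivariate simple point process on the whole real line, adapted to the filtration `ℱ`:
`S i ω` is the set of event times of type `i`. It is locally finite, the number of events in
`(a, b]` is known at time `b`, and almost surely no two events of different types coincide. -/
structure IsPointProcess (P : Measure Ω) (ℱ : Filtration ℝ mΩ) (S : Fin 2 → Ω → Set ℝ) :
    Prop where
  locallyFinite : ∀ i ω a b, (S i ω ∩ Icc a b).Finite
  adapted : ∀ i a b, Measurable[ℱ b] fun ω => (S i ω ∩ Ioc a b).ncard
  noCommonEvents : ∀ᵐ ω ∂P, Disjoint (S 0 ω) (S 1 ω)

/-- The random measure `dN_i`, the counting measure of the event times of type `i`. -/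
def eventMeasure (S : Fin 2 → Ω → Set ℝ) (i : Fin 2) (ω : Ω) : Measure ℝ :=
  Measure.count.restrict (S i ω)

/-- The counting process `N_i(t)`: the number of events of type `i` in `(0, t]`. -/
def N (S : Fin 2 → Ω → Set ℝ) (t : ℝ) (ω : Ω) (i : Fin 2) : ℝ :=
  (S i ω ∩ Ioc 0 t).ncard

/-- The component `λ_k(t) = ∫_{(-∞, t)} h_k(t - u) dN_u` of the intensity. -/
def component {K : ℕ} (θ : Params K) (S : Fin 2 → Ω → Set ℝ) (k : Fin K) (t : ℝ) (ω : Ω)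
    (i : Fin 2) : ℝ :=
  ∑ j, ∫ u in Iio t, θ.kernel k (t - u) i j ∂(eventMeasure S j ω)

/-- The intensity `λ_t = μ + ∑ k, λ_k(t)`. -/
def intensity {K : ℕ} (θ : Params K) (S : Fin 2 → Ω → Set ℝ) (t : ℝ) (ω : Ω) (i : Fin 2) : ℝ :=
  θ.μ i + ∑ k, component θ S k t ω i

/-- The predictable σ-algebra on `ℝ × Ω`, generated by the sets `(s, ∞) × A` with `A ∈ ℱ s`. -/
@[reducible]
def predictable (ℱ : Filtration ℝ mΩ) : MeasurableSpace (ℝ × Ω) :=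
  MeasurableSpace.generateFrom {B | ∃ s A, MeasurableSet[ℱ s] A ∧ B = Ioi s ×ˢ A}

/-- `S` is a Hawkes process with parameters `θ`: the integrals that define its intensity converge
almost surely, and `intensity θ S` is its stochastic intensity with respect to `ℱ`, that is,
`E ∫ C_t dN_i(t) = E ∫ C_t λ_i(t) dt` for every predictable `C ≥ 0`. -/
structure IsHawkes {K : ℕ} (θ : Params K) (P : Measure Ω) (ℱ : Filtration ℝ mΩ)
    (S : Fin 2 → Ω → Set ℝ) : Prop where
  pointProcess : IsPointProcess P ℱ S
  convergent : ∀ᵐ ω ∂P, ∀ k i j t,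
    IntegrableOn (fun u => θ.kernel k (t - u) i j) (Iio t) (eventMeasure S j ω)
  stochasticIntensity : ∀ (i : Fin 2) (C : ℝ × Ω → ℝ≥0∞), Measurable[predictable ℱ] C →
    ∫⁻ ω, ∫⁻ t, C (t, ω) ∂(eventMeasure S i ω) ∂P =
      ∫⁻ ω, ∫⁻ t, C (t, ω) * ENNReal.ofReal (intensity θ S t ω i) ∂volume ∂P

/-- Steady state from time `0` on: the law of `Λ_t = (λ_1(t), …, λ_K(t))` does not depend on
`t ≥ 0`. -/
def IsSteadyState {K : ℕ} (θ : Params K) (P : Measure Ω) (S : Fin 2 → Ω → Set ℝ) : Prop :=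
  ∀ t, 0 ≤ t → IdentDistrib (fun ω k i => component θ S k t ω i)
    (fun ω k i => component θ S k 0 ω i) P P

/-- `E[λ_t]`. -/
def meanIntensity {K : ℕ} (θ : Params K) (P : Measure Ω) (S : Fin 2 → Ω → Set ℝ) (t : ℝ) :
    Fin 2 → ℝ :=
  fun i => ∫ ω, intensity θ S t ω i ∂P

/-- `E[λ_k(t) λ_tᵀ]`. -/
def componentMoment {K : ℕ} (θ : Params K) (P : Measure Ω) (S : Fin 2 → Ω → Set ℝ) (k : Fin K)
    (t : ℝ) : Matrix (Fin 2) (Fin 2) ℝ :=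
  Matrix.of fun i j => ∫ ω, component θ S k t ω i * intensity θ S t ω j ∂P

/-- `E[λ_t N_tᵀ]`. -/
def crossMoment {K : ℕ} (θ : Params K) (P : Measure Ω) (S : Fin 2 → Ω → Set ℝ) (t : ℝ) :
    Matrix (Fin 2) (Fin 2) ℝ :=
  Matrix.of fun i j => ∫ ω, intensity θ S t ω i * N S t ω j ∂P

/-- `A = E[λ_s] E[λ_sᵀ]`, with the expectations taken at time `s`. -/
def slopeMat {K : ℕ} (θ : Params K) (P : Measure Ω) (S : Fin 2 → Ω → Set ℝ) (s : ℝ) :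
    Matrix (Fin 2) (Fin 2) ℝ :=
  Matrix.vecMulVec (meanIntensity θ P S s) (meanIntensity θ P S s)

/-- `B = (I - ∑ β_k⁻¹ α_k)⁻¹ ∑ β_k⁻¹ (-β_k⁻¹ α_k A + E[λ_k(s) λ_sᵀ] + α_k Dg(E[λ_s]))`, with the
expectations taken at time `s`. -/
def offsetMat {K : ℕ} (θ : Params K) (P : Measure Ω) (S : Fin 2 → Ω → Set ℝ) (s : ℝ) :
    Matrix (Fin 2) (Fin 2) ℝ :=
  (1 - θ.branching)⁻¹ * ∑ k, (θ.βMat k)⁻¹ *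
    (-((θ.βMat k)⁻¹ * θ.α k * slopeMat θ P S s) + componentMoment θ P S k s +
      θ.α k * Matrix.diagonal (meanIntensity θ P S s))

end MultiKernelHawkes

end

/-!
Write `G = ∑ β_k⁻¹ α_k` and let `X = (λ_k(0))_k` be the state at time `0`. Between events the state
decays exponentially and at an event of type `j` it jumps by `(α_{·jk})_k`, so that `e^{-⟨c, λ(t)⟩}`
satisfies a pathwise balance equation; taking expectations in steady state gives, for all `c ≥ 0`,
`E[e^{-⟨c, X⟩} ∑_j (1 - e^{-g_j(c)}) λ_j] = E[e^{-⟨c, X⟩} ⟨βc, X⟩]`, where `g_j(c)` is the jump of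
`⟨c, ·⟩`. No moment of `X` is presupposed here. By a separating hyperplane either `G` is subcritical
or `v ≤ vG` for some `v ≥ 0`, `v ≠ 0`; in the latter case the identity at `c = s β⁻¹v` becomes
`v · μ ≤ 0` as `s → 0`, which is absurd. For subcritical `G` there is `v > 0` with `vG < v`, and
first- and second-order expansions of the identity at `c = s β⁻¹v` bound `E[X]` and `E[X Xᵀ]`.

The cross moments `Z_i(t) = E[λ_i(t) N_j(t)]` are finite because `E[N_j(t)²]` is, and integrating by
parts `λ_k(t) N_j(t)` yields the renewal equation
`Z_i(t) = μ_i E[λ_j] t + ∑_k ∫₀ᵗ e^{-β_{ki}(t-v)} (E[(λ_{k,i} + α_{ijk}) λ_j] + (α_k Z(v))_i) dv`.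
Substituting `At + B` leaves an error of size `O(e^{-εt})`, and subcriticality makes the renewal
operator a contraction for the norm `sup e^{εt} |z_i(t)| / r_i`, where `G r < r`.
-/

noncomputable section

namespace MultiKernelHawkes

/-! ### Subcritical matrices -/

section Subcritical

variable {ι : Type*} [Fintype ι] {G : Matrix ι ι ℝ}

/-- Subcriticality of a matrix `G` with nonnegative entries, encoded by a positive vector which `G`
contracts strictly; it is equivalent to the spectral radius of `G` being less than `1`. -/
def Subcritical (G : Matrix ι ι ℝ) : Prop :=
  ∃ r : ι → ℝ, (∀ i, 0 < r i) ∧ ∀ i, (G *ᵥ r) i < r i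

lemma Subcritical.eq_zero_of_le_vecMul (hG : Subcritical G) {x : ι → ℝ} (hx0 : 0 ≤ x)
    (hx : x ≤ x ᵥ* G) : x = 0 := by
  obtain ⟨r, hr, hlt⟩ := hG
  have hterm : ∀ i ∈ Finset.univ, 0 ≤ x i * (r i - (G *ᵥ r) i) := fun i _ =>
    mul_nonneg (hx0 i) (sub_nonneg.2 (hlt i).le)
  have hsum : ∑ i, x i * (r i - (G *ᵥ r) i) ≤ 0 := by
    have h : x ⬝ᵥ r ≤ (x ᵥ* G) ⬝ᵥ r :=
      dotProduct_le_dotProduct_of_nonneg_right hx fun i => (hr i).le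
    rw [← Matrix.dotProduct_mulVec] at h
    simpa only [mul_sub, Finset.sum_sub_distrib, sub_nonpos, dotProduct] using h
  funext i
  have hi := (Finset.sum_eq_zero_iff_of_nonneg hterm).1
    (hsum.antisymm (Finset.sum_nonneg hterm)) i (Finset.mem_univ i)
  exact (mul_eq_zero.1 hi).resolve_right (sub_pos.2 (hlt i)).ne'

lemma abs_vecMul_le (hG0 : ∀ i j, 0 ≤ G i j) (x : ι → ℝ) (j : ι) :
    |(x ᵥ* G) j| ≤ (|x| ᵥ* G) j :=
  (Finset.abs_sum_le_sum_abs _ _).trans_eq <|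
    Finset.sum_congr rfl fun i _ => by rw [abs_mul, abs_of_nonneg (hG0 i j), Pi.abs_apply]

lemma Subcritical.isUnit_one_sub [DecidableEq ι] (hG : Subcritical G) (hG0 : ∀ i j, 0 ≤ G i j) :
    IsUnit (1 - G) := by
  rw [← Matrix.vecMul_injective_iff_isUnit]
  refine (injective_iff_map_eq_zero (Matrix.vecMulLinear (1 - G))).2 fun x hx => ?_
  have hfix : x = x ᵥ* G := by
    rwa [Matrix.vecMulLinear_apply, Matrix.vecMul_sub, Matrix.vecMul_one, sub_eq_zero] at hx
  have habs : |x| = 0 := hG.eq_zero_of_le_vecMul (abs_nonneg x) fun j => ?_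
  · exact funext fun i => abs_eq_zero.1 (congrFun habs i)
  calc |x j| = |(x ᵥ* G) j| := by rw [← hfix]
    _ ≤ (|x| ᵥ* G) j := abs_vecMul_le hG0 x j

lemma Subcritical.exists_vecMul_lt (hG : Subcritical G) (hG0 : ∀ i j, 0 ≤ G i j) :
    ∃ v : ι → ℝ, (∀ i, 0 < v i) ∧ ∀ i, (v ᵥ* G) i < v i := by
  classical
  obtain ⟨v, hv⟩ : ∃ v : ι → ℝ, v ᵥ* (1 - G) = 1 :=
    Matrix.vecMul_surjective_iff_isUnit.2 (hG.isUnit_one_sub hG0) 1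
  have hv' : ∀ j, v j = 1 + (v ᵥ* G) j := fun j => by
    have h := congrFun hv j
    rw [Matrix.vecMul_sub, Matrix.vecMul_one, Pi.sub_apply, Pi.one_apply] at h
    linarith
  have hneg : v⁻ = 0 := by
    refine hG.eq_zero_of_le_vecMul (negPart_nonneg v) fun j => ?_
    have hvneg : -(v ᵥ* G) j ≤ (v⁻ ᵥ* G) j := by
      rw [← Pi.neg_apply, ← Matrix.neg_vecMul]
      exact dotProduct_le_dotProduct_of_nonneg_right (neg_le_negPart v) fun i => hG0 i j
    have hnonneg : 0 ≤ (v⁻ ᵥ* G) j :=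
      dotProduct_nonneg_of_nonneg (negPart_nonneg v) fun i => hG0 i j
    rw [Pi.negPart_apply, negPart_def]
    exact sup_le (by linarith [hv' j]) hnonneg
  have hvG : ∀ j, 0 ≤ (v ᵥ* G) j := fun j =>
    dotProduct_nonneg_of_nonneg (negPart_eq_zero.1 hneg) fun i => hG0 i j
  exact ⟨v, fun j => by linarith [hv' j, hvG j], fun j => by linarith [hv' j]⟩

lemma exists_eq_neg_dotProduct (f : StrongDual ℝ (ι → ℝ)) :
    ∃ v : ι → ℝ, ∀ y, f y = -(v ⬝ᵥ y) := by
  classical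
  refine ⟨fun i => -f fun j => if i = j then 1 else 0, fun y => ?_⟩
  rw [← f.coe_coe, LinearMap.pi_apply_eq_sum_univ f.toLinearMap y, dotProduct,
    ← Finset.sum_neg_distrib]
  exact Finset.sum_congr rfl fun i _ => by rw [smul_eq_mul, neg_mul, neg_neg, mul_comm]

-- Separate the open positive orthant from the cone `{x - G x | x ≥ 0}` by a hyperplane.
lemma exists_dotProduct_separating
    (h : ∀ x : ι → ℝ, 0 ≤ x → ¬ ∀ i, (G *ᵥ x) i < x i) :
    ∃ (v : ι → ℝ) (u : ℝ), (∀ y : ι → ℝ, (∀ i, 0 < y i) → u < v ⬝ᵥ y) ∧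
      ∀ x : ι → ℝ, 0 ≤ x → v ⬝ᵥ (x - G *ᵥ x) ≤ u := by
  set orthant : Set (ι → ℝ) := univ.pi fun _ => Ioi 0
  set T : (ι → ℝ) →ₗ[ℝ] ι → ℝ := LinearMap.id - G.mulVecLin
  set cone : Set (ι → ℝ) := T '' Ici 0
  have hdisj : Disjoint orthant cone := by
    refine Set.disjoint_left.2 ?_
    rintro _ hpos ⟨x, hx, rfl⟩
    exact h x hx fun i => sub_pos.1 (hpos i (mem_univ i))
  obtain ⟨f, u, hfu, huf⟩ := geometric_hahn_banach_open (convex_pi fun i _ => convex_Ioi 0)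
    (isOpen_set_pi finite_univ fun i _ => isOpen_Ioi)
    ((convex_Ici (0 : ι → ℝ)).linear_image T) hdisj
  obtain ⟨v, hv⟩ := exists_eq_neg_dotProduct f
  refine ⟨v, -u, fun y hy => ?_, fun x hx => ?_⟩
  · have hlt := hfu y fun i _ => hy i
    rw [hv] at hlt
    linarith
  · have hle := huf _ ⟨x, hx, rfl⟩
    rw [hv] at hle
    simp only [T, LinearMap.sub_apply, LinearMap.id_apply, Matrix.mulVecLin_apply] at hle
    linarith

lemma subcritical_or_exists_le_vecMul (hG0 : ∀ i j, 0 ≤ G i j) :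
    Subcritical G ∨ ∃ v : ι → ℝ, 0 ≤ v ∧ v ≠ 0 ∧ v ≤ v ᵥ* G := by
  classical
  by_cases h : ∃ x : ι → ℝ, 0 ≤ x ∧ ∀ i, (G *ᵥ x) i < x i
  · obtain ⟨x, hx, hlt⟩ := h
    exact .inl ⟨x, fun i => (dotProduct_nonneg_of_nonneg (hG0 i) hx).trans_lt (hlt i), hlt⟩
  push Not at h
  obtain ⟨v, u, huv, hvu⟩ := exists_dotProduct_separating fun x hx hlt =>
    (h x hx).elim fun i hi => (hlt i).not_ge hi
  have hu : 0 ≤ u := by simpa using hvu 0 le_rfl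
  have hsingle : ∀ j, (0 : ι → ℝ) ≤ Pi.single j 1 := fun j => Pi.single_nonneg.2 zero_le_one
  have hv1 : 0 < v ⬝ᵥ 1 := hu.trans_lt (huv 1 fun _ => one_pos)
  refine .inr ⟨v, fun j => ?_, fun hv => by simp [hv] at hv1, fun j => ?_⟩
  · by_contra! hj
    have hmem := huv (Pi.single j 1 + (-v j / v ⬝ᵥ 1) • 1) fun i => ?_
    · rw [dotProduct_add, dotProduct_smul, dotProduct_single_one, smul_eq_mul,
        div_mul_cancel₀ _ hv1.ne', add_neg_cancel] at hmem
      exact hmem.not_ge hu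
    · simpa using add_pos_of_nonneg_of_pos (hsingle j i) (div_pos (neg_pos.2 hj) hv1)
  · by_contra! hj
    rw [← sub_pos] at hj
    have hle := hvu (((u + 1) / (v j - (v ᵥ* G) j)) • Pi.single j 1)
      (smul_nonneg (div_nonneg (by linarith) hj.le) (hsingle j))
    rw [Matrix.mulVec_smul, ← smul_sub, dotProduct_smul, dotProduct_sub, Matrix.dotProduct_mulVec,
      dotProduct_single_one, dotProduct_single_one, smul_eq_mul, div_mul_cancel₀ _ hj.ne'] at hle
    linarith

end Subcritical

section Branching

variable {K : ℕ} {θ : Params K}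

lemma βMat_inv (hβ : ∀ k i, 0 < θ.β k i) (k : Fin K) :
    (θ.βMat k)⁻¹ = Matrix.diagonal fun i => (θ.β k i)⁻¹ := by
  refine Matrix.inv_eq_left_inv ?_
  rw [Params.βMat, Matrix.diagonal_mul_diagonal]
  simp only [inv_mul_cancel₀ (hβ k _).ne', Matrix.diagonal_one]

lemma branching_apply (hβ : ∀ k i, 0 < θ.β k i) (i j : Fin 2) :
    θ.branching i j = ∑ k, (θ.β k i)⁻¹ * θ.α k i j := by
  simp only [Params.branching, Matrix.sum_apply, βMat_inv hβ, Matrix.diagonal_mul]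

lemma branching_nonneg (hα : ∀ k i j, 0 ≤ θ.α k i j) (hβ : ∀ k i, 0 < θ.β k i) (i j : Fin 2) :
    0 ≤ θ.branching i j := by
  rw [branching_apply hβ]
  exact Finset.sum_nonneg fun k _ => mul_nonneg (inv_nonneg.2 (hβ k i).le) (hα k i j)

lemma vecMul_branching_nonneg (hα : ∀ k i j, 0 ≤ θ.α k i j) (hβ : ∀ k i, 0 < θ.β k i)
    {v : Fin 2 → ℝ} (hv : 0 ≤ v) : 0 ≤ v ᵥ* θ.branching :=
  fun j => dotProduct_nonneg_of_nonneg hv fun i => branching_nonneg hα hβ i j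

lemma branching_mulVec (hβ : ∀ k i, 0 < θ.β k i) (x : Fin 2 → ℝ) (i : Fin 2) :
    (θ.branching *ᵥ x) i = ∑ k, (θ.β k i)⁻¹ * (θ.α k *ᵥ x) i := by
  simp only [Params.branching, Matrix.sum_mulVec, Finset.sum_apply, ← Matrix.mulVec_mulVec,
    βMat_inv hβ, Matrix.mulVec_diagonal]

lemma Subcritical.exists_tilt (hG : Subcritical θ.branching) (hβ : ∀ k i, 0 < θ.β k i) :
    ∃ r : Fin 2 → ℝ, ∃ ε κ : ℝ, (∀ i, 0 < r i) ∧ 0 < ε ∧ κ < 1 ∧ (∀ k i, ε < θ.β k i) ∧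
      ∀ i, ∑ k, (θ.β k i - ε)⁻¹ * (θ.α k *ᵥ r) i ≤ κ * r i := by
  obtain ⟨r, hr, hlt⟩ := hG
  have hκ : ∀ᶠ κ in 𝓝[<] (1 : ℝ), ∀ i, (θ.branching *ᵥ r) i < κ * r i := by
    refine eventually_all.2 fun i => eventually_nhdsWithin_of_eventually_nhds ?_
    have hcont : ContinuousAt (fun κ : ℝ => κ * r i) 1 := by fun_prop
    exact hcont.tendsto.eventually_const_lt (by simpa only [one_mul] using hlt i)
  obtain ⟨κ, hκ, hκ1 : κ < 1⟩ := (hκ.and self_mem_nhdsWithin).exists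
  have hβε : ∀ᶠ ε in 𝓝[>] (0 : ℝ), ∀ k i, ε < θ.β k i :=
    eventually_all.2 fun k => eventually_all.2 fun i =>
      eventually_nhdsWithin_of_eventually_nhds (eventually_lt_nhds (hβ k i))
  have hsum : ∀ᶠ ε in 𝓝[>] (0 : ℝ), ∀ i, ∑ k, (θ.β k i - ε)⁻¹ * (θ.α k *ᵥ r) i < κ * r i := by
    refine eventually_all.2 fun i => eventually_nhdsWithin_of_eventually_nhds ?_
    have hcont : Tendsto (fun ε => ∑ k, (θ.β k i - ε)⁻¹ * (θ.α k *ᵥ r) i) (𝓝 0)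
        (𝓝 (∑ k, (θ.β k i - 0)⁻¹ * (θ.α k *ᵥ r) i)) :=
      tendsto_finsetSum _ fun k _ => ((tendsto_id.const_sub _).inv₀
        (by simpa only [sub_zero] using (hβ k i).ne')).mul_const _
    refine hcont.eventually_lt_const ?_
    simpa only [sub_zero, branching_mulVec hβ] using hκ i
  obtain ⟨ε, ⟨hβε, hsum⟩, hε⟩ := ((hβε.and hsum).and self_mem_nhdsWithin).exists
  exact ⟨r, ε, κ, hr, hε, hκ1, hβε, fun i => (hsum i).le⟩

end Branching

/-! ### Renewal equations with exponential kernels -/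

section ExpConv

/-- The convolution `∫₀ᵗ e^{-b(t-v)} f(v) dv` on `[0, t]` with the exponential kernel of
rate `b`. -/
def expConv (b : ℝ) (f : ℝ → ℝ) (t : ℝ) : ℝ :=
  ∫ v in (0 : ℝ)..t, Real.exp (-b * (t - v)) * f v

lemma intervalIntegrable_exp_mul {f : ℝ → ℝ} {t : ℝ} (hf : IntervalIntegrable f volume 0 t)
    (b : ℝ) : IntervalIntegrable (fun v => Real.exp (-b * (t - v)) * f v) volume 0 t :=
  hf.continuousOn_mul (by fun_prop)

lemma expConv_sub {f g : ℝ → ℝ} {t : ℝ} (hf : IntervalIntegrable f volume 0 t)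
    (hg : IntervalIntegrable g volume 0 t) (b : ℝ) :
    expConv b (fun v => f v - g v) t = expConv b f t - expConv b g t := by
  rw [expConv, expConv, expConv, ← intervalIntegral.integral_sub (intervalIntegrable_exp_mul hf b)
    (intervalIntegrable_exp_mul hg b)]
  simp only [mul_sub (Real.exp _)]

lemma expConv_affine (b p q t : ℝ) :
    expConv b (fun v => b * (p * v + q) + p) t = p * t + q - q * Real.exp (-b * t) := by
  have hderiv : ∀ v, HasDerivAt (fun v => Real.exp (-b * (t - v)) * (p * v + q))
      (Real.exp (-b * (t - v)) * (b * (p * v + q) + p)) v := fun v => by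
    have hexponent : HasDerivAt (fun u => -b * (t - u)) b v := by
      simpa using ((hasDerivAt_id v).const_sub t).const_mul (-b)
    have haffine : HasDerivAt (fun u => p * u + q) p v := by
      simpa using ((hasDerivAt_id v).const_mul p).add_const q
    exact (hexponent.exp.mul haffine).congr_deriv (by ring)
  rw [expConv, intervalIntegral.integral_eq_sub_of_hasDerivAt (fun v _ => hderiv v)
    (Continuous.intervalIntegrable (by fun_prop) _ _)]
  simp only [sub_self, mul_zero, Real.exp_zero, one_mul, sub_zero, zero_add]
  ring

-- With `|f v| ≤ c e^{-εv}` the integrand is at most `c e^{-εt} e^{-(b-ε)(t-v)}`.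
lemma abs_expConv_le {b ε t c : ℝ} (hε : ε < b) (ht : 0 ≤ t) (hc : 0 ≤ c) {f : ℝ → ℝ}
    (hf : ∀ v ∈ Icc 0 t, |f v| ≤ c * Real.exp (-ε * v)) :
    |expConv b f t| ≤ (b - ε)⁻¹ * c * Real.exp (-ε * t) := by
  have hb : 0 < b - ε := sub_pos.2 hε
  have hle : ∀ v ∈ Ioc 0 t, ‖Real.exp (-b * (t - v)) * f v‖ ≤
      c * Real.exp (-ε * t) * Real.exp (-(b - ε) * (t - v)) := fun v hv => by
    rw [Real.norm_eq_abs, abs_mul, Real.abs_exp]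
    calc Real.exp (-b * (t - v)) * |f v| ≤ Real.exp (-b * (t - v)) * (c * Real.exp (-ε * v)) := by
          gcongr; exact hf v (Ioc_subset_Icc_self hv)
      _ = c * Real.exp (-ε * t) * Real.exp (-(b - ε) * (t - v)) := by
          rw [mul_left_comm, mul_assoc, ← Real.exp_add, ← Real.exp_add]
          ring_nf
  have hexp : expConv (b - ε) (fun _ => 1) t ≤ (b - ε)⁻¹ := by
    have h := expConv_affine (b - ε) 0 (b - ε)⁻¹ t
    simp only [zero_mul, zero_add, add_zero, mul_inv_cancel₀ hb.ne'] at h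
    rw [h, sub_le_self_iff]
    positivity
  calc |expConv b f t|
      ≤ ∫ v in (0 : ℝ)..t, c * Real.exp (-ε * t) * Real.exp (-(b - ε) * (t - v)) :=
        intervalIntegral.norm_integral_le_of_norm_le ht (ae_of_all _ hle)
          (Continuous.intervalIntegrable (by fun_prop) _ _)
    _ = c * Real.exp (-ε * t) * expConv (b - ε) (fun _ => 1) t := by
        simp only [expConv, mul_one, intervalIntegral.integral_const_mul]
    _ ≤ c * Real.exp (-ε * t) * (b - ε)⁻¹ := by gcongr
    _ = (b - ε)⁻¹ * c * Real.exp (-ε * t) := by ring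

end ExpConv

section Renewal

variable {K : ℕ} {θ : Params K}

lemma le_div_one_sub_of_self_improving {X : Type*} {g : X → ℝ} {C κ : ℝ} (hκ : κ < 1)
    (hg : BddAbove (range g)) (h : ∀ M, (∀ x, g x ≤ M) → ∀ x, g x ≤ C + κ * M) (x : X) :
    g x ≤ C / (1 - κ) := by
  have : Nonempty X := ⟨x⟩
  have hsup : ⨆ y, g y ≤ C + κ * ⨆ y, g y := ciSup_le (h _ (le_ciSup hg))
  rw [le_div_iff₀ (sub_pos.2 hκ)]
  nlinarith [le_ciSup hg x]

lemma abs_mulVec_le {ι : Type*} [Fintype ι] {G : Matrix ι ι ℝ} (hG : ∀ i j, 0 ≤ G i j)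
    {x y : ι → ℝ} (hxy : ∀ i, |x i| ≤ y i) (i : ι) : |(G *ᵥ x) i| ≤ (G *ᵥ y) i :=
  (Finset.abs_sum_le_sum_abs _ _).trans <| Finset.sum_le_sum fun j _ => by
    rw [abs_mul, abs_of_nonneg (hG i j)]
    exact mul_le_mul_of_nonneg_left (hxy j) (hG i j)

lemma sum_abs_expConv_le (hα : ∀ k i j, 0 ≤ θ.α k i j) {r : Fin 2 → ℝ} {ε κ M t : ℝ}
    (hr : ∀ i, 0 < r i) (hβε : ∀ k i, ε < θ.β k i)
    (hκ : ∀ i, ∑ k, (θ.β k i - ε)⁻¹ * (θ.α k *ᵥ r) i ≤ κ * r i) (hM : 0 ≤ M) (ht : 0 ≤ t)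
    {z : ℝ → Fin 2 → ℝ} (hz : ∀ v ∈ Icc 0 t, ∀ i, |z v i| ≤ M * (r i * Real.exp (-ε * v)))
    (i : Fin 2) :
    ∑ k, |expConv (θ.β k i) (fun v => (θ.α k *ᵥ z v) i) t| ≤
      κ * M * (r i * Real.exp (-ε * t)) := by
  have hbound : ∀ k, |expConv (θ.β k i) (fun v => (θ.α k *ᵥ z v) i) t| ≤
      (θ.β k i - ε)⁻¹ * (M * (θ.α k *ᵥ r) i) * Real.exp (-ε * t) := fun k => by
    refine abs_expConv_le (c := M * (θ.α k *ᵥ r) i) (hβε k i) ht (mul_nonneg hM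
      (dotProduct_nonneg_of_nonneg (hα k i) fun j => (hr j).le)) fun v hv => ?_
    have h := abs_mulVec_le (hα k) (y := (M * Real.exp (-ε * v)) • r)
      (fun l => (hz v hv l).trans_eq (by rw [Pi.smul_apply, smul_eq_mul]; ring)) i
    rw [Matrix.mulVec_smul, Pi.smul_apply, smul_eq_mul] at h
    exact h.trans_eq (by ring)
  calc ∑ k, |expConv (θ.β k i) (fun v => (θ.α k *ᵥ z v) i) t|
      ≤ ∑ k, (θ.β k i - ε)⁻¹ * (M * (θ.α k *ᵥ r) i) * Real.exp (-ε * t) :=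
        Finset.sum_le_sum fun k _ => hbound k
    _ = M * Real.exp (-ε * t) * ∑ k, (θ.β k i - ε)⁻¹ * (θ.α k *ᵥ r) i := by
        rw [Finset.mul_sum]
        exact Finset.sum_congr rfl fun k _ => by ring
    _ ≤ M * Real.exp (-ε * t) * (κ * r i) := by gcongr; exact hκ i
    _ = κ * M * (r i * Real.exp (-ε * t)) := by ring

lemma abs_le_of_renewal (hα : ∀ k i j, 0 ≤ θ.α k i j) {r : Fin 2 → ℝ} {ε κ C : ℝ}
    (hr : ∀ i, 0 < r i) (hε : 0 < ε) (hκ1 : κ < 1) (hβε : ∀ k i, ε < θ.β k i)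
    (hκ : ∀ i, ∑ k, (θ.β k i - ε)⁻¹ * (θ.α k *ᵥ r) i ≤ κ * r i) {z : ℝ → Fin 2 → ℝ}
    (hbdd : ∀ i T, ∃ M, ∀ t ∈ Icc 0 T, |z t i| ≤ M)
    (hz : ∀ i t, 0 ≤ t → |z t i - ∑ k, expConv (θ.β k i) (fun v => (θ.α k *ᵥ z v) i) t| ≤
      C * (r i * Real.exp (-ε * t))) (i : Fin 2) {t : ℝ} (ht : 0 ≤ t) :
    |z t i| ≤ C / (1 - κ) * (r i * Real.exp (-ε * t)) := by
  have hpos : ∀ i t, 0 < r i * Real.exp (-ε * t) := fun i t => mul_pos (hr i) (Real.exp_pos _)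
  set ratio : Fin 2 × Icc 0 t → ℝ := fun x => |z x.2 x.1| / (r x.1 * Real.exp (-ε * x.2))
  have hratio : BddAbove (range ratio) := by
    choose M hM using fun i => hbdd i t
    obtain ⟨D, hD⟩ := Finite.exists_le fun i => M i / (r i * Real.exp (-ε * t))
    refine ⟨D, ?_⟩
    rintro _ ⟨⟨l, v, hv⟩, rfl⟩
    refine (div_le_div₀ ((abs_nonneg _).trans (hM l v hv)) (hM l v hv) (hpos l t) ?_).trans (hD l)
    have := hr l
    gcongr ?_ * Real.exp ?_
    nlinarith [hv.2]
  refine (div_le_iff₀ (hpos i t)).1 (le_div_one_sub_of_self_improving hκ1 hratio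
    (fun M hM => ?_) (i, ⟨t, ht, le_rfl⟩))
  have hM0 : 0 ≤ M := (div_nonneg (abs_nonneg _) (hpos _ _).le).trans (hM (i, ⟨t, ht, le_rfl⟩))
  rintro ⟨l, v, hv⟩
  refine (div_le_iff₀ (hpos l v)).2 ?_
  have hconv := sum_abs_expConv_le hα hr hβε hκ hM0 hv.1
    (fun u hu j => (div_le_iff₀ (hpos j u)).1 (hM (j, ⟨u, hu.1, hu.2.trans hv.2⟩))) l
  have htri := abs_sub_abs_le_abs_sub (z v l)
    (∑ k, expConv (θ.β k l) (fun u => (θ.α k *ᵥ z u) l) v)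
  have hsum := (Finset.abs_sum_le_sum_abs (fun k =>
    expConv (θ.β k l) (fun u => (θ.α k *ᵥ z u) l) v) Finset.univ)
  linarith [hz l v hv.1]

lemma Subcritical.tendsto_zero_of_renewal (hG : Subcritical θ.branching)
    (hα : ∀ k i j, 0 ≤ θ.α k i j) (hβ : ∀ k i, 0 < θ.β k i) {z : ℝ → Fin 2 → ℝ}
    {c : Fin K → Fin 2 → ℝ} (hbdd : ∀ i T, ∃ M, ∀ t ∈ Icc 0 T, |z t i| ≤ M)
    (hz : ∀ i t, 0 ≤ t → z t i = ∑ k, (c k i * Real.exp (-θ.β k i * t) +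
      expConv (θ.β k i) (fun v => (θ.α k *ᵥ z v) i) t)) (i : Fin 2) :
    Tendsto (fun t => z t i) atTop (𝓝 0) := by
  obtain ⟨r, ε, κ, hr, hε, hκ1, hβε, hκ⟩ := hG.exists_tilt hβ
  obtain ⟨C, hC⟩ := Finite.exists_le fun i => (∑ k, |c k i|) / r i
  have hz' : ∀ i t, 0 ≤ t → |z t i - ∑ k, expConv (θ.β k i) (fun v => (θ.α k *ᵥ z v) i) t| ≤
      C * (r i * Real.exp (-ε * t)) := fun i t ht => by
    rw [hz i t ht, Finset.sum_add_distrib, add_sub_cancel_right]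
    calc |∑ k, c k i * Real.exp (-θ.β k i * t)|
        ≤ ∑ k, |c k i * Real.exp (-θ.β k i * t)| := Finset.abs_sum_le_sum_abs _ _
      _ ≤ ∑ k, |c k i| * Real.exp (-ε * t) := Finset.sum_le_sum fun k _ => by
          rw [abs_mul, Real.abs_exp]
          gcongr
          exact (hβε k i).le
      _ ≤ C * r i * Real.exp (-ε * t) := by
          rw [← Finset.sum_mul]
          gcongr
          exact (div_le_iff₀ (hr i)).1 (hC i)
      _ = C * (r i * Real.exp (-ε * t)) := mul_assoc _ _ _
  have hexp : Tendsto (fun t => C / (1 - κ) * (r i * Real.exp (-ε * t))) atTop (𝓝 0) := by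
    have h : Tendsto (fun t => Real.exp (-ε * t)) atTop (𝓝 0) :=
      Real.tendsto_exp_atBot.comp (tendsto_id.const_mul_atTop_of_neg (neg_lt_zero.2 hε))
    simpa only [mul_zero] using (h.const_mul (r i)).const_mul (C / (1 - κ))
  refine squeeze_zero_norm' ?_ hexp
  filter_upwards [eventually_ge_atTop 0] with t ht
  exact abs_le_of_renewal hα hr hε hκ1 hβε hκ hbdd hz' i ht

-- The affine path `t A + B` solves the same renewal equation up to exponentially small terms.
lemma affine_eq_renewal (hβ : ∀ k i, 0 < θ.β k i) {a A B : Fin 2 → ℝ} {q : Fin K → Fin 2 → ℝ}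
    (hA : A = a + θ.branching *ᵥ A) (hB : ∀ i, B i = (θ.branching *ᵥ B) i +
      ∑ k, (θ.β k i)⁻¹ * (q k i - (θ.β k i)⁻¹ * (θ.α k *ᵥ A) i)) :
    ∃ r : Fin K → Fin 2 → ℝ, ∀ i t, t * A i + B i = a i * t + ∑ k, (r k i *
      Real.exp (-θ.β k i * t) +
        expConv (θ.β k i) (fun v => q k i + (θ.α k *ᵥ (v • A + B)) i) t) := by
  set p : Fin K → Fin 2 → ℝ := fun k i => (θ.β k i)⁻¹ * (θ.α k *ᵥ A) i with hp
  set r : Fin K → Fin 2 → ℝ := fun k i => (θ.β k i)⁻¹ * (q k i + (θ.α k *ᵥ B) i - p k i) with hr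
  refine ⟨r, fun i t => ?_⟩
  have hAp : A i = a i + ∑ k, p k i := by
    rw [← branching_mulVec hβ, ← Pi.add_apply, ← hA]
  have hBr : B i = ∑ k, r k i := by
    rw [hB, branching_mulVec hβ, ← Finset.sum_add_distrib]
    exact Finset.sum_congr rfl fun k _ => by simp only [hr, hp]; ring
  have hconv : ∀ k, expConv (θ.β k i) (fun v => q k i + (θ.α k *ᵥ (v • A + B)) i) t =
      p k i * t + r k i - r k i * Real.exp (-θ.β k i * t) := fun k => by
    rw [← expConv_affine]
    congr 1
    funext v
    have hb := (hβ k i).ne'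
    rw [Matrix.mulVec_add, Matrix.mulVec_smul, Pi.add_apply, Pi.smul_apply, smul_eq_mul]
    simp only [hr, hp]
    field_simp
    ring
  simp only [hconv, add_sub_cancel, Finset.sum_add_distrib, ← Finset.sum_mul, ← hBr]
  rw [hAp]
  ring

lemma Subcritical.tendsto_sub_affine_of_renewal (hG : Subcritical θ.branching)
    (hα : ∀ k i j, 0 ≤ θ.α k i j) (hβ : ∀ k i, 0 < θ.β k i) {Z : ℝ → Fin 2 → ℝ}
    (hbdd : ∀ i T, ∃ M, ∀ t ∈ Icc 0 T, |Z t i| ≤ M)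
    (hint : ∀ i t, 0 ≤ t → IntervalIntegrable (fun v => Z v i) volume 0 t)
    {a A B : Fin 2 → ℝ} {q : Fin K → Fin 2 → ℝ}
    (hZ : ∀ i t, 0 ≤ t → Z t i = a i * t +
      ∑ k, expConv (θ.β k i) (fun v => q k i + (θ.α k *ᵥ Z v) i) t)
    (hA : A = a + θ.branching *ᵥ A) (hB : ∀ i, B i = (θ.branching *ᵥ B) i +
      ∑ k, (θ.β k i)⁻¹ * (q k i - (θ.β k i)⁻¹ * (θ.α k *ᵥ A) i)) (i : Fin 2) :
    Tendsto (fun t => Z t i - (t * A i + B i)) atTop (𝓝 0) := by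
  obtain ⟨r, hr⟩ := affine_eq_renewal hβ hA hB
  refine hG.tendsto_zero_of_renewal hα hβ (z := fun t => Z t - (t • A + B))
    (c := fun k i => -r k i) (fun i T => ?_) (fun i t ht => ?_) i
  · obtain ⟨M, hM⟩ := hbdd i T
    obtain ⟨M', hM'⟩ := (isCompact_Icc (a := 0) (b := T)).exists_bound_of_continuousOn
      (f := fun t => t * A i + B i) (by fun_prop)
    exact ⟨M + M', fun t ht => (abs_sub _ _).trans (add_le_add (hM t ht) (hM' t ht))⟩
  · have hconv : ∀ k, expConv (θ.β k i) (fun v => (θ.α k *ᵥ (Z v - (v • A + B))) i) t =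
        expConv (θ.β k i) (fun v => q k i + (θ.α k *ᵥ Z v) i) t -
          expConv (θ.β k i) (fun v => q k i + (θ.α k *ᵥ (v • A + B)) i) t := fun k => by
      rw [← expConv_sub]
      · simp only [Matrix.mulVec_sub, Pi.sub_apply, add_sub_add_left_eq_sub]
      · refine intervalIntegrable_const.add ?_
        simpa only [Matrix.mulVec, dotProduct, Finset.sum_fn] using IntervalIntegrable.sum
          (f := fun l v => θ.α k i l * Z v l) Finset.univ fun l _ => (hint l t ht).const_mul _
      · exact Continuous.intervalIntegrable (by fun_prop) _ _
    simp only [hconv, Pi.sub_apply, Pi.add_apply, Pi.smul_apply, smul_eq_mul]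
    rw [hZ i t ht, hr i t]
    simp only [neg_mul, Finset.sum_add_distrib, Finset.sum_sub_distrib, Finset.sum_neg_distrib]
    ring

end Renewal

/-! ### Laplace transforms and moments -/

section LaplaceLimits

variable {α : Type*} {mα : MeasurableSpace α} {ν : Measure α}

lemma integrable_of_tendsto_of_integral_le {ι : Type*} {l : Filter ι} [l.NeBot]
    [l.IsCountablyGenerated] {f : ι → α → ℝ} {g : α → ℝ} {C : ℝ}
    (hf : ∀ᶠ n in l, Integrable (f n) ν ∧ (∀ x, 0 ≤ f n x) ∧ ∫ x, f n x ∂ν ≤ C)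
    (hlim : ∀ x, Tendsto (fun n => f n x) l (𝓝 (g x))) : Integrable g ν := by
  obtain ⟨u, hu, hfu⟩ := exists_seq_forall_of_frequently hf.frequently
  have hlim' : ∀ x, Tendsto (fun n => f (u n) x) atTop (𝓝 (g x)) := fun x => (hlim x).comp hu
  refine ⟨aestronglyMeasurable_of_tendsto_ae atTop (fun n => (hfu n).1.aestronglyMeasurable)
    (ae_of_all _ hlim'), lt_of_le_of_lt ?_ (ENNReal.ofReal_lt_top (r := C))⟩
  calc ∫⁻ x, ‖g x‖ₑ ∂ν = ∫⁻ x, liminf (fun n => ‖f (u n) x‖ₑ) atTop ∂ν :=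
        lintegral_congr fun x => (hlim' x).enorm.liminf_eq.symm
    _ ≤ liminf (fun n => ∫⁻ x, ‖f (u n) x‖ₑ ∂ν) atTop :=
        lintegral_liminf_le' fun n => (hfu n).1.aestronglyMeasurable.enorm
    _ ≤ ENNReal.ofReal C := by
        refine liminf_le_of_frequently_le' (Frequently.of_forall fun n => ?_)
        obtain ⟨hint, hnonneg, hle⟩ := hfu n
        simp only [Real.enorm_of_nonneg (hnonneg _)]
        rw [← ofReal_integral_eq_lintegral_ofReal hint (ae_of_all _ hnonneg)]
        exact ENNReal.ofReal_le_ofReal hle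

lemma one_sub_exp_neg_le (x : ℝ) : 1 - Real.exp (-x) ≤ x := by
  linarith [Real.add_one_le_exp (-x)]

lemma sub_sq_half_le_one_sub_exp_neg {x : ℝ} (hx : 0 ≤ x) : x - x ^ 2 / 2 ≤ 1 - Real.exp (-x) := by
  have hexp : Real.exp (-x) ≤ 1 - x + x ^ 2 / 2 := by
    rw [Real.exp_neg, inv_le_iff_one_le_mul₀ (Real.exp_pos x)]
    have h0 : 0 ≤ 1 - x + x ^ 2 / 2 := by nlinarith [sq_nonneg (x - 1)]
    nlinarith [mul_le_mul_of_nonneg_left (Real.quadratic_le_exp_of_nonneg hx) h0,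
      sq_nonneg (x ^ 2)]
  linarith

lemma mul_le_one_sub_exp_neg {s x y V : ℝ} (hs : 0 ≤ s) (hx : 0 ≤ x) (hxy : x ≤ y) (hxV : x ≤ V) :
    s * (1 - s * V / 2) * x ≤ 1 - Real.exp (-(s * y)) := by
  have hmono : Real.exp (-(s * y)) ≤ Real.exp (-(s * x)) := by gcongr
  have hquad := sub_sq_half_le_one_sub_exp_neg (mul_nonneg hs hx)
  nlinarith [mul_le_mul_of_nonneg_left hxV (mul_nonneg (sq_nonneg s) hx)]

lemma tendsto_one_sub_exp_neg_div (a : ℝ) :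
    Tendsto (fun s => (1 - Real.exp (-(s * a))) / s) (𝓝[>] 0) (𝓝 a) := by
  have hderiv : HasDerivAt (fun s => 1 - Real.exp (-(s * a))) a 0 := by
    simpa using ((hasDerivAt_mul_const (x := 0) a).neg.exp).const_sub 1
  have h := (hasDerivAt_iff_tendsto_slope_zero.1 hderiv).mono_left (nhdsGT_le_nhdsNE 0)
  simpa [div_eq_inv_mul] using h

lemma mul_exp_neg_mul_le {C s a b : ℝ} (hC : 0 ≤ C) (hs : 0 ≤ s) (hb : b ≤ C * a) :
    s * (Real.exp (-(s * a)) * b) ≤ C := by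
  calc s * (Real.exp (-(s * a)) * b) ≤ s * (Real.exp (-(s * a)) * (C * a)) := by gcongr
    _ = C * (s * a * Real.exp (-(s * a))) := by ring
    _ ≤ C * 1 := by
        gcongr
        exact (Real.mul_exp_neg_le_exp_neg_one _).trans (Real.exp_le_one_iff.2 (by norm_num))
    _ = C := mul_one C

lemma tendsto_integral_exp_neg_mul_mul {a f : α → ℝ} (ha : Measurable a) (ha0 : ∀ x, 0 ≤ a x)
    (hf : Integrable f ν) :
    Tendsto (fun s => ∫ x, Real.exp (-(s * a x)) * f x ∂ν) (𝓝[>] 0) (𝓝 (∫ x, f x ∂ν)) := by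
  refine tendsto_integral_filter_of_dominated_convergence (fun x => ‖f x‖)
    (Eventually.of_forall fun s => AEStronglyMeasurable.mul (by fun_prop) hf.1)
    (eventually_nhdsWithin_of_forall fun s (hs : 0 < s) => ae_of_all _ fun x => ?_) hf.norm
    (ae_of_all _ fun x => tendsto_nhdsWithin_of_tendsto_nhds ?_)
  · rw [norm_mul, Real.norm_eq_abs, Real.abs_exp]
    refine mul_le_of_le_one_left (norm_nonneg _) (Real.exp_le_one_iff.2 ?_)
    exact neg_nonpos.2 (mul_nonneg hs.le (ha0 x))
  · have hcont : ContinuousAt (fun s => Real.exp (-(s * a x)) * f x) 0 := by fun_prop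
    simpa [ContinuousAt] using hcont

lemma integrable_exp_neg_mul_mul [IsFiniteMeasure ν] {C s : ℝ} {a b : α → ℝ} (ha : Measurable a)
    (hb : Measurable b) (hb0 : ∀ x, 0 ≤ b x) (hC : 0 ≤ C) (hab : ∀ x, b x ≤ C * a x)
    (hs : 0 < s) : Integrable (fun x => Real.exp (-(s * a x)) * b x) ν := by
  refine Integrable.of_bound (by fun_prop) (C / s) (ae_of_all _ fun x => ?_)
  rw [Real.norm_of_nonneg (mul_nonneg (Real.exp_pos _).le (hb0 x)), le_div_iff₀' hs]
  exact mul_exp_neg_mul_le hC hs.le (hab x)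

lemma tendsto_mul_integral_exp_neg_mul_mul [IsFiniteMeasure ν] {C : ℝ} {a b : α → ℝ}
    (ha : Measurable a) (hb : Measurable b) (hb0 : ∀ x, 0 ≤ b x) (hC : 0 ≤ C)
    (hab : ∀ x, b x ≤ C * a x) :
    Tendsto (fun s => s * ∫ x, Real.exp (-(s * a x)) * b x ∂ν) (𝓝[>] 0) (𝓝 0) := by
  suffices h : Tendsto (fun s => ∫ x, s * (Real.exp (-(s * a x)) * b x) ∂ν) (𝓝[>] 0)
      (𝓝 (∫ _, (0 : ℝ) ∂ν)) by
    simpa only [integral_const_mul, integral_zero] using h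
  refine tendsto_integral_filter_of_dominated_convergence (fun _ => C)
    (Eventually.of_forall fun s => by fun_prop)
    (eventually_nhdsWithin_of_forall fun s (hs : 0 < s) => ae_of_all _ fun x => ?_)
    (integrable_const C) (ae_of_all _ fun x => tendsto_nhdsWithin_of_tendsto_nhds ?_)
  · rw [Real.norm_of_nonneg (mul_nonneg hs.le (mul_nonneg (Real.exp_pos _).le (hb0 x)))]
    exact mul_exp_neg_mul_le hC hs.le (hab x)
  · have hcont : ContinuousAt (fun s => s * (Real.exp (-(s * a x)) * b x)) 0 := by fun_prop
    simpa [ContinuousAt] using hcont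

end LaplaceLimits

section Functionals

variable {K : ℕ} {θ : Params K}

/-- The intensity `λ_j` as a function of the vector `x` of all components `λ_{ki}`. -/
def rate (θ : Params K) (x : Fin K → Fin 2 → ℝ) (j : Fin 2) : ℝ :=
  θ.μ j + ∑ k, x k j

/-- The linear functional with coefficients `c` of the vector `x` of all components. -/
def pairing (c x : Fin K → Fin 2 → ℝ) : ℝ :=
  ∑ k, ∑ i, c k i * x k i

/-- The jump of the linear functional with coefficients `c` at an event of type `j`. -/
def gain (θ : Params K) (c : Fin K → Fin 2 → ℝ) (j : Fin 2) : ℝ :=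
  ∑ k, ∑ i, c k i * θ.α k i j

/-- The coefficients `v_i / β_{ki}`: the corresponding functional of the components is the total
mass `∑ v_i λ_{ki}` that they release, without further events, from the present time on. -/
def potentialWeight (θ : Params K) (v : Fin 2 → ℝ) : Fin K → Fin 2 → ℝ :=
  fun k i => (θ.β k i)⁻¹ * v i

@[fun_prop]
lemma measurable_rate (θ : Params K) (j : Fin 2) : Measurable fun x => rate θ x j := by
  unfold rate
  fun_prop

@[fun_prop]
lemma measurable_pairing (c : Fin K → Fin 2 → ℝ) : Measurable (pairing c) := by
  unfold pairing
  fun_prop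

lemma rate_nonneg (hμ : ∀ i, 0 < θ.μ i) {x : Fin K → Fin 2 → ℝ} (hx : 0 ≤ x) (j : Fin 2) :
    0 ≤ rate θ x j :=
  add_nonneg (hμ j).le (Finset.sum_nonneg fun k _ => hx k j)

lemma pairing_nonneg {c x : Fin K → Fin 2 → ℝ} (hc : 0 ≤ c) (hx : 0 ≤ x) : 0 ≤ pairing c x :=
  Finset.sum_nonneg fun k _ => Finset.sum_nonneg fun i _ => mul_nonneg (hc k i) (hx k i)

lemma mul_le_pairing {c x : Fin K → Fin 2 → ℝ} (hc : 0 ≤ c) (hx : 0 ≤ x) (k : Fin K)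
    (i : Fin 2) : c k i * x k i ≤ pairing c x :=
  have hterm : ∀ k i, 0 ≤ c k i * x k i := fun k i => mul_nonneg (hc k i) (hx k i)
  (Finset.single_le_sum (f := fun i => c k i * x k i) (fun i _ => hterm k i)
    (Finset.mem_univ i)).trans <|
  Finset.single_le_sum (f := fun k => ∑ i, c k i * x k i)
    (fun k _ => Finset.sum_nonneg fun i _ => hterm k i) (Finset.mem_univ k)

lemma pairing_mono {c c' x : Fin K → Fin 2 → ℝ} (hc : c ≤ c') (hx : 0 ≤ x) :
    pairing c x ≤ pairing c' x :=
  Finset.sum_le_sum fun k _ => Finset.sum_le_sum fun i _ =>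
    mul_le_mul_of_nonneg_right (hc k i) (hx k i)

lemma pairing_smul (s : ℝ) (c x : Fin K → Fin 2 → ℝ) : pairing (s • c) x = s * pairing c x := by
  simp only [pairing, Pi.smul_apply, smul_eq_mul, Finset.mul_sum, mul_assoc]

lemma pairing_sub (c c' x : Fin K → Fin 2 → ℝ) :
    pairing (c - c') x = pairing c x - pairing c' x := by
  simp only [pairing, Pi.sub_apply, sub_mul, Finset.sum_sub_distrib]

lemma pairing_add_right (c x y : Fin K → Fin 2 → ℝ) :
    pairing c (x + y) = pairing c x + pairing c y := by
  simp only [pairing, Pi.add_apply, mul_add, Finset.sum_add_distrib]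

lemma gain_smul (s : ℝ) (c : Fin K → Fin 2 → ℝ) (j : Fin 2) :
    gain θ (s • c) j = s * gain θ c j := by
  simp only [gain, Pi.smul_apply, smul_eq_mul, Finset.mul_sum, mul_assoc]

lemma gain_nonneg (hα : ∀ k i j, 0 ≤ θ.α k i j) {c : Fin K → Fin 2 → ℝ} (hc : 0 ≤ c) (j : Fin 2) :
    0 ≤ gain θ c j :=
  Finset.sum_nonneg fun k _ => Finset.sum_nonneg fun i _ => mul_nonneg (hc k i) (hα k i j)

lemma sum_mul_rate (v : Fin 2 → ℝ) (x : Fin K → Fin 2 → ℝ) :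
    ∑ j, v j * rate θ x j = v ⬝ᵥ θ.μ + pairing (fun _ => v) x := by
  simp only [rate, pairing, dotProduct, mul_add, Finset.sum_add_distrib, Finset.mul_sum]
  rw [Finset.sum_comm]

lemma potentialWeight_pos (hβ : ∀ k i, 0 < θ.β k i) {v : Fin 2 → ℝ} (hv : ∀ i, 0 < v i)
    (k : Fin K) (i : Fin 2) : 0 < potentialWeight θ v k i :=
  mul_pos (inv_pos.2 (hβ k i)) (hv i)

lemma potentialWeight_nonneg (hβ : ∀ k i, 0 < θ.β k i) {v : Fin 2 → ℝ} (hv : 0 ≤ v) :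
    0 ≤ potentialWeight θ v :=
  fun k i => mul_nonneg (inv_nonneg.2 (hβ k i).le) (hv i)

lemma β_mul_potentialWeight (hβ : ∀ k i, 0 < θ.β k i) (v : Fin 2 → ℝ) :
    θ.β * potentialWeight θ v = fun _ => v := by
  funext k i
  exact mul_inv_cancel_left₀ (hβ k i).ne' (v i)

lemma gain_potentialWeight (hβ : ∀ k i, 0 < θ.β k i) (v : Fin 2 → ℝ) (j : Fin 2) :
    gain θ (potentialWeight θ v) j = (v ᵥ* θ.branching) j := by
  simp only [gain, potentialWeight, Matrix.vecMul, dotProduct, branching_apply hβ, Finset.mul_sum]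
  rw [Finset.sum_comm]
  exact Finset.sum_congr rfl fun i _ => Finset.sum_congr rfl fun k _ => by ring

lemma pairing_β_mul_le (hβ : ∀ k i, 0 < θ.β k i) {c x : Fin K → Fin 2 → ℝ} (hc : 0 ≤ c)
    (hx : 0 ≤ x) : pairing (θ.β * c) x ≤ (∑ k, ∑ i, θ.β k i) * pairing c x := by
  rw [← pairing_smul]
  refine pairing_mono (fun k i => mul_le_mul_of_nonneg_right ?_ (hc k i)) hx
  exact (Finset.single_le_sum (f := θ.β k) (fun i _ => (hβ k i).le) (Finset.mem_univ i)).trans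
    (Finset.single_le_sum (f := fun k => ∑ i, θ.β k i)
      (fun k _ => Finset.sum_nonneg fun i _ => (hβ k i).le) (Finset.mem_univ k))

end Functionals

section Moments

variable {Ω : Type*} {mΩ : MeasurableSpace Ω} {P : Measure Ω} {K : ℕ} {θ : Params K}
  {X : Ω → Fin K → Fin 2 → ℝ}

/-- The mean rate of change of the linear functional with coefficients `c`: it jumps by
`gain θ c j` at rate `λ_j`, and it decays between the events. -/
def drift (θ : Params K) (c x : Fin K → Fin 2 → ℝ) : ℝ :=
  ∑ j, gain θ c j * rate θ x j - pairing (θ.β * c) x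

/-- The law of `X` is balanced for the functionals `exp (-⟨c, x⟩)`: their expected increase through
decay equals their expected decrease through jumps. Every stationary state satisfies this. -/
def LaplaceIdentity (θ : Params K) (P : Measure Ω) (X : Ω → Fin K → Fin 2 → ℝ) : Prop :=
  ∀ c, 0 ≤ c →
    Integrable (fun ω => Real.exp (-pairing c (X ω)) *
      ∑ j, (1 - Real.exp (-gain θ c j)) * rate θ (X ω) j) P ∧
    ∫ ω, Real.exp (-pairing c (X ω)) * ∑ j, (1 - Real.exp (-gain θ c j)) * rate θ (X ω) j ∂P =
      ∫ ω, Real.exp (-pairing c (X ω)) * pairing (θ.β * c) (X ω) ∂P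

lemma integrable_exp_neg_mul_pairing_mul [IsProbabilityMeasure P] (hX : Measurable X)
    (hX0 : ∀ ω, 0 ≤ X ω) {c : Fin K → Fin 2 → ℝ} (hc : 0 ≤ c) {s : ℝ} (hs : 0 ≤ s) {f : Ω → ℝ}
    (hf : Integrable f P) :
    Integrable (fun ω => Real.exp (-(s * pairing c (X ω))) * f ω) P := by
  refine hf.bdd_mul (c := 1) (Measurable.aestronglyMeasurable (by fun_prop))
    (ae_of_all _ fun ω => ?_)
  rw [Real.norm_eq_abs, Real.abs_exp, Real.exp_le_one_iff, neg_nonpos]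
  exact mul_nonneg hs (pairing_nonneg hc (hX0 ω))

lemma integrable_exp_neg_mul_pairing_mul_pairing [IsProbabilityMeasure P]
    (hβ : ∀ k i, 0 < θ.β k i) (hX : Measurable X) (hX0 : ∀ ω, 0 ≤ X ω) {c : Fin K → Fin 2 → ℝ}
    (hc : 0 ≤ c) {s : ℝ} (hs : 0 < s) :
    Integrable (fun ω => Real.exp (-(s * pairing c (X ω))) * pairing (θ.β * c) (X ω)) P :=
  integrable_exp_neg_mul_mul (by fun_prop) (by fun_prop)
    (fun ω => pairing_nonneg (fun k i => mul_nonneg (hβ k i).le (hc k i)) (hX0 ω))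
    (Finset.sum_nonneg fun k _ => Finset.sum_nonneg fun i _ => (hβ k i).le)
    (fun ω => pairing_β_mul_le hβ hc (hX0 ω)) hs

lemma integrable_exp_neg_mul_pairing_mul_rate [IsProbabilityMeasure P] (hX : Measurable X)
    (hX0 : ∀ ω, 0 ≤ X ω) {c : Fin K → Fin 2 → ℝ} (hc : ∀ k i, 0 < c k i) {s : ℝ} (hs : 0 < s)
    (j : Fin 2) : Integrable (fun ω => Real.exp (-(s * pairing c (X ω))) * rate θ (X ω) j) P := by
  have hc0 : 0 ≤ c := fun k i => (hc k i).le
  simp only [rate, mul_add, Finset.mul_sum]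
  refine (integrable_exp_neg_mul_pairing_mul hX hX0 hc0 hs.le (integrable_const _)).add
    (integrable_finsetSum _ fun k _ => ?_)
  refine integrable_exp_neg_mul_mul (C := (c k j)⁻¹) (by fun_prop) (by fun_prop)
    (fun ω => hX0 ω k j) (inv_pos.2 (hc k j)).le (fun ω => ?_) hs
  rw [le_inv_mul_iff₀ (hc k j)]
  exact mul_le_pairing hc0 (hX0 ω) k j

lemma integrable_pairing (hX : ∀ k i, Integrable (fun ω => X ω k i) P)
    (c : Fin K → Fin 2 → ℝ) : Integrable (fun ω => pairing c (X ω)) P :=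
  integrable_finsetSum _ fun k _ => integrable_finsetSum _ fun i _ => (hX k i).const_mul _

lemma integrable_rate [IsFiniteMeasure P] (hX : ∀ k i, Integrable (fun ω => X ω k i) P)
    (j : Fin 2) : Integrable (fun ω => rate θ (X ω) j) P :=
  (integrable_const _).add (integrable_finsetSum _ fun k _ => hX k j)

lemma integrable_drift [IsFiniteMeasure P] (hX : ∀ k i, Integrable (fun ω => X ω k i) P)
    (c : Fin K → Fin 2 → ℝ) : Integrable (fun ω => drift θ c (X ω)) P :=
  (integrable_finsetSum _ fun j _ => (integrable_rate hX j).const_mul _).sub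
    (integrable_pairing hX _)

lemma drift_potentialWeight (hβ : ∀ k i, 0 < θ.β k i) (v : Fin 2 → ℝ) (x : Fin K → Fin 2 → ℝ) :
    drift θ (potentialWeight θ v) x =
      (v ᵥ* θ.branching) ⬝ᵥ θ.μ - pairing (fun _ => v - v ᵥ* θ.branching) x := by
  have hsub := pairing_sub (fun _ => v) (fun _ => v ᵥ* θ.branching) x
  simp only [drift, gain_potentialWeight hβ, sum_mul_rate, β_mul_potentialWeight hβ]
  rw [show (fun _ : Fin K => v - v ᵥ* θ.branching) =
    (fun _ => v) - (fun _ => v ᵥ* θ.branching) from rfl, hsub]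
  ring

lemma LaplaceIdentity.smul (hL : LaplaceIdentity θ P X) {c : Fin K → Fin 2 → ℝ} (hc : 0 ≤ c)
    {s : ℝ} (hs : 0 ≤ s) :
    Integrable (fun ω => Real.exp (-(s * pairing c (X ω))) *
      ∑ j, (1 - Real.exp (-(s * gain θ c j))) * rate θ (X ω) j) P ∧
    ∫ ω, Real.exp (-(s * pairing c (X ω))) *
        ∑ j, (1 - Real.exp (-(s * gain θ c j))) * rate θ (X ω) j ∂P =
      s * ∫ ω, Real.exp (-(s * pairing c (X ω))) * pairing (θ.β * c) (X ω) ∂P := by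
  have h := hL (s • c) (smul_nonneg hs hc)
  simp only [mul_smul_comm, pairing_smul, gain_smul] at h
  refine ⟨h.1, h.2.trans ?_⟩
  rw [← integral_const_mul]
  exact integral_congr_ae (ae_of_all _ fun ω => by ring)

lemma LaplaceIdentity.integral_exp_mul_drift_eq [IsProbabilityMeasure P]
    (hL : LaplaceIdentity θ P X) (hβ : ∀ k i, 0 < θ.β k i) (hX : Measurable X)
    (hX0 : ∀ ω, 0 ≤ X ω) {c : Fin K → Fin 2 → ℝ} (hc : 0 ≤ c) {s : ℝ} (hs : 0 < s)
    (hrate : ∀ j, Integrable (fun ω => Real.exp (-(s * pairing c (X ω))) * rate θ (X ω) j) P) :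
    s * ∫ ω, Real.exp (-(s * pairing c (X ω))) * drift θ c (X ω) ∂P =
      ∑ j, (s * gain θ c j - (1 - Real.exp (-(s * gain θ c j)))) *
        ∫ ω, Real.exp (-(s * pairing c (X ω))) * rate θ (X ω) j ∂P := by
  have hsum : ∀ b : Fin 2 → ℝ, ∫ ω, Real.exp (-(s * pairing c (X ω))) *
      ∑ j, b j * rate θ (X ω) j ∂P =
      ∑ j, b j * ∫ ω, Real.exp (-(s * pairing c (X ω))) * rate θ (X ω) j ∂P := fun b => by
    simp only [Finset.mul_sum, mul_left_comm _ (b _)]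
    rw [integral_finsetSum _ fun j _ => (hrate j).const_mul _]
    simp only [integral_const_mul]
  have hgain : Integrable (fun ω => Real.exp (-(s * pairing c (X ω))) *
      ∑ j, gain θ c j * rate θ (X ω) j) P := by
    simp only [Finset.mul_sum, mul_left_comm _ (gain θ c _)]
    exact integrable_finsetSum _ fun j _ => (hrate j).const_mul _
  simp only [drift, mul_sub]
  rw [integral_sub hgain (integrable_exp_neg_mul_pairing_mul_pairing hβ hX hX0 hc hs), mul_sub,
    ← (hL.smul hc hs.le).2, hsum, hsum, Finset.mul_sum, ← Finset.sum_sub_distrib]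
  exact Finset.sum_congr rfl fun j _ => by ring

lemma LaplaceIdentity.integral_exp_mul_drift_nonneg [IsProbabilityMeasure P]
    (hL : LaplaceIdentity θ P X) (hμ : ∀ i, 0 < θ.μ i) (hβ : ∀ k i, 0 < θ.β k i)
    (hX : Measurable X) (hX0 : ∀ ω, 0 ≤ X ω) {c : Fin K → Fin 2 → ℝ} (hc : 0 ≤ c)
    {s : ℝ} (hs : 0 < s)
    (hrate : ∀ j, Integrable (fun ω => Real.exp (-(s * pairing c (X ω))) * rate θ (X ω) j) P) :
    0 ≤ ∫ ω, Real.exp (-(s * pairing c (X ω))) * drift θ c (X ω) ∂P := by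
  refine nonneg_of_mul_nonneg_right ?_ hs
  rw [hL.integral_exp_mul_drift_eq hβ hX hX0 hc hs hrate]
  exact Finset.sum_nonneg fun j _ => mul_nonneg (sub_nonneg.2 (one_sub_exp_neg_le _))
    (integral_nonneg fun ω => mul_nonneg (Real.exp_pos _).le (rate_nonneg hμ (hX0 ω) j))

lemma LaplaceIdentity.integral_exp_mul_drift_le [IsProbabilityMeasure P]
    (hL : LaplaceIdentity θ P X) (hμ : ∀ i, 0 < θ.μ i) (hα : ∀ k i j, 0 ≤ θ.α k i j)
    (hβ : ∀ k i, 0 < θ.β k i) (hX : Measurable X) (hX0 : ∀ ω, 0 ≤ X ω)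
    (hXint : ∀ k i, Integrable (fun ω => X ω k i) P) {c : Fin K → Fin 2 → ℝ} (hc : 0 ≤ c)
    {s : ℝ} (hs : 0 < s) :
    ∫ ω, Real.exp (-(s * pairing c (X ω))) * drift θ c (X ω) ∂P ≤
      s * ∑ j, gain θ c j ^ 2 / 2 * ∫ ω, rate θ (X ω) j ∂P := by
  have hrate : ∀ j, Integrable (fun ω => Real.exp (-(s * pairing c (X ω))) * rate θ (X ω) j) P :=
    fun j => integrable_exp_neg_mul_pairing_mul hX hX0 hc hs.le (integrable_rate hXint j)
  refine le_of_mul_le_mul_left ?_ hs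
  rw [hL.integral_exp_mul_drift_eq hβ hX hX0 hc hs hrate, Finset.mul_sum, Finset.mul_sum]
  refine Finset.sum_le_sum fun j _ => ?_
  have hQ : ∫ ω, Real.exp (-(s * pairing c (X ω))) * rate θ (X ω) j ∂P ≤
      ∫ ω, rate θ (X ω) j ∂P :=
    integral_mono (hrate j) (integrable_rate hXint j) fun ω =>
      mul_le_of_le_one_left (rate_nonneg hμ (hX0 ω) j) <| Real.exp_le_one_iff.2 <|
        neg_nonpos.2 (mul_nonneg hs.le (pairing_nonneg hc (hX0 ω)))
  have hexp := sub_sq_half_le_one_sub_exp_neg (mul_nonneg hs.le (gain_nonneg hα hc j))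
  have hm : 0 ≤ ∫ ω, rate θ (X ω) j ∂P := integral_nonneg fun ω => rate_nonneg hμ (hX0 ω) j
  calc _ ≤ (s * gain θ c j - (1 - Real.exp (-(s * gain θ c j)))) * ∫ ω, rate θ (X ω) j ∂P :=
        mul_le_mul_of_nonneg_left hQ (sub_nonneg.2 (one_sub_exp_neg_le _))
    _ ≤ (s * gain θ c j) ^ 2 / 2 * ∫ ω, rate θ (X ω) j ∂P :=
        mul_le_mul_of_nonneg_right (by linarith) hm
    _ = s * (s * (gain θ c j ^ 2 / 2 * ∫ ω, rate θ (X ω) j ∂P)) := by ring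

lemma LaplaceIdentity.dotProduct_mul_integral_exp_le [IsProbabilityMeasure P]
    (hL : LaplaceIdentity θ P X) (hμ : ∀ i, 0 < θ.μ i) (hβ : ∀ k i, 0 < θ.β k i)
    (hX : Measurable X) (hX0 : ∀ ω, 0 ≤ X ω) {v : Fin 2 → ℝ} (hv : 0 ≤ v)
    (hvG : v ≤ v ᵥ* θ.branching) {s : ℝ} (hs : 0 < s) :
    v ⬝ᵥ θ.μ * ∫ ω, Real.exp (-(s * pairing (potentialWeight θ v) (X ω))) ∂P ≤
      (∑ j, v j) / 2 * (v ⬝ᵥ θ.μ * (s *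
          ∫ ω, Real.exp (-(s * pairing (potentialWeight θ v) (X ω))) ∂P) +
        s * ∫ ω, Real.exp (-(s * pairing (potentialWeight θ v) (X ω))) *
          pairing (fun _ => v) (X ω) ∂P) := by
  have hc := potentialWeight_nonneg hβ hv
  obtain ⟨hint, heq⟩ := hL.smul hc hs.le
  have hT := integrable_exp_neg_mul_pairing_mul_pairing (P := P) hβ hX hX0 hc hs
  have hE : Integrable (fun ω => Real.exp (-(s * pairing (potentialWeight θ v) (X ω)))) P := by
    simpa using integrable_exp_neg_mul_pairing_mul hX hX0 hc hs.le (integrable_const (1 : ℝ))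
  rw [β_mul_potentialWeight hβ] at hT heq
  simp only [gain_potentialWeight hβ] at hint heq
  set V := ∑ j, v j
  have hpoint : ∀ ω, s * (1 - s * V / 2) *
      (v ⬝ᵥ θ.μ * Real.exp (-(s * pairing (potentialWeight θ v) (X ω))) +
        Real.exp (-(s * pairing (potentialWeight θ v) (X ω))) * pairing (fun _ => v) (X ω)) ≤
      Real.exp (-(s * pairing (potentialWeight θ v) (X ω))) *
        ∑ j, (1 - Real.exp (-(s * (v ᵥ* θ.branching) j))) * rate θ (X ω) j := fun ω => by
    rw [mul_comm (v ⬝ᵥ θ.μ), ← mul_add, ← sum_mul_rate, mul_left_comm, Finset.mul_sum]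
    refine mul_le_mul_of_nonneg_left (Finset.sum_le_sum fun j _ => ?_) (Real.exp_pos _).le
    have hvV : v j ≤ V := Finset.single_le_sum (fun i _ => hv i) (Finset.mem_univ j)
    rw [← mul_assoc]
    exact mul_le_mul_of_nonneg_right (mul_le_one_sub_exp_neg hs.le (hv j) (hvG j) hvV)
      (rate_nonneg hμ (hX0 ω) j)
  have hle := integral_mono (((hE.const_mul (v ⬝ᵥ θ.μ)).add hT).const_mul _) hint hpoint
  simp only [Pi.add_apply] at hle
  rw [heq, integral_const_mul, integral_add (hE.const_mul _) hT, integral_const_mul] at hle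
  refine le_of_mul_le_mul_left ?_ hs
  linarith

lemma LaplaceIdentity.subcritical [IsProbabilityMeasure P] (hL : LaplaceIdentity θ P X)
    (hμ : ∀ i, 0 < θ.μ i) (hα : ∀ k i j, 0 ≤ θ.α k i j) (hβ : ∀ k i, 0 < θ.β k i)
    (hX : Measurable X) (hX0 : ∀ ω, 0 ≤ X ω) : Subcritical θ.branching := by
  refine (subcritical_or_exists_le_vecMul (branching_nonneg hα hβ)).resolve_right ?_
  rintro ⟨v, hv, hv_ne, hvG⟩
  set a : Ω → ℝ := fun ω => pairing (potentialWeight θ v) (X ω)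
  have ha : Measurable a := by fun_prop
  have ha0 : ∀ ω, 0 ≤ a ω := fun ω => pairing_nonneg (potentialWeight_nonneg hβ hv) (hX0 ω)
  have hpos : 0 < v ⬝ᵥ θ.μ := by
    obtain ⟨j, hj⟩ := Function.ne_iff.1 hv_ne
    exact Finset.sum_pos' (fun i _ => mul_nonneg (hv i) (hμ i).le)
      ⟨j, Finset.mem_univ j, mul_pos ((hv j).lt_of_ne' hj) (hμ j)⟩
  have hE : Tendsto (fun s => ∫ ω, Real.exp (-(s * a ω)) ∂P) (𝓝[>] 0) (𝓝 1) := by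
    simpa using tendsto_integral_exp_neg_mul_mul ha ha0 (integrable_const (μ := P) (1 : ℝ))
  have hsE : Tendsto (fun s => s * ∫ ω, Real.exp (-(s * a ω)) ∂P) (𝓝[>] 0) (𝓝 0) := by
    simpa using (tendsto_nhdsWithin_of_tendsto_nhds tendsto_id).mul hE
  have hsT : Tendsto (fun s => s * ∫ ω, Real.exp (-(s * a ω)) * pairing (fun _ => v) (X ω) ∂P)
      (𝓝[>] 0) (𝓝 0) := by
    refine tendsto_mul_integral_exp_neg_mul_mul (C := ∑ k, ∑ i, θ.β k i) ha (by fun_prop)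
      (fun ω => pairing_nonneg (fun _ => hv) (hX0 ω))
      (Finset.sum_nonneg fun k _ => Finset.sum_nonneg fun i _ => (hβ k i).le) fun ω => ?_
    rw [← β_mul_potentialWeight hβ]
    exact pairing_β_mul_le hβ (potentialWeight_nonneg hβ hv) (hX0 ω)
  have hlim := le_of_tendsto_of_tendsto (hE.const_mul (v ⬝ᵥ θ.μ))
    (((hsE.const_mul (v ⬝ᵥ θ.μ)).add hsT).const_mul ((∑ j, v j) / 2))
    (eventually_nhdsWithin_of_forall fun s hs =>
      hL.dotProduct_mul_integral_exp_le hμ hβ hX hX0 hv hvG hs)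
  linarith

lemma integrable_apply_of_integrable_pairing (hX : Measurable X) (hX0 : ∀ ω, 0 ≤ X ω)
    {c : Fin K → Fin 2 → ℝ} (hc : ∀ k i, 0 < c k i)
    (hint : Integrable (fun ω => pairing c (X ω)) P) (k : Fin K) (i : Fin 2) :
    Integrable (fun ω => X ω k i) P := by
  refine (hint.const_mul (c k i)⁻¹).mono' (Measurable.aestronglyMeasurable (by fun_prop))
    (ae_of_all _ fun ω => ?_)
  rw [Real.norm_of_nonneg (hX0 ω k i), le_inv_mul_iff₀ (hc k i)]
  exact mul_le_pairing (fun k i => (hc k i).le) (hX0 ω) k i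

lemma LaplaceIdentity.integrable_and_integral_exp_mul_pairing_le [IsProbabilityMeasure P]
    (hL : LaplaceIdentity θ P X) (hμ : ∀ i, 0 < θ.μ i) (hα : ∀ k i j, 0 ≤ θ.α k i j)
    (hβ : ∀ k i, 0 < θ.β k i) (hX : Measurable X) (hX0 : ∀ ω, 0 ≤ X ω) {v : Fin 2 → ℝ}
    (hv : ∀ i, 0 < v i) (hvG : v ᵥ* θ.branching ≤ v) {s : ℝ} (hs : 0 < s) :
    Integrable (fun ω => Real.exp (-(s * pairing (potentialWeight θ v) (X ω))) *
      pairing (fun _ => v - v ᵥ* θ.branching) (X ω)) P ∧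
    ∫ ω, Real.exp (-(s * pairing (potentialWeight θ v) (X ω))) *
      pairing (fun _ => v - v ᵥ* θ.branching) (X ω) ∂P ≤ (v ᵥ* θ.branching) ⬝ᵥ θ.μ := by
  set w := v ᵥ* θ.branching
  have hc := potentialWeight_pos hβ hv
  have hc0 : 0 ≤ potentialWeight θ v := fun k i => (hc k i).le
  have hw0 : 0 ≤ w := vecMul_branching_nonneg hα hβ fun i => (hv i).le
  have hwμ : 0 ≤ w ⬝ᵥ θ.μ := Finset.sum_nonneg fun j _ => mul_nonneg (hw0 j) (hμ j).le
  have hE : Integrable (fun ω => Real.exp (-(s * pairing (potentialWeight θ v) (X ω)))) P := by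
    simpa using integrable_exp_neg_mul_pairing_mul hX hX0 hc0 hs.le (integrable_const (1 : ℝ))
  have hE1 : ∫ ω, Real.exp (-(s * pairing (potentialWeight θ v) (X ω))) ∂P ≤ 1 := by
    simpa using integral_mono hE (integrable_const 1) fun ω => Real.exp_le_one_iff.2 <|
      neg_nonpos.2 <| mul_nonneg hs.le (pairing_nonneg hc0 (hX0 ω))
  have hT : Integrable (fun ω => Real.exp (-(s * pairing (potentialWeight θ v) (X ω))) *
      pairing (fun _ => v - w) (X ω)) P := by
    refine integrable_exp_neg_mul_mul (C := ∑ k, ∑ i, θ.β k i) (by fun_prop) (by fun_prop)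
      (fun ω => pairing_nonneg (fun _ => sub_nonneg.2 hvG) (hX0 ω))
      (Finset.sum_nonneg fun k _ => Finset.sum_nonneg fun i _ => (hβ k i).le) (fun ω => ?_) hs
    refine (pairing_mono (fun _ => ?_) (hX0 ω)).trans (pairing_β_mul_le hβ hc0 (hX0 ω))
    rw [β_mul_potentialWeight hβ]
    exact sub_le_self v hw0
  have hdrift := hL.integral_exp_mul_drift_nonneg hμ hβ hX hX0 hc0 hs
    (integrable_exp_neg_mul_pairing_mul_rate hX hX0 hc hs)
  simp only [drift_potentialWeight hβ, mul_sub] at hdrift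
  rw [integral_sub (hE.mul_const _) hT, integral_mul_const] at hdrift
  exact ⟨hT, by linarith [mul_le_of_le_one_left hwμ hE1]⟩

lemma LaplaceIdentity.integrable_apply [IsProbabilityMeasure P] (hL : LaplaceIdentity θ P X)
    (hμ : ∀ i, 0 < θ.μ i) (hα : ∀ k i j, 0 ≤ θ.α k i j) (hβ : ∀ k i, 0 < θ.β k i)
    (hX : Measurable X) (hX0 : ∀ ω, 0 ≤ X ω) (k : Fin K) (i : Fin 2) :
    Integrable (fun ω => X ω k i) P := by
  obtain ⟨v, hv, hvG⟩ := (hL.subcritical hμ hα hβ hX hX0).exists_vecMul_lt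
    (branching_nonneg hα hβ)
  have hvG' : v ᵥ* θ.branching ≤ v := fun j => (hvG j).le
  refine integrable_apply_of_integrable_pairing hX hX0 (c := fun _ => v - v ᵥ* θ.branching)
    (fun _ j => sub_pos.2 (hvG j)) ?_ k i
  refine integrable_of_tendsto_of_integral_le (l := 𝓝[>] (0 : ℝ))
    (C := (v ᵥ* θ.branching) ⬝ᵥ θ.μ)
    (f := fun s ω => Real.exp (-(s * pairing (potentialWeight θ v) (X ω))) *
      pairing (fun _ => v - v ᵥ* θ.branching) (X ω))
    (eventually_nhdsWithin_of_forall fun s (hs : 0 < s) => ?_) fun ω => ?_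
  · obtain ⟨hint, hle⟩ :=
      hL.integrable_and_integral_exp_mul_pairing_le hμ hα hβ hX hX0 hv hvG' hs
    exact ⟨hint, fun ω => mul_nonneg (Real.exp_pos _).le
      (pairing_nonneg (fun _ => sub_nonneg.2 hvG') (hX0 ω)), hle⟩
  · refine tendsto_nhdsWithin_of_tendsto_nhds (Continuous.tendsto' (by fun_prop) _ _ ?_)
    simp

lemma LaplaceIdentity.integral_drift [IsProbabilityMeasure P] (hL : LaplaceIdentity θ P X)
    (hμ : ∀ i, 0 < θ.μ i) (hα : ∀ k i j, 0 ≤ θ.α k i j) (hβ : ∀ k i, 0 < θ.β k i)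
    (hX : Measurable X) (hX0 : ∀ ω, 0 ≤ X ω) {c : Fin K → Fin 2 → ℝ} (hc : 0 ≤ c) :
    ∫ ω, drift θ c (X ω) ∂P = 0 := by
  have hXint := hL.integrable_apply hμ hα hβ hX hX0
  have hlim := tendsto_integral_exp_neg_mul_mul (a := fun ω => pairing c (X ω)) (by fun_prop)
    (fun ω => pairing_nonneg hc (hX0 ω)) (integrable_drift (θ := θ) hXint c)
  refine le_antisymm (le_of_tendsto_of_tendsto hlim (g := fun s : ℝ =>
    s * ∑ j, gain θ c j ^ 2 / 2 * ∫ ω, rate θ (X ω) j ∂P) ?_ ?_) (ge_of_tendsto hlim ?_)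
  · exact tendsto_nhdsWithin_of_tendsto_nhds (Continuous.tendsto' (by fun_prop) _ _ (zero_mul _))
  · exact eventually_nhdsWithin_of_forall fun s hs =>
      hL.integral_exp_mul_drift_le hμ hα hβ hX hX0 hXint hc hs
  · exact eventually_nhdsWithin_of_forall fun s (hs : 0 < s) =>
      hL.integral_exp_mul_drift_nonneg hμ hβ hX hX0 hc hs fun j =>
        integrable_exp_neg_mul_pairing_mul hX hX0 hc hs.le (integrable_rate hXint j)

lemma drift_single (x : Fin K → Fin 2 → ℝ) (k : Fin K) (i : Fin 2) :
    drift θ (Pi.single k (Pi.single i 1)) x =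
      (θ.α k *ᵥ rate θ x) i - θ.β k i * x k i := by
  have hsingle : ∀ f : Fin K → Fin 2 → ℝ,
      ∑ k', ∑ i', (Pi.single k (Pi.single i 1) : Fin K → Fin 2 → ℝ) k' i' * f k' i' = f k i := by
    intro f
    rw [Finset.sum_eq_single k (fun k' _ hk => by simp [hk]) (by simp),
      Finset.sum_eq_single i (fun i' _ hi => by simp [hi]) (by simp)]
    simp
  have hpair := hsingle fun k i => θ.β k i * x k i
  simp only [drift, gain, hsingle fun k i => θ.α k i _, pairing, Pi.mul_apply, Matrix.mulVec,
    dotProduct]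
  rw [← hpair]
  simp only [mul_left_comm, mul_assoc]

lemma LaplaceIdentity.β_mul_integral_apply [IsProbabilityMeasure P] (hL : LaplaceIdentity θ P X)
    (hμ : ∀ i, 0 < θ.μ i) (hα : ∀ k i j, 0 ≤ θ.α k i j) (hβ : ∀ k i, 0 < θ.β k i)
    (hX : Measurable X) (hX0 : ∀ ω, 0 ≤ X ω) (k : Fin K) (i : Fin 2) :
    θ.β k i * ∫ ω, X ω k i ∂P = (θ.α k *ᵥ fun j => ∫ ω, rate θ (X ω) j ∂P) i := by
  have hXint := hL.integrable_apply hμ hα hβ hX hX0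
  have hrate : ∀ j, Integrable (fun ω => θ.α k i j * rate θ (X ω) j) P := fun j =>
    (integrable_rate hXint j).const_mul _
  have h := hL.integral_drift hμ hα hβ hX hX0 (c := Pi.single k (Pi.single i 1))
    (Pi.single_nonneg.2 (Pi.single_nonneg.2 zero_le_one))
  simp only [drift_single, Matrix.mulVec, dotProduct] at h ⊢
  rw [integral_sub (integrable_finsetSum _ fun j _ => hrate j) ((hXint k i).const_mul _),
    integral_finsetSum _ fun j _ => hrate j, integral_const_mul, sub_eq_zero] at h
  simp only [← h, integral_const_mul]

lemma LaplaceIdentity.integral_rate [IsProbabilityMeasure P] (hL : LaplaceIdentity θ P X)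
    (hμ : ∀ i, 0 < θ.μ i) (hα : ∀ k i j, 0 ≤ θ.α k i j) (hβ : ∀ k i, 0 < θ.β k i)
    (hX : Measurable X) (hX0 : ∀ ω, 0 ≤ X ω) :
    (fun j => ∫ ω, rate θ (X ω) j ∂P) =
      θ.μ + θ.branching *ᵥ fun j => ∫ ω, rate θ (X ω) j ∂P := by
  have hXint := hL.integrable_apply hμ hα hβ hX hX0
  funext i
  rw [Pi.add_apply, branching_mulVec hβ]
  simp only [rate]
  rw [integral_add (integrable_const _) (integrable_finsetSum _ fun k _ => hXint k i),
    integral_const, probReal_univ, one_smul, integral_finsetSum _ fun k _ => hXint k i]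
  congr 1
  refine Finset.sum_congr rfl fun k _ => ?_
  rw [eq_inv_mul_iff_mul_eq₀ (hβ k i).ne']
  exact hL.β_mul_integral_apply hμ hα hβ hX hX0 k i

lemma LaplaceIdentity.integrable_and_integral_one_sub_exp_div_mul_pairing_le
    [IsProbabilityMeasure P] (hL : LaplaceIdentity θ P X) (hμ : ∀ i, 0 < θ.μ i)
    (hα : ∀ k i j, 0 ≤ θ.α k i j) (hβ : ∀ k i, 0 < θ.β k i) (hX : Measurable X)
    (hX0 : ∀ ω, 0 ≤ X ω) {v : Fin 2 → ℝ} (hv : 0 ≤ v) {s : ℝ} (hs : 0 < s) :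
    Integrable (fun ω => (1 - Real.exp (-(s * pairing (potentialWeight θ v) (X ω)))) / s *
      pairing (fun _ => v - v ᵥ* θ.branching) (X ω)) P ∧
    ∫ ω, (1 - Real.exp (-(s * pairing (potentialWeight θ v) (X ω)))) / s *
        pairing (fun _ => v - v ᵥ* θ.branching) (X ω) ∂P ≤
      (v ᵥ* θ.branching) ⬝ᵥ θ.μ * ∫ ω, pairing (potentialWeight θ v) (X ω) ∂P +
        ∑ j, gain θ (potentialWeight θ v) j ^ 2 / 2 * ∫ ω, rate θ (X ω) j ∂P := by
  set c := potentialWeight θ v with hc_def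
  have hc : 0 ≤ c := potentialWeight_nonneg hβ hv
  set d := (v ᵥ* θ.branching) ⬝ᵥ θ.μ
  have hd : 0 ≤ d := Finset.sum_nonneg fun j _ =>
    mul_nonneg (vecMul_branching_nonneg hα hβ hv j) (hμ j).le
  have hXint := hL.integrable_apply hμ hα hβ hX hX0
  have hD := integrable_drift (θ := θ) hXint c
  have hED := integrable_exp_neg_mul_pairing_mul hX hX0 hc hs.le hD
  have hE : Integrable (fun ω => Real.exp (-(s * pairing c (X ω)))) P := by
    simpa using integrable_exp_neg_mul_pairing_mul hX hX0 hc hs.le (integrable_const (1 : ℝ))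
  have hE' : Integrable (fun ω => d * ((1 - Real.exp (-(s * pairing c (X ω)))) / s)) P :=
    (((integrable_const 1).sub hE).div_const s).const_mul d
  have hdecomp : ∀ ω, (1 - Real.exp (-(s * pairing c (X ω)))) / s *
      pairing (fun _ => v - v ᵥ* θ.branching) (X ω) =
      d * ((1 - Real.exp (-(s * pairing c (X ω)))) / s) - s⁻¹ * drift θ c (X ω) +
        s⁻¹ * (Real.exp (-(s * pairing c (X ω))) * drift θ c (X ω)) := fun ω => by
    rw [hc_def, drift_potentialWeight hβ]
    ring
  simp only [hdecomp]
  have hsub : Integrable (fun ω => d * ((1 - Real.exp (-(s * pairing c (X ω)))) / s) -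
      s⁻¹ * drift θ c (X ω)) P := hE'.sub (hD.const_mul _)
  refine ⟨hsub.add (hED.const_mul _), ?_⟩
  rw [integral_add hsub (hED.const_mul _), integral_sub hE' (hD.const_mul _)]
  simp only [integral_const_mul]
  rw [hL.integral_drift hμ hα hβ hX hX0 hc, mul_zero, sub_zero]
  refine add_le_add (mul_le_mul_of_nonneg_left ?_ hd) ?_
  · refine integral_mono (((integrable_const 1).sub hE).div_const s) (integrable_pairing hXint c)
      fun ω => ?_
    rw [div_le_iff₀' hs]
    exact one_sub_exp_neg_le _
  · rw [inv_mul_le_iff₀ hs]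
    exact hL.integral_exp_mul_drift_le hμ hα hβ hX hX0 hXint hc hs

lemma LaplaceIdentity.integrable_apply_mul_apply [IsProbabilityMeasure P]
    (hL : LaplaceIdentity θ P X) (hμ : ∀ i, 0 < θ.μ i) (hα : ∀ k i j, 0 ≤ θ.α k i j)
    (hβ : ∀ k i, 0 < θ.β k i) (hX : Measurable X) (hX0 : ∀ ω, 0 ≤ X ω)
    (k l : Fin K) (i j : Fin 2) : Integrable (fun ω => X ω k i * X ω l j) P := by
  obtain ⟨v, hv, hvG⟩ := (hL.subcritical hμ hα hβ hX hX0).exists_vecMul_lt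
    (branching_nonneg hα hβ)
  have hc := potentialWeight_pos hβ hv
  have hc0 : 0 ≤ potentialWeight θ v := fun k i => (hc k i).le
  have hd : ∀ j, 0 < (v - v ᵥ* θ.branching) j := fun j => sub_pos.2 (hvG j)
  have hd0 : (0 : Fin K → Fin 2 → ℝ) ≤ fun _ => v - v ᵥ* θ.branching := fun _ j => (hd j).le
  have hprod : Integrable (fun ω => pairing (potentialWeight θ v) (X ω) *
      pairing (fun _ => v - v ᵥ* θ.branching) (X ω)) P := by
    refine integrable_of_tendsto_of_integral_le (l := 𝓝[>] (0 : ℝ))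
      (C := (v ᵥ* θ.branching) ⬝ᵥ θ.μ * ∫ ω, pairing (potentialWeight θ v) (X ω) ∂P +
        ∑ j, gain θ (potentialWeight θ v) j ^ 2 / 2 * ∫ ω, rate θ (X ω) j ∂P)
      (eventually_nhdsWithin_of_forall fun s (hs : 0 < s) => ?_)
      fun ω => (tendsto_one_sub_exp_neg_div _).mul_const _
    obtain ⟨hint, hle⟩ := hL.integrable_and_integral_one_sub_exp_div_mul_pairing_le hμ hα hβ hX hX0
      (fun i => (hv i).le) hs
    refine ⟨hint, fun ω => mul_nonneg (div_nonneg (sub_nonneg.2 ?_) hs.le)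
      (pairing_nonneg hd0 (hX0 ω)), hle⟩
    exact Real.exp_le_one_iff.2 (neg_nonpos.2 (mul_nonneg hs.le (pairing_nonneg hc0 (hX0 ω))))
  refine (hprod.const_mul ((potentialWeight θ v k i)⁻¹ * ((v - v ᵥ* θ.branching) j)⁻¹)).mono'
    (Measurable.aestronglyMeasurable (by fun_prop)) (ae_of_all _ fun ω => ?_)
  rw [Real.norm_of_nonneg (mul_nonneg (hX0 ω k i) (hX0 ω l j)), mul_mul_mul_comm]
  refine mul_le_mul ?_ ?_ (hX0 ω l j)
    (mul_nonneg (inv_pos.2 (hc k i)).le (pairing_nonneg hc0 (hX0 ω)))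
  · rw [le_inv_mul_iff₀ (hc k i)]
    exact mul_le_pairing hc0 (hX0 ω) k i
  · rw [le_inv_mul_iff₀ (hd j)]
    exact mul_le_pairing hd0 (hX0 ω) l j

end Moments

/-! ### Counting measures of locally finite sets -/

section CountingMeasure

variable {T : Set ℝ}

lemma countable_of_finite_inter_Icc (hT : ∀ a b, (T ∩ Icc a b).Finite) : T.Countable := by
  have hcover : T = ⋃ n : ℕ, T ∩ Icc (-(n : ℝ)) n := by
    ext x
    simp only [mem_iUnion, mem_inter_iff, mem_Icc, exists_and_left, iff_self_and]
    intro _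
    obtain ⟨n, hn⟩ := exists_nat_ge |x|
    exact ⟨n, abs_le.1 hn⟩
  rw [hcover]
  exact countable_iUnion fun n => (hT _ _).countable

lemma count_restrict_apply {B : Set ℝ} (hB : MeasurableSet B) (hTB : (T ∩ B).Finite) :
    Measure.count.restrict T B = ((T ∩ B).ncard : ℝ≥0∞) := by
  rw [Measure.restrict_apply hB, inter_comm,
    Measure.count_apply_finite' hTB hTB.measurableSet, ncard_eq_toFinset_card _ hTB]

lemma isLocallyFiniteMeasure_count_restrict (hT : ∀ a b, (T ∩ Icc a b).Finite) :
    IsLocallyFiniteMeasure (Measure.count.restrict T) := by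
  refine ⟨fun x => ⟨Icc (x - 1) (x + 1), Icc_mem_nhds (by linarith) (by linarith), ?_⟩⟩
  rw [count_restrict_apply measurableSet_Icc (hT _ _)]
  exact ENNReal.natCast_lt_top _

lemma lintegral_count_restrict_singleton (T : Set ℝ) (a : ℝ) (f : ℝ → ℝ≥0∞) :
    ∫⁻ u in {a}, f u ∂(Measure.count.restrict T) = T.indicator f a := by
  rw [Measure.restrict_singleton, lintegral_smul_measure, lintegral_dirac, smul_eq_mul,
    count_restrict_apply (measurableSet_singleton a) ((finite_singleton a).inter_of_right T)]
  by_cases ha : a ∈ T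
  · simp [ha, inter_eq_right.2 (singleton_subset_iff.2 ha)]
  · simp [ha, inter_singleton_eq_empty.2 ha]

lemma lintegral_Ico_eq_add_Ioo (ν : Measure ℝ) {a b : ℝ} (hab : a < b) (f : ℝ → ℝ≥0∞) :
    ∫⁻ u in Ico a b, f u ∂ν = ∫⁻ u in {a}, f u ∂ν + ∫⁻ u in Ioo a b, f u ∂ν := by
  rw [← Ioo_insert_left hab, insert_eq, lintegral_union measurableSet_Ioo (by simp)]

lemma lintegral_count_restrict_Ico {a b : ℝ} (hab : a < b) (hT : T ∩ Ioo a b = ∅)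
    (f : ℝ → ℝ≥0∞) : ∫⁻ u in Ico a b, f u ∂(Measure.count.restrict T) = T.indicator f a := by
  have hgap : (Measure.count.restrict T).restrict (Ioo a b) = 0 := by
    rw [Measure.restrict_eq_zero, Measure.restrict_apply measurableSet_Ioo, inter_comm, hT,
      measure_empty]
  rw [lintegral_Ico_eq_add_Ioo _ hab, hgap, lintegral_zero_measure,
    lintegral_count_restrict_singleton, add_zero]

lemma lintegral_Ico_add_Ico (ν : Measure ℝ) {a b c : ℝ} (hab : a ≤ b) (hbc : b ≤ c)
    (f : ℝ → ℝ≥0∞) :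
    ∫⁻ u in Ico a b, f u ∂ν + ∫⁻ u in Ico b c, f u ∂ν = ∫⁻ u in Ico a c, f u ∂ν := by
  rw [← Ico_union_Ico_eq_Ico hab hbc, lintegral_union measurableSet_Ico Ico_disjoint_Ico_same]

lemma rel_of_gap (hT : ∀ a b, (T ∩ Icc a b).Finite) {R : ℝ → ℝ → Prop}
    (hgap : ∀ a b, a < b → T ∩ Ioo a b = ∅ → R a b)
    (htrans : ∀ a b c, a < b → b < c → R a b → R b c → R a c) {a b : ℝ} (hab : a < b) :
    R a b := by
  have hfin : ∀ a b, (T ∩ Ioo a b).Finite := fun a b =>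
    (hT a b).subset (inter_subset_inter_right _ Ioo_subset_Icc_self)
  induction hn : (T ∩ Ioo a b).ncard using Nat.strong_induction_on generalizing a b with
  | _ n ih =>
    rcases eq_empty_or_nonempty (T ∩ Ioo a b) with hempty | ⟨c, hcT, hac, hcb⟩
    · exact hgap a b hab hempty
    have hleft : T ∩ Ioo a c ⊂ T ∩ Ioo a b :=
      ⟨inter_subset_inter_right _ (Ioo_subset_Ioo_right hcb.le),
        fun h => lt_irrefl c (h ⟨hcT, hac, hcb⟩).2.2⟩
    have hright : T ∩ Ioo c b ⊂ T ∩ Ioo a b :=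
      ⟨inter_subset_inter_right _ (Ioo_subset_Ioo_left hac.le),
        fun h => lt_irrefl c (h ⟨hcT, hac, hcb⟩).2.1⟩
    subst hn
    exact htrans a c b hac hcb (ih _ (ncard_lt_ncard hleft (hfin a b)) hac rfl)
      (ih _ (ncard_lt_ncard hright (hfin a b)) hcb rfl)

end CountingMeasure

section Measure

lemma measure_Ioc_inter_Iio_eq_iSup (ν : Measure ℝ) (a b t : ℝ) :
    ν (Ioc a b ∩ Iio t) =
      ⨆ q : ℚ, (Ioi (q : ℝ)).indicator (fun _ => ν (Ioc a (min b q))) t := by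
  have hunion : Ioc a b ∩ Iio t = ⋃ q : {q : ℚ // (q : ℝ) < t}, Ioc a (min b q) := by
    ext x
    simp only [mem_inter_iff, mem_Ioc, mem_Iio, mem_iUnion, le_min_iff, Subtype.exists]
    constructor
    · rintro ⟨⟨hax, hxb⟩, hxt⟩
      obtain ⟨q, hxq, hqt⟩ := exists_rat_btwn hxt
      exact ⟨q, hqt, hax, hxb, hxq.le⟩
    · rintro ⟨q, hqt, hax, hxb, hxq⟩
      exact ⟨⟨hax, hxb⟩, hxq.trans_lt hqt⟩
  have hmono : Monotone fun q : {q : ℚ // (q : ℝ) < t} => Ioc a (min b q) := fun q r hqr =>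
    Ioc_subset_Ioc_right (min_le_min_left _ (by exact_mod_cast hqr))
  rw [hunion, hmono.directed_le.measure_iUnion, iSup_subtype]
  refine iSup_congr fun q => ?_
  by_cases hq : (q : ℝ) < t
  · simp [hq]
  · simp [hq]

lemma lintegral_Iio_eq_iSup (ν : Measure ℝ) (g : ℝ → ℝ≥0∞) (t : ℝ) :
    ∫⁻ u in Iio t, g u ∂ν = ⨆ n : ℕ, ∫⁻ u in Ioc (-(n : ℝ)) n ∩ Iio t, g u ∂ν := by
  rw [← setLIntegral_iUnion_of_directed]
  · congr 2
    ext x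
    simp only [mem_Iio, mem_iUnion, mem_inter_iff, mem_Ioc, exists_and_right, iff_and_self]
    intro _
    obtain ⟨n, hn⟩ := exists_nat_gt |x|
    exact ⟨n, (abs_lt.1 hn).1, (abs_lt.1 hn).2.le⟩
  · refine Monotone.directed_le fun m n hmn => inter_subset_inter_left _ ?_
    have hmn' : (m : ℝ) ≤ n := by exact_mod_cast hmn
    exact Ioc_subset_Ioc (neg_le_neg hmn') hmn'

lemma measurable_lintegral_of_measurable_measure {E F : Type*} [MeasurableSpace E]
    [MeasurableSpace F] {m : E → Measure F} (hm : Measurable m) [∀ x, IsFiniteMeasure (m x)]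
    {f : E → F → ℝ≥0∞} (hf : Measurable (Function.uncurry f)) :
    Measurable fun x => ∫⁻ y, f x y ∂(m x) := by
  classical
  have hs : ∀ n : ℕ, MeasurableSet {x | m x univ ≤ n} := fun n =>
    (Measure.measurable_coe MeasurableSet.univ).comp hm measurableSet_Iic
  let κ : ℕ → Kernel E F := fun n => Kernel.piecewise (hs n) ⟨m, hm⟩ 0
  have hκ : ∀ n x, κ n x = if m x univ ≤ n then m x else 0 := fun n x => by
    simp only [κ, Kernel.piecewise_apply, mem_ofPred_eq]
    rfl
  have hfin : ∀ n, IsFiniteKernel (κ n) := fun n => by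
    refine ⟨⟨n, ENNReal.natCast_lt_top n, fun x => ?_⟩⟩
    rw [hκ]
    split_ifs with h
    · exact h
    · simp
  have hsup : (fun x => ∫⁻ y, f x y ∂(m x)) = fun x => ⨆ n, ∫⁻ y, f x y ∂(κ n x) := by
    ext x
    refine le_antisymm ?_ (iSup_le fun n => ?_)
    · obtain ⟨n, hn⟩ := ENNReal.exists_nat_gt (measure_ne_top (m x) univ)
      refine le_iSup_of_le n ?_
      rw [hκ, if_pos hn.le]
    · rw [hκ]
      split_ifs
      · exact le_rfl
      · simp
  rw [hsup]
  exact Measurable.iSup fun n => hf.lintegral_kernel_prod_right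

lemma lintegral_lintegral_Ioo (ν ρ : Measure ℝ) [SFinite ν] [SFinite ρ] {f : ℝ → ℝ≥0∞}
    (hf : Measurable f) (a b : ℝ) :
    ∫⁻ v in Ico a b, ∫⁻ u in Ioo v b, f u ∂ρ ∂ν =
      ∫⁻ u in Ico a b, f u * ν (Ico a u) ∂ρ := by
  have hinner : ∀ v ∈ Ico a b,
      ∫⁻ u in Ioo v b, f u ∂ρ = ∫⁻ u in Ico a b, (Ioi v).indicator f u ∂ρ := fun v hv => by
    rw [setLIntegral_indicator measurableSet_Ioi]
    congr 2
    ext x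
    simp only [mem_Ioo, mem_inter_iff, mem_Ioi, mem_Ico]
    exact ⟨fun h => ⟨h.1, hv.1.trans h.1.le, h.2⟩, fun h => ⟨h.1, h.2.2⟩⟩
  have hm : Measurable (Function.uncurry fun v u : ℝ => (Ioi v).indicator f u) :=
    (hf.comp measurable_snd).indicator (measurableSet_lt measurable_fst measurable_snd)
  rw [setLIntegral_congr_fun measurableSet_Ico hinner, lintegral_lintegral_swap hm.aemeasurable]
  refine setLIntegral_congr_fun measurableSet_Ico fun u hu => ?_
  calc ∫⁻ v in Ico a b, (Ioi v).indicator f u ∂ν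
      = ∫⁻ v in Ico a b, (Iio u).indicator (fun _ => f u) v ∂ν := by simp [indicator]
    _ = f u * ν (Ico a u) := by
      rw [setLIntegral_indicator measurableSet_Iio, setLIntegral_const]
      congr 2
      ext x
      simp only [mem_inter_iff, mem_Iio, mem_Ico]
      exact ⟨fun h => ⟨h.2.1, h.1⟩, fun h => ⟨h.2, h.1, h.2.trans hu.2⟩⟩

end Measure

/-! ### Predictable processes -/

section Predictable

variable {Ω : Type*} {mΩ : MeasurableSpace Ω}

lemma measurable_predictable_fst (ℱ : Filtration ℝ mΩ) :
    Measurable[predictable ℱ] (Prod.fst : ℝ × Ω → ℝ) := by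
  refine measurable_of_Ioi fun s =>
    MeasurableSpace.measurableSet_generateFrom ⟨s, univ, MeasurableSet.univ, ?_⟩
  ext; simp

lemma predictable_le (ℱ : Filtration ℝ mΩ) : predictable ℱ ≤ Prod.instMeasurableSpace := by
  refine MeasurableSpace.generateFrom_le ?_
  rintro _ ⟨s, A, hA, rfl⟩
  exact measurableSet_Ioi.prod (ℱ.le s A hA)

lemma measurable_predictable_indicator (ℱ : Filtration ℝ mΩ) (s : ℝ) {f : Ω → ℝ≥0∞}
    (hf : Measurable[ℱ s] f) :
    Measurable[predictable ℱ] fun p : ℝ × Ω => (Ioi s).indicator (fun _ => f p.2) p.1 := by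
  intro B hB
  have hpreimage : (fun p : ℝ × Ω => (Ioi s).indicator (fun _ => f p.2) p.1) ⁻¹' B =
      (Ioi s ×ˢ (f ⁻¹' B)) ∪ ((Prod.fst ⁻¹' (Ioi s)ᶜ) ∩ {_p | (0 : ℝ≥0∞) ∈ B}) := by
    ext p
    rcases lt_or_ge s p.1 with hp | hp
    · simp [hp]
    · simp [hp, hp.not_gt]
  rw [hpreimage]
  refine @MeasurableSet.union _ (predictable ℱ) _ _ ?_ ?_
  · exact MeasurableSpace.measurableSet_generateFrom ⟨s, _, hf hB, rfl⟩
  · refine @MeasurableSet.inter _ (predictable ℱ) _ _ ?_ ?_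
    · exact measurable_predictable_fst ℱ measurableSet_Ioi.compl
    · exact @MeasurableSet.const _ (predictable ℱ) _

variable {P : Measure Ω} {ℱ : Filtration ℝ mΩ} {S : Fin 2 → Ω → Set ℝ}

lemma IsPointProcess.finite_inter (hS : IsPointProcess P ℱ S) (i : Fin 2) (ω : Ω) {B : Set ℝ}
    {a b : ℝ} (hB : B ⊆ Icc a b) : (S i ω ∩ B).Finite :=
  (hS.locallyFinite i ω a b).subset (inter_subset_inter_right _ hB)

lemma IsPointProcess.isLocallyFiniteMeasure_eventMeasure (hS : IsPointProcess P ℱ S)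
    (i : Fin 2) (ω : Ω) : IsLocallyFiniteMeasure (eventMeasure S i ω) :=
  isLocallyFiniteMeasure_count_restrict (hS.locallyFinite i ω)

lemma IsPointProcess.measurable_eventMeasure_Ioc (hS : IsPointProcess P ℱ S) (i : Fin 2)
    (a b : ℝ) : Measurable[predictable ℱ]
      fun p : ℝ × Ω => eventMeasure S i p.2 (Ioc a b ∩ Iio p.1) := by
  simp only [measure_Ioc_inter_Iio_eq_iSup]
  refine Measurable.iSup fun q => measurable_predictable_indicator ℱ q
    (f := fun ω => eventMeasure S i ω (Ioc a (min b q))) ?_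
  have hcount : (fun ω => eventMeasure S i ω (Ioc a (min b q))) =
      fun ω => (((S i ω ∩ Ioc a (min b q)).ncard : ℕ) : ℝ≥0∞) := by
    ext ω
    exact count_restrict_apply measurableSet_Ioc (hS.finite_inter i ω Ioc_subset_Icc_self)
  rw [hcount]
  exact (measurable_from_top (f := fun n : ℕ => (n : ℝ≥0∞))).comp
    ((hS.adapted i a (min b q)).mono (ℱ.mono (min_le_right _ _)) le_rfl)

lemma IsPointProcess.measurable_restrict_Ioc_inter_Iio (hS : IsPointProcess P ℱ S) (i : Fin 2)
    (a b : ℝ) : Measurable[predictable ℱ]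
      fun p : ℝ × Ω => (eventMeasure S i p.2).restrict (Ioc a b ∩ Iio p.1) := by
  have hfin : ∀ p : ℝ × Ω,
      IsFiniteMeasure ((eventMeasure S i p.2).restrict (Ioc a b ∩ Iio p.1)) := fun p => by
    have := hS.isLocallyFiniteMeasure_eventMeasure i p.2
    exact ⟨by simpa using (measure_mono inter_subset_left).trans_lt measure_Ioc_lt_top⟩
  refine @Measurable.measure_of_isPiSystem (ℝ × Ω) ℝ (predictable ℱ) _ _ hfin _
    (borel_eq_generateFrom_Iic ℝ) isPiSystem_Iic ?_ ?_
  · rintro _ ⟨c, rfl⟩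
    convert hS.measurable_eventMeasure_Ioc i a (min b c) using 2 with p
    rw [Measure.restrict_apply measurableSet_Iic, ← Ioc_inter_Iic, inter_comm, inter_right_comm]
  · simpa using hS.measurable_eventMeasure_Ioc i a b

lemma IsPointProcess.measurable_lintegral_Iio (hS : IsPointProcess P ℱ S) (i : Fin 2)
    {g : ℝ → ℝ≥0∞} (hg : Measurable g) : Measurable[predictable ℱ]
      fun p : ℝ × Ω => ∫⁻ u in Iio p.1, g u ∂(eventMeasure S i p.2) := by
  simp only [lintegral_Iio_eq_iSup]
  exact Measurable.iSup fun n =>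
    (Measure.measurable_lintegral hg).comp (hS.measurable_restrict_Ioc_inter_Iio i _ _)

lemma IsPointProcess.measurable_setLIntegral (hS : IsPointProcess P ℱ S) (i : Fin 2)
    {C : ℝ → Ω → ℝ≥0∞} (hC : Measurable[predictable ℱ] fun p : ℝ × Ω => C p.1 p.2)
    {B : Set ℝ} (hB : MeasurableSet B) {a b : ℝ} (hBab : B ⊆ Ico a b) :
    Measurable fun ω => ∫⁻ t in B, C t ω ∂(eventMeasure S i ω) := by
  have hfin : ∀ ω, IsFiniteMeasure ((eventMeasure S i ω).restrict B) := fun ω => by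
    have := hS.isLocallyFiniteMeasure_eventMeasure i ω
    exact ⟨by simpa using (measure_mono hBab).trans_lt measure_Ico_lt_top⟩
  refine measurable_lintegral_of_measurable_measure (f := fun ω t => C t ω) ?_
    ((hC.mono (predictable_le ℱ) le_rfl).comp measurable_swap)
  refine Measure.measurable_of_measurable_coe _ fun D hD => ?_
  have hmeas := ((hS.measurable_lintegral_Iio i (g := (D ∩ B).indicator 1)
    (measurable_one.indicator (hD.inter hB))).mono (predictable_le ℱ) le_rfl).comp
    (measurable_prodMk_left (x := b))
  convert hmeas using 2 with ω
  simp only [Function.comp]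
  rw [lintegral_indicator_one (hD.inter hB), Measure.restrict_apply hD,
    Measure.restrict_apply (hD.inter hB), inter_eq_left.2 (show D ∩ B ⊆ Iio b from
      inter_subset_right.trans (hBab.trans fun x hx => hx.2))]

lemma IsPointProcess.measurable_lintegral_Ico (hS : IsPointProcess P ℱ S) (i : Fin 2)
    {C : ℝ → Ω → ℝ≥0∞} (hC : Measurable[predictable ℱ] fun p : ℝ × Ω => C p.1 p.2) (a b : ℝ) :
    Measurable fun ω => ∫⁻ t in Ico a b, C t ω ∂(eventMeasure S i ω) :=
  hS.measurable_setLIntegral i hC measurableSet_Ico subset_rfl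

lemma IsPointProcess.ae_mem_restrict (hS : IsPointProcess P ℱ S) (j : Fin 2) (ω : Ω) {B : Set ℝ}
    (hB : MeasurableSet B) : ∀ᵐ v ∂((eventMeasure S j ω).restrict B), v ∈ S j ω ∧ v ∈ B := by
  have hm : MeasurableSet (S j ω) :=
    (countable_of_finite_inter_Icc (hS.locallyFinite j ω)).measurableSet
  exact (ae_restrict_of_ae (ae_restrict_mem hm)).and (ae_restrict_mem hB)

/-- The number of events of type `i` in `[0, t)`, the left-continuous and hence predictable
version of `N`. -/
def countBefore (S : Fin 2 → Ω → Set ℝ) (i : Fin 2) (t : ℝ) (ω : Ω) : ℝ≥0∞ :=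
  eventMeasure S i ω (Ico 0 t)

lemma countBefore_add (j : Fin 2) {a b : ℝ} (ha : 0 ≤ a) (hab : a ≤ b) (ω : Ω) :
    countBefore S j b ω = countBefore S j a ω + eventMeasure S j ω (Ico a b) := by
  rw [countBefore, countBefore, ← Ico_union_Ico_eq_Ico ha hab,
    measure_union Ico_disjoint_Ico_same measurableSet_Ico]

lemma countBefore_mono (j : Fin 2) {s t : ℝ} (hst : s ≤ t) (ω : Ω) :
    countBefore S j s ω ≤ countBefore S j t ω :=
  measure_mono (Ico_subset_Ico_right hst)

lemma IsPointProcess.measurable_countBefore (hS : IsPointProcess P ℱ S) (i : Fin 2) :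
    Measurable[predictable ℱ] fun p : ℝ × Ω => countBefore S i p.1 p.2 := by
  convert hS.measurable_lintegral_Iio i (g := (Ici 0).indicator 1)
    (measurable_one.indicator measurableSet_Ici) using 2 with p
  rw [lintegral_indicator_one measurableSet_Ici, Measure.restrict_apply measurableSet_Ici,
    Ici_inter_Iio, countBefore]

lemma min_countBefore_sq_le_of_gap (j : Fin 2) (n : ℕ) {a b : ℝ} (ha : 0 ≤ a) (hab : a < b)
    (ω : Ω) (hgap : S j ω ∩ Ioo a b = ∅) :
    (min (countBefore S j b ω) n) ^ 2 ≤ (min (countBefore S j a ω) n) ^ 2 +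
      ∫⁻ v in Ico a b, (2 * min (countBefore S j v ω) n + 1) ∂(eventMeasure S j ω) := by
  have hcount : eventMeasure S j ω (Ico a b) = (S j ω).indicator 1 a := by
    rw [← lintegral_count_restrict_Ico hab hgap, ← setLIntegral_one]
    rfl
  rw [countBefore_add j ha hab.le, hcount, eventMeasure, lintegral_count_restrict_Ico hab hgap]
  by_cases haS : a ∈ S j ω
  · rw [indicator_of_mem haS, indicator_of_mem haS]
    generalize countBefore S j a ω = x
    calc (min (x + (1 : ℝ → ℝ≥0∞) a) n) ^ 2 ≤ (min x n + 1) ^ 2 := by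
          gcongr
          rw [← min_add_add_right]
          exact min_le_min le_rfl le_self_add
      _ = _ := by ring
  · simp [haS]

lemma IsPointProcess.min_countBefore_sq_le (hS : IsPointProcess P ℱ S) (j : Fin 2) (n : ℕ)
    {t : ℝ} (ht : 0 < t) (ω : Ω) :
    (min (countBefore S j t ω) n) ^ 2 ≤
      ∫⁻ v in Ico 0 t, (2 * min (countBefore S j v ω) n + 1) ∂(eventMeasure S j ω) := by
  have hrel := rel_of_gap (hS.locallyFinite j ω) (R := fun a b => 0 ≤ a →
    (min (countBefore S j b ω) n) ^ 2 ≤ (min (countBefore S j a ω) n) ^ 2 +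
      ∫⁻ v in Ico a b, (2 * min (countBefore S j v ω) n + 1) ∂(eventMeasure S j ω))
    (fun a b hab hgap ha => min_countBefore_sq_le_of_gap j n ha hab ω hgap) ?_ ht
  · simpa [countBefore] using hrel le_rfl
  · intro a b c hab hbc h₁ h₂ ha
    rw [← lintegral_Ico_add_Ico _ hab.le hbc.le, ← add_assoc]
    exact (h₂ (ha.trans hab.le)).trans (by gcongr; exact h₁ ha)

end Predictable

/-! ### The components of the intensity -/

section Components

variable {Ω : Type*} {mΩ : MeasurableSpace Ω} {P : Measure Ω} {ℱ : Filtration ℝ mΩ} {K : ℕ}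
  {θ : Params K} {S : Fin 2 → Ω → Set ℝ}

lemma kernel_apply (k : Fin K) (t : ℝ) (i j : Fin 2) :
    θ.kernel k t i j = θ.α k i j * Real.exp (-θ.β k i * t) := rfl

lemma kernel_nonneg (hα : ∀ k i j, 0 ≤ θ.α k i j) (k : Fin K) (t : ℝ) (i j : Fin 2) :
    0 ≤ θ.kernel k t i j :=
  mul_nonneg (hα k i j) (Real.exp_pos _).le

lemma ofReal_kernel_add (k : Fin K) (s t : ℝ) (i j : Fin 2) :
    ENNReal.ofReal (θ.kernel k (s + t) i j) =
      ENNReal.ofReal (Real.exp (-θ.β k i * s)) * ENNReal.ofReal (θ.kernel k t i j) := by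
  rw [← ENNReal.ofReal_mul (Real.exp_pos _).le, kernel_apply, kernel_apply, mul_add, Real.exp_add]
  congr 1
  ring

@[fun_prop]
lemma measurable_kernel (k : Fin K) (i j : Fin 2) : Measurable fun t => θ.kernel k t i j := by
  simp only [kernel_apply]
  fun_prop

/-- The component `λ_k(t)` of the intensity as an integral with values in `[0, ∞]`, which does not
presuppose convergence. -/
def componentE (θ : Params K) (S : Fin 2 → Ω → Set ℝ) (k : Fin K) (t : ℝ) (ω : Ω)
    (i : Fin 2) : ℝ≥0∞ :=
  ∑ j, ∫⁻ u in Iio t, ENNReal.ofReal (θ.kernel k (t - u) i j) ∂(eventMeasure S j ω)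

/-- The outcomes for which the intensity is finite at all times and there are no common events. -/
structure Regular (θ : Params K) (S : Fin 2 → Ω → Set ℝ) (ω : Ω) : Prop where
  integrableOn : ∀ k i j t,
    IntegrableOn (fun u => θ.kernel k (t - u) i j) (Iio t) (eventMeasure S j ω)
  disjoint : Disjoint (S 0 ω) (S 1 ω)

lemma IsHawkes.ae_regular (hS : IsHawkes θ P ℱ S) : ∀ᵐ ω ∂P, Regular θ S ω := by
  filter_upwards [hS.convergent, hS.pointProcess.noCommonEvents] with ω hconv hdisj
  exact ⟨hconv, hdisj⟩

lemma Regular.notMem {ω : Ω} (hω : Regular θ S ω) {j l : Fin 2} (hjl : l ≠ j) {v : ℝ}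
    (hv : v ∈ S j ω) : v ∉ S l ω := by
  fin_cases j <;> fin_cases l
  · exact absurd rfl hjl
  · exact Set.disjoint_left.1 hω.disjoint hv
  · exact Set.disjoint_right.1 hω.disjoint hv
  · exact absurd rfl hjl

lemma component_nonneg (hα : ∀ k i j, 0 ≤ θ.α k i j) (k : Fin K) (t : ℝ) (ω : Ω) (i : Fin 2) :
    0 ≤ component θ S k t ω i :=
  Finset.sum_nonneg fun _ _ => integral_nonneg fun _ => kernel_nonneg hα _ _ _ _

lemma Regular.ofReal_component {ω : Ω} (hω : Regular θ S ω) (hα : ∀ k i j, 0 ≤ θ.α k i j)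
    (k : Fin K) (t : ℝ) (i : Fin 2) :
    ENNReal.ofReal (component θ S k t ω i) = componentE θ S k t ω i := by
  rw [component, ENNReal.ofReal_sum_of_nonneg
    fun _ _ => integral_nonneg fun _ => kernel_nonneg hα _ _ _ _]
  exact Finset.sum_congr rfl fun j _ => ofReal_integral_eq_lintegral_ofReal
    (hω.integrableOn k i j t) (ae_of_all _ fun _ => kernel_nonneg hα _ _ _ _)

lemma componentE_eq_add (k : Fin K) {a b : ℝ} (hab : a ≤ b) (ω : Ω) (i : Fin 2) :
    componentE θ S k b ω i =
      ENNReal.ofReal (Real.exp (-θ.β k i * (b - a))) * componentE θ S k a ω i +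
      ∑ j, ∫⁻ u in Ico a b, ENNReal.ofReal (θ.kernel k (b - u) i j) ∂(eventMeasure S j ω) := by
  rw [componentE, componentE, Finset.mul_sum, ← Finset.sum_add_distrib]
  refine Finset.sum_congr rfl fun j _ => ?_
  have hdisj : Disjoint (Iio a) (Ico a b) :=
    Set.disjoint_left.2 fun x hxa hx => (not_lt.2 hx.1) hxa
  rw [← lintegral_const_mul _ (by fun_prop), ← Iio_union_Ico_eq_Iio hab,
    lintegral_union measurableSet_Ico hdisj]
  congr 1
  refine lintegral_congr fun u => ?_
  rw [← ofReal_kernel_add, sub_add_sub_cancel]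

lemma Regular.componentE_eq_add_of_mem {ω : Ω} (hω : Regular θ S ω) (k : Fin K) (i : Fin 2)
    {j : Fin 2} {v t : ℝ} (hv : v ∈ S j ω) (hvt : v < t) :
    componentE θ S k t ω i =
      (ENNReal.ofReal (Real.exp (-θ.β k i * (t - v))) * componentE θ S k v ω i +
        ENNReal.ofReal (θ.kernel k (t - v) i j)) +
      ∑ l, ∫⁻ u in Ioo v t, ENNReal.ofReal (θ.kernel k (t - u) i l) ∂(eventMeasure S l ω) := by
  have hjump : ∀ l, ∫⁻ u in {v}, ENNReal.ofReal (θ.kernel k (t - u) i l) ∂(eventMeasure S l ω) =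
      if l = j then ENNReal.ofReal (θ.kernel k (t - v) i l) else 0 := fun l => by
    rw [eventMeasure, lintegral_count_restrict_singleton]
    split_ifs with hl
    · rw [indicator_of_mem (hl ▸ hv)]
    · rw [indicator_of_notMem (hω.notMem hl hv)]
  simp only [componentE_eq_add k hvt.le, lintegral_Ico_eq_add_Ioo _ hvt, hjump,
    Finset.sum_add_distrib, Finset.sum_ite_eq', Finset.mem_univ, if_true, add_assoc]

/-- Integration by parts: an event counted by `countBefore` and an event that contributes to the
component are distinguished by which comes first. -/
lemma IsPointProcess.componentE_mul_countBefore (hS : IsPointProcess P ℱ S) {ω : Ω}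
    (hω : Regular θ S ω) (k : Fin K) (i j : Fin 2) (t : ℝ) :
    componentE θ S k t ω i * countBefore S j t ω =
      ∫⁻ v in Ico 0 t, (ENNReal.ofReal (Real.exp (-θ.β k i * (t - v))) * componentE θ S k v ω i +
        ENNReal.ofReal (θ.kernel k (t - v) i j)) ∂(eventMeasure S j ω) +
      ∑ l, ∫⁻ u in Ico 0 t, ENNReal.ofReal (θ.kernel k (t - u) i l) * countBefore S j u ω
        ∂(eventMeasure S l ω) := by
  have hfin : ∀ l, IsLocallyFiniteMeasure (eventMeasure S l ω) := fun l =>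
    hS.isLocallyFiniteMeasure_eventMeasure l ω
  have hevents := (hS.ae_mem_restrict j ω (measurableSet_Ico (a := 0) (b := t))).mono fun v hv =>
    hω.componentE_eq_add_of_mem k i hv.1 hv.2.2
  have hafter : ∀ l, Measurable fun v => ∫⁻ u in Ioo v t,
      ENNReal.ofReal (θ.kernel k (t - u) i l) ∂(eventMeasure S l ω) := fun l =>
    Antitone.measurable fun v v' hv => lintegral_mono_set (Ioo_subset_Ioo_left hv)
  calc componentE θ S k t ω i * countBefore S j t ω
      = ∫⁻ _ in Ico 0 t, componentE θ S k t ω i ∂(eventMeasure S j ω) := by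
        rw [setLIntegral_const, countBefore]
    _ = _ := by
        rw [lintegral_congr_ae hevents,
          lintegral_add_right _ (Finset.measurable_fun_sum _ fun l _ => hafter l),
          lintegral_finsetSum _ fun l _ => hafter l]
        congr 1
        exact Finset.sum_congr rfl fun l _ => lintegral_lintegral_Ioo _ _ (by fun_prop) 0 t

end Components

section Intensity

variable {Ω : Type*} {mΩ : MeasurableSpace Ω} {P : Measure Ω} {ℱ : Filtration ℝ mΩ} {K : ℕ}
  {θ : Params K} {S : Fin 2 → Ω → Set ℝ}

/-- The vector of all components of the intensity, a Markov process. -/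
def state (θ : Params K) (S : Fin 2 → Ω → Set ℝ) (t : ℝ) (ω : Ω) (k : Fin K) (i : Fin 2) : ℝ :=
  component θ S k t ω i

lemma state_nonneg (hα : ∀ k i j, 0 ≤ θ.α k i j) (t : ℝ) (ω : Ω) : 0 ≤ state θ S t ω :=
  fun k i => component_nonneg hα k t ω i

lemma intensity_eq_rate (t : ℝ) (ω : Ω) (j : Fin 2) :
    intensity θ S t ω j = rate θ (state θ S t ω) j := rfl

lemma IsPointProcess.measurable_lintegral_kernel (hS : IsPointProcess P ℱ S) (k : Fin K)
    (i j : Fin 2) : Measurable[predictable ℱ] fun p : ℝ × Ω =>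
      ∫⁻ u in Iio p.1, ENNReal.ofReal (θ.kernel k (p.1 - u) i j) ∂(eventMeasure S j p.2) := by
  have hm : Measurable fun u => ENNReal.ofReal (θ.kernel k (-u) i j) := by fun_prop
  have hexp : Measurable fun t : ℝ => ENNReal.ofReal (Real.exp (-θ.β k i * t)) := by fun_prop
  simp only [sub_eq_add_neg, ofReal_kernel_add, lintegral_const_mul _ hm]
  exact (hexp.comp (measurable_predictable_fst ℱ)).mul (hS.measurable_lintegral_Iio j hm)

lemma IsPointProcess.measurable_componentE (hS : IsPointProcess P ℱ S) (k : Fin K) (i : Fin 2) :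
    Measurable[predictable ℱ] fun p : ℝ × Ω => componentE θ S k p.1 p.2 i :=
  Finset.measurable_sum _ fun j _ => hS.measurable_lintegral_kernel k i j

lemma IsPointProcess.measurable_component (hS : IsPointProcess P ℱ S)
    (hα : ∀ k i j, 0 ≤ θ.α k i j) (k : Fin K) (i : Fin 2) :
    Measurable[predictable ℱ] fun p : ℝ × Ω => component θ S k p.1 p.2 i := by
  have hintegral : ∀ (p : ℝ × Ω) j,
      ∫ u in Iio p.1, θ.kernel k (p.1 - u) i j ∂(eventMeasure S j p.2) =
        (∫⁻ u in Iio p.1, ENNReal.ofReal (θ.kernel k (p.1 - u) i j)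
          ∂(eventMeasure S j p.2)).toReal := fun p j =>
    integral_eq_lintegral_of_nonneg_ae (ae_of_all _ fun _ => kernel_nonneg hα _ _ _ _)
      (Measurable.aestronglyMeasurable (by fun_prop))
  simp only [component, hintegral]
  exact Finset.measurable_sum _ fun j _ => (hS.measurable_lintegral_kernel k i j).ennreal_toReal

lemma IsPointProcess.measurable_state_prod (hS : IsPointProcess P ℱ S)
    (hα : ∀ k i j, 0 ≤ θ.α k i j) :
    Measurable[predictable ℱ] fun p : ℝ × Ω => state θ S p.1 p.2 :=
  @measurable_pi_lambda _ _ _ (predictable ℱ) _ _ fun k =>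
    @measurable_pi_lambda _ _ _ (predictable ℱ) _ _ fun i => hS.measurable_component hα k i

lemma IsPointProcess.measurable_state (hS : IsPointProcess P ℱ S)
    (hα : ∀ k i j, 0 ≤ θ.α k i j) (t : ℝ) : Measurable (state θ S t) :=
  ((hS.measurable_state_prod hα).mono (predictable_le ℱ) le_rfl).comp measurable_prodMk_left

lemma IsPointProcess.measurable_intensity (hS : IsPointProcess P ℱ S)
    (hα : ∀ k i j, 0 ≤ θ.α k i j) (i : Fin 2) :
    Measurable[predictable ℱ] fun p : ℝ × Ω => intensity θ S p.1 p.2 i :=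
  (measurable_rate θ i).comp (hS.measurable_state_prod hα)

lemma IsHawkes.lintegral_eventMeasure [SFinite P] (hS : IsHawkes θ P ℱ S)
    (hα : ∀ k i j, 0 ≤ θ.α k i j) (i : Fin 2) {C : ℝ → Ω → ℝ≥0∞}
    (hC : Measurable[predictable ℱ] fun p : ℝ × Ω => C p.1 p.2) {B : Set ℝ}
    (hB : MeasurableSet B) :
    ∫⁻ ω, ∫⁻ t in B, C t ω ∂(eventMeasure S i ω) ∂P =
      ∫⁻ t in B, ∫⁻ ω, C t ω * ENNReal.ofReal (intensity θ S t ω i) ∂P := by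
  set CB : ℝ × Ω → ℝ≥0∞ := (Prod.fst ⁻¹' B).indicator fun p => C p.1 p.2
  have hCB : Measurable[predictable ℱ] CB := hC.indicator (measurable_predictable_fst ℱ hB)
  have hCB_apply : ∀ t ω, CB (t, ω) = B.indicator (fun t => C t ω) t := fun _ _ => rfl
  have hjoint : Measurable fun p : ℝ × Ω => CB p * ENNReal.ofReal (intensity θ S p.1 p.2 i) :=
    (hCB.mul (hS.pointProcess.measurable_intensity hα i).ennreal_ofReal).mono
      (predictable_le ℱ) le_rfl
  calc ∫⁻ ω, ∫⁻ t in B, C t ω ∂(eventMeasure S i ω) ∂P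
      = ∫⁻ ω, ∫⁻ t, CB (t, ω) ∂(eventMeasure S i ω) ∂P := by
        simp only [hCB_apply, lintegral_indicator hB]
    _ = ∫⁻ ω, ∫⁻ t, CB (t, ω) * ENNReal.ofReal (intensity θ S t ω i) ∂volume ∂P :=
        hS.stochasticIntensity i _ hCB
    _ = ∫⁻ t, ∫⁻ ω, CB (t, ω) * ENNReal.ofReal (intensity θ S t ω i) ∂P :=
        lintegral_lintegral_swap (hjoint.comp measurable_swap).aemeasurable
    _ = _ := by
        rw [← lintegral_indicator hB]
        refine lintegral_congr fun t => ?_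
        by_cases ht : t ∈ B <;> simp [hCB_apply, ht]

lemma IsHawkes.ae_notMem [SFinite P] (hS : IsHawkes θ P ℱ S) (hα : ∀ k i j, 0 ≤ θ.α k i j)
    (i : Fin 2) (t : ℝ) : ∀ᵐ ω ∂P, t ∉ S i ω := by
  have hzero : ∫⁻ ω, ∫⁻ _ in {t}, 1 ∂(eventMeasure S i ω) ∂P = 0 := by
    rw [hS.lintegral_eventMeasure hα i (C := fun _ _ => 1) measurable_const
      (measurableSet_singleton t), Measure.restrict_singleton]
    simp
  rw [lintegral_eq_zero_iff (hS.pointProcess.measurable_setLIntegral i measurable_const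
    (measurableSet_singleton t) (singleton_subset_iff.2 ⟨le_rfl, lt_add_one t⟩))] at hzero
  filter_upwards [hzero] with ω hω hmem
  rw [eventMeasure, lintegral_count_restrict_singleton, indicator_of_mem hmem] at hω
  exact one_ne_zero hω

lemma IsHawkes.ae_countBefore [SFinite P] (hS : IsHawkes θ P ℱ S)
    (hα : ∀ k i j, 0 ≤ θ.α k i j) (j : Fin 2) (t : ℝ) :
    ∀ᵐ ω ∂P, ENNReal.ofReal (N S t ω j) = countBefore S j t ω := by
  filter_upwards [hS.ae_notMem hα j 0, hS.ae_notMem hα j t] with ω h0 ht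
  rw [countBefore, eventMeasure, count_restrict_apply measurableSet_Ico
    (hS.pointProcess.finite_inter j ω Ico_subset_Icc_self), N, ENNReal.ofReal_natCast]
  congr 2
  ext x
  simp only [mem_inter_iff, mem_Ioc, mem_Ico, and_congr_right_iff]
  intro hx
  have hx0 : x ≠ 0 := fun h => h0 (h ▸ hx)
  have hxt : x ≠ t := fun h => ht (h ▸ hx)
  exact ⟨fun h => ⟨h.1.le, h.2.lt_of_ne hxt⟩, fun h => ⟨h.1.lt_of_ne hx0.symm, h.2.le⟩⟩

end Intensity

/-! ### Exponential functionals of the state -/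

section Exponential

variable {Ω : Type*} {mΩ : MeasurableSpace Ω} {P : Measure Ω} {ℱ : Filtration ℝ mΩ} {K : ℕ}
  {θ : Params K} {S : Fin 2 → Ω → Set ℝ}

/-- The flow followed by the state between events. -/
def decay (θ : Params K) (t : ℝ) (x : Fin K → Fin 2 → ℝ) : Fin K → Fin 2 → ℝ :=
  fun k i => Real.exp (-θ.β k i * t) * x k i

/-- The increase of the state at time `a`; it vanishes unless `a` is an event time. -/
def jump (θ : Params K) (S : Fin 2 → Ω → Set ℝ) (a : ℝ) (ω : Ω) : Fin K → Fin 2 → ℝ :=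
  fun k i => ∑ j, (S j ω).indicator (fun _ => θ.α k i j) a

lemma decay_nonneg {x : Fin K → Fin 2 → ℝ} (hx : 0 ≤ x) (t : ℝ) : 0 ≤ decay θ t x :=
  fun k i => mul_nonneg (Real.exp_pos _).le (hx k i)

lemma jump_nonneg (hα : ∀ k i j, 0 ≤ θ.α k i j) (a : ℝ) (ω : Ω) : 0 ≤ jump θ S a ω :=
  fun k i => Finset.sum_nonneg fun j _ => indicator_nonneg (fun _ _ => hα k i j) a

lemma pairing_jump (c : Fin K → Fin 2 → ℝ) (a : ℝ) (ω : Ω) :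
    pairing c (jump θ S a ω) = ∑ j, (S j ω).indicator (fun _ => gain θ c j) a := by
  have hgain : ∀ j, (S j ω).indicator (fun _ => gain θ c j) a =
      ∑ k, ∑ i, c k i * (S j ω).indicator (fun _ => θ.α k i j) a := fun j => by
    by_cases ha : a ∈ S j ω <;> simp [ha, gain]
  simp only [hgain, pairing, jump, Finset.mul_sum]
  rw [Finset.sum_comm (s := (Finset.univ : Finset (Fin 2)))]
  exact Finset.sum_congr rfl fun k _ => Finset.sum_comm

lemma Regular.state_of_gap {ω : Ω} (hω : Regular θ S ω) (hα : ∀ k i j, 0 ≤ θ.α k i j)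
    {a b u : ℝ} (hu : u ∈ Ioc a b) (hgap : ∀ j, S j ω ∩ Ioo a b = ∅) :
    state θ S u ω = decay θ (u - a) (state θ S a ω + jump θ S a ω) := by
  ext k i
  have hgap' : ∀ j, S j ω ∩ Ioo a u = ∅ := fun j =>
    subset_eq_empty (inter_subset_inter_right _ (Ioo_subset_Ioo_right hu.2)) (hgap j)
  have hkernel : ∀ j, ∫⁻ v in Ico a u, ENNReal.ofReal (θ.kernel k (u - v) i j)
      ∂(eventMeasure S j ω) = ENNReal.ofReal (Real.exp (-θ.β k i * (u - a))) *
        ENNReal.ofReal ((S j ω).indicator (fun _ => θ.α k i j) a) := fun j => by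
    rw [eventMeasure, lintegral_count_restrict_Ico hu.1 (hgap' j),
      ← ENNReal.ofReal_mul (by positivity)]
    by_cases ha : a ∈ S j ω
    · rw [indicator_of_mem ha, indicator_of_mem ha, kernel_apply, mul_comm]
    · simp [ha]
  have hx := state_nonneg (S := S) hα a ω k i
  have hj := jump_nonneg (S := S) hα a ω k i
  refine (ENNReal.ofReal_eq_ofReal_iff (state_nonneg hα u ω k i)
    (decay_nonneg (add_nonneg (state_nonneg hα a ω) (jump_nonneg hα a ω)) _ k i)).1 ?_
  rw [state, hω.ofReal_component hα, componentE_eq_add k hu.1.le, ← hω.ofReal_component hα]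
  simp only [hkernel, ← Finset.mul_sum, ← ENNReal.ofReal_sum_of_nonneg
    fun j _ => indicator_nonneg (fun _ _ => hα k i j) a]
  rw [← mul_add, decay, ENNReal.ofReal_mul (by positivity), Pi.add_apply, Pi.add_apply,
    ENNReal.ofReal_add hx hj, state, jump]

lemma hasDerivAt_exp_neg_pairing_decay (c x : Fin K → Fin 2 → ℝ) (t : ℝ) :
    HasDerivAt (fun t => Real.exp (-pairing c (decay θ t x)))
      (Real.exp (-pairing c (decay θ t x)) * pairing (θ.β * c) (decay θ t x)) t := by
  have hpairing : HasDerivAt (fun t => pairing c (decay θ t x))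
      (-pairing (θ.β * c) (decay θ t x)) t := by
    simp only [pairing, decay, ← Finset.sum_neg_distrib]
    refine HasDerivAt.fun_sum fun k _ => HasDerivAt.fun_sum fun i _ => ?_
    have hexp : HasDerivAt (fun t => Real.exp (-θ.β k i * t))
        (Real.exp (-θ.β k i * t) * -θ.β k i) t := by
      simpa using ((hasDerivAt_id t).const_mul (-θ.β k i)).exp
    refine ((hexp.mul_const (x k i)).const_mul (c k i)).congr_deriv ?_
    simp only [Pi.mul_apply]
    ring
  simpa using hpairing.neg.exp

lemma ofReal_exp_neg_pairing_decay (hβ : ∀ k i, 0 < θ.β k i) {c x : Fin K → Fin 2 → ℝ}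
    (hc : 0 ≤ c) (hx : 0 ≤ x) {t : ℝ} (ht : 0 ≤ t) :
    ENNReal.ofReal (Real.exp (-pairing c (decay θ t x))) =
      ENNReal.ofReal (Real.exp (-pairing c x)) + ∫⁻ u in Ioc 0 t, ENNReal.ofReal
        (Real.exp (-pairing c (decay θ u x)) * pairing (θ.β * c) (decay θ u x)) := by
  have hcont : Continuous fun u =>
      Real.exp (-pairing c (decay θ u x)) * pairing (θ.β * c) (decay θ u x) := by
    simp only [pairing, decay]
    fun_prop
  have hpos : ∀ u, 0 ≤ Real.exp (-pairing c (decay θ u x)) * pairing (θ.β * c) (decay θ u x) :=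
    fun u => mul_nonneg (Real.exp_pos _).le (pairing_nonneg
      (fun k i => mul_nonneg (hβ k i).le (hc k i)) (decay_nonneg hx u))
  have hzero : decay θ 0 x = x := by ext; simp [decay]
  have hle : ∫ u in (0 : ℝ)..t, Real.exp (-pairing c (decay θ u x)) *
      pairing (θ.β * c) (decay θ u x) =
        Real.exp (-pairing c (decay θ t x)) - Real.exp (-pairing c x) := by
    rw [intervalIntegral.integral_eq_sub_of_hasDerivAt
      (fun u _ => hasDerivAt_exp_neg_pairing_decay c x u) (hcont.intervalIntegrable _ _), hzero]
  rw [← ofReal_integral_eq_lintegral_ofReal hcont.integrableOn_Ioc (ae_of_all _ hpos),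
    ← intervalIntegral.integral_of_le ht, ← ENNReal.ofReal_add (Real.exp_pos _).le
    (intervalIntegral.integral_nonneg ht fun u _ => hpos u), hle, add_sub_cancel]

lemma Regular.ofReal_exp_neg_pairing_add_jump {ω : Ω} (hω : Regular θ S ω)
    (hα : ∀ k i j, 0 ≤ θ.α k i j) {c : Fin K → Fin 2 → ℝ} (hc : 0 ≤ c) (a : ℝ) :
    ENNReal.ofReal (Real.exp (-pairing c (state θ S a ω + jump θ S a ω))) +
      ∑ j, (S j ω).indicator (fun u => ENNReal.ofReal (Real.exp (-pairing c (state θ S u ω)) *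
        (1 - Real.exp (-gain θ c j)))) a =
    ENNReal.ofReal (Real.exp (-pairing c (state θ S a ω))) := by
  have hsplit : ∀ j, ENNReal.ofReal (Real.exp (-(pairing c (state θ S a ω) + gain θ c j))) +
      ENNReal.ofReal (Real.exp (-pairing c (state θ S a ω)) * (1 - Real.exp (-gain θ c j))) =
        ENNReal.ofReal (Real.exp (-pairing c (state θ S a ω))) := fun j => by
    have hg : 0 ≤ 1 - Real.exp (-gain θ c j) :=
      sub_nonneg.2 (Real.exp_le_one_iff.2 (neg_nonpos.2 (gain_nonneg hα hc j)))
    rw [← ENNReal.ofReal_add (Real.exp_pos _).le (mul_nonneg (Real.exp_pos _).le hg), neg_add,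
      Real.exp_add]
    congr 1
    ring
  rw [pairing_add_right, pairing_jump, Fin.sum_univ_two, Fin.sum_univ_two]
  by_cases h0 : a ∈ S 0 ω
  · have h1 : a ∉ S 1 ω := Set.disjoint_left.1 hω.disjoint h0
    simpa [h0, h1] using hsplit 0
  · by_cases h1 : a ∈ S 1 ω
    · simpa [h0, h1] using hsplit 1
    · simp [h0, h1]

lemma Regular.ofReal_exp_neg_pairing_of_gap {ω : Ω} (hω : Regular θ S ω)
    (hα : ∀ k i j, 0 ≤ θ.α k i j) (hβ : ∀ k i, 0 < θ.β k i) {c : Fin K → Fin 2 → ℝ} (hc : 0 ≤ c)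
    {a b : ℝ} (hab : a < b) (hgap : ∀ j, S j ω ∩ Ioo a b = ∅) :
    ENNReal.ofReal (Real.exp (-pairing c (state θ S b ω))) +
      ∑ j, ∫⁻ u in Ico a b, ENNReal.ofReal (Real.exp (-pairing c (state θ S u ω)) *
        (1 - Real.exp (-gain θ c j))) ∂(eventMeasure S j ω) =
    ENNReal.ofReal (Real.exp (-pairing c (state θ S a ω))) + ∫⁻ u in Ico a b, ENNReal.ofReal
      (Real.exp (-pairing c (state θ S u ω)) * pairing (θ.β * c) (state θ S u ω)) := by
  set x := state θ S a ω + jump θ S a ω with hx_def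
  have hx : 0 ≤ x := add_nonneg (state_nonneg hα a ω) (jump_nonneg hα a ω)
  have hstate : ∀ u ∈ Ioc a b, state θ S u ω = decay θ (u - a) x := fun u hu =>
    hω.state_of_gap hα hu hgap
  set f : ℝ → ℝ≥0∞ := fun u => ENNReal.ofReal
    (Real.exp (-pairing c (decay θ u x)) * pairing (θ.β * c) (decay θ u x)) with hf
  have hflow : ∫⁻ u in Ico a b, ENNReal.ofReal (Real.exp (-pairing c (state θ S u ω)) *
      pairing (θ.β * c) (state θ S u ω)) = ∫⁻ u in Ioc 0 (b - a), f u := by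
    have hpre : (fun u => u - a) ⁻¹' Ioc 0 (b - a) = Ioc a b := by ext u; simp
    rw [setLIntegral_congr Ico_ae_eq_Ioc,
      ← (measurePreserving_sub_right volume a).setLIntegral_comp_preimage_emb
        (MeasurableEquiv.subRight a).measurableEmbedding f (Ioc 0 (b - a)), hpre]
    exact setLIntegral_congr_fun measurableSet_Ioc fun u hu => by simp only [hstate u hu, hf]
  have hjump : ∀ j, ∫⁻ u in Ico a b, ENNReal.ofReal (Real.exp (-pairing c (state θ S u ω)) *
      (1 - Real.exp (-gain θ c j))) ∂(eventMeasure S j ω) = (S j ω).indicator (fun u =>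
        ENNReal.ofReal (Real.exp (-pairing c (state θ S u ω)) *
          (1 - Real.exp (-gain θ c j)))) a := fun j =>
    lintegral_count_restrict_Ico hab (hgap j) _
  simp only [hjump]
  rw [hflow, hstate b ⟨hab, le_rfl⟩, ofReal_exp_neg_pairing_decay hβ hc hx (sub_nonneg.2 hab.le),
    add_right_comm, hx_def, hω.ofReal_exp_neg_pairing_add_jump hα hc a]

lemma IsPointProcess.ofReal_exp_neg_pairing (hS : IsPointProcess P ℱ S) {ω : Ω}
    (hω : Regular θ S ω) (hα : ∀ k i j, 0 ≤ θ.α k i j) (hβ : ∀ k i, 0 < θ.β k i)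
    {c : Fin K → Fin 2 → ℝ} (hc : 0 ≤ c) {a b : ℝ} (hab : a < b) :
    ENNReal.ofReal (Real.exp (-pairing c (state θ S b ω))) +
      ∑ j, ∫⁻ u in Ico a b, ENNReal.ofReal (Real.exp (-pairing c (state θ S u ω)) *
        (1 - Real.exp (-gain θ c j))) ∂(eventMeasure S j ω) =
    ENNReal.ofReal (Real.exp (-pairing c (state θ S a ω))) + ∫⁻ u in Ico a b, ENNReal.ofReal
      (Real.exp (-pairing c (state θ S u ω)) * pairing (θ.β * c) (state θ S u ω)) := by
  refine rel_of_gap (T := ⋃ j, S j ω) (R := fun a b =>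
    ENNReal.ofReal (Real.exp (-pairing c (state θ S b ω))) +
      ∑ j, ∫⁻ u in Ico a b, ENNReal.ofReal (Real.exp (-pairing c (state θ S u ω)) *
        (1 - Real.exp (-gain θ c j))) ∂(eventMeasure S j ω) =
    ENNReal.ofReal (Real.exp (-pairing c (state θ S a ω))) + ∫⁻ u in Ico a b, ENNReal.ofReal
      (Real.exp (-pairing c (state θ S u ω)) * pairing (θ.β * c) (state θ S u ω)))
    (fun a b => ?_) (fun a b hab hgap => ?_) (fun a b d hab hbd h₁ h₂ => ?_) hab
  · rw [iUnion_inter]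
    exact finite_iUnion fun j => hS.locallyFinite j ω a b
  · exact hω.ofReal_exp_neg_pairing_of_gap hα hβ hc hab fun j =>
      subset_eq_empty (inter_subset_inter_left _ (subset_iUnion (fun j => S j ω) j)) hgap
  · simp only [← lintegral_Ico_add_Ico _ hab.le hbd.le, Finset.sum_add_distrib]
    rw [add_left_comm, h₂, ← add_assoc, ← add_assoc, ← h₁, add_comm (ENNReal.ofReal _)]

end Exponential

/-! ### Moments in steady state -/

section SteadyState

variable {Ω : Type*} {mΩ : MeasurableSpace Ω} {P : Measure Ω} {ℱ : Filtration ℝ mΩ} {K : ℕ}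
  {θ : Params K} {S : Fin 2 → Ω → Set ℝ}

lemma IsSteadyState.identDistrib_comp (hss : IsSteadyState θ P S) {E : Type*}
    [MeasurableSpace E] {f : (Fin K → Fin 2 → ℝ) → E} (hf : Measurable f) {t : ℝ} (ht : 0 ≤ t) :
    IdentDistrib (fun ω => f (state θ S t ω)) (fun ω => f (state θ S 0 ω)) P P :=
  (hss t ht).comp hf

lemma IsSteadyState.setLIntegral_Ico (hss : IsSteadyState θ P S)
    {f : (Fin K → Fin 2 → ℝ) → ℝ≥0∞} (hf : Measurable f) (t : ℝ) :
    ∫⁻ u in Ico 0 t, ∫⁻ ω, f (state θ S u ω) ∂P =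
      ENNReal.ofReal t * ∫⁻ ω, f (state θ S 0 ω) ∂P := by
  rw [setLIntegral_congr_fun measurableSet_Ico
    fun u hu => (hss.identDistrib_comp hf hu.1).lintegral_eq, setLIntegral_const,
    Real.volume_Ico, sub_zero, mul_comm]

lemma IsSteadyState.lintegral_setLIntegral_Ico [SFinite P] (hss : IsSteadyState θ P S)
    (hS : IsPointProcess P ℱ S) (hα : ∀ k i j, 0 ≤ θ.α k i j) {f : (Fin K → Fin 2 → ℝ) → ℝ≥0∞}
    (hf : Measurable f) (t : ℝ) :
    ∫⁻ ω, (∫⁻ u in Ico 0 t, f (state θ S u ω)) ∂P =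
      ENNReal.ofReal t * ∫⁻ ω, f (state θ S 0 ω) ∂P := by
  have hmeas := (hf.comp (hS.measurable_state_prod hα)).mono (predictable_le ℱ) le_rfl
  rw [lintegral_lintegral_swap (f := fun ω u => f (state θ S u ω))
    (hmeas.comp measurable_swap).aemeasurable]
  exact hss.setLIntegral_Ico hf t

lemma IsHawkes.lintegral_eventMeasure_state [SFinite P] (hS : IsHawkes θ P ℱ S)
    (hss : IsSteadyState θ P S) (hα : ∀ k i j, 0 ≤ θ.α k i j) (j : Fin 2)
    {f : (Fin K → Fin 2 → ℝ) → ℝ≥0∞} (hf : Measurable f) (t : ℝ) :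
    ∫⁻ ω, ∫⁻ u in Ico 0 t, f (state θ S u ω) ∂(eventMeasure S j ω) ∂P =
      ENNReal.ofReal t *
        ∫⁻ ω, f (state θ S 0 ω) * ENNReal.ofReal (rate θ (state θ S 0 ω) j) ∂P := by
  rw [hS.lintegral_eventMeasure hα j (C := fun u ω => f (state θ S u ω))
    (hf.comp (hS.pointProcess.measurable_state_prod hα)) measurableSet_Ico]
  exact hss.setLIntegral_Ico (f := fun x => f x * ENNReal.ofReal (rate θ x j)) (by fun_prop) t

lemma IsHawkes.lintegral_countBefore [SFinite P] (hS : IsHawkes θ P ℱ S)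
    (hss : IsSteadyState θ P S) (hα : ∀ k i j, 0 ≤ θ.α k i j) (j : Fin 2) (t : ℝ) :
    ∫⁻ ω, countBefore S j t ω ∂P =
      ENNReal.ofReal t * ∫⁻ ω, ENNReal.ofReal (rate θ (state θ S 0 ω) j) ∂P := by
  simpa [countBefore] using hS.lintegral_eventMeasure_state hss hα j (f := fun _ => 1)
    measurable_const t

lemma IsHawkes.sum_lintegral_exp_neg_pairing_mul_rate [IsProbabilityMeasure P]
    (hS : IsHawkes θ P ℱ S) (hss : IsSteadyState θ P S) (hα : ∀ k i j, 0 ≤ θ.α k i j)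
    (hβ : ∀ k i, 0 < θ.β k i) {c : Fin K → Fin 2 → ℝ} (hc : 0 ≤ c) :
    ∑ j, ∫⁻ ω, ENNReal.ofReal (Real.exp (-pairing c (state θ S 0 ω)) *
        (1 - Real.exp (-gain θ c j))) * ENNReal.ofReal (rate θ (state θ S 0 ω) j) ∂P =
      ∫⁻ ω, ENNReal.ofReal (Real.exp (-pairing c (state θ S 0 ω)) *
        pairing (θ.β * c) (state θ S 0 ω)) ∂P := by
  have hstate := hS.pointProcess.measurable_state (θ := θ) hα
  have hstate' := hS.pointProcess.measurable_state_prod (θ := θ) hα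
  have hexp : ∀ t, Measurable fun ω => ENNReal.ofReal (Real.exp (-pairing c (state θ S t ω))) :=
    fun t => by fun_prop
  have hjump : ∀ j, Measurable fun x : Fin K → Fin 2 → ℝ =>
      ENNReal.ofReal (Real.exp (-pairing c x) * (1 - Real.exp (-gain θ c j))) :=
    fun j => by fun_prop
  have hdecay : Measurable fun x : Fin K → Fin 2 → ℝ =>
      ENNReal.ofReal (Real.exp (-pairing c x) * pairing (θ.β * c) x) := by fun_prop
  have hfin : ∫⁻ ω, ENNReal.ofReal (Real.exp (-pairing c (state θ S 0 ω))) ∂P ≠ ∞ := by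
    refine ne_of_lt ((lintegral_mono (g := fun _ => 1) fun ω => ?_).trans_lt (by simp))
    exact ENNReal.ofReal_le_one.2 (Real.exp_le_one_iff.2
      (neg_nonpos.2 (pairing_nonneg hc (state_nonneg hα 0 ω))))
  have hbalance := lintegral_congr_ae (hS.ae_regular.mono fun ω hω =>
    hS.pointProcess.ofReal_exp_neg_pairing hω hα hβ hc one_pos)
  rw [lintegral_add_left (hexp 1), lintegral_add_left (hexp 0),
    (hss.identDistrib_comp (f := fun x => ENNReal.ofReal (Real.exp (-pairing c x))) (by fun_prop)
      zero_le_one).lintegral_eq,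
    ENNReal.add_right_inj hfin, lintegral_finsetSum _ fun j _ =>
      hS.pointProcess.measurable_lintegral_Ico j ((hjump j).comp hstate') 0 1,
    hss.lintegral_setLIntegral_Ico hS.pointProcess hα hdecay] at hbalance
  simpa only [hS.lintegral_eventMeasure_state hss hα _ (hjump _), ENNReal.ofReal_one, one_mul]
    using hbalance

lemma IsHawkes.laplaceIdentity [IsProbabilityMeasure P] (hS : IsHawkes θ P ℱ S)
    (hss : IsSteadyState θ P S) (hμ : ∀ i, 0 < θ.μ i) (hα : ∀ k i j, 0 ≤ θ.α k i j)
    (hβ : ∀ k i, 0 < θ.β k i) : LaplaceIdentity θ P (state θ S 0) := by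
  intro c hc
  have hX := hS.pointProcess.measurable_state (θ := θ) hα 0
  have hX0 := state_nonneg (θ := θ) (S := S) hα 0
  have hpos : ∀ j, 0 ≤ 1 - Real.exp (-gain θ c j) := fun j =>
    sub_nonneg.2 (Real.exp_le_one_iff.2 (neg_nonpos.2 (gain_nonneg hα hc j)))
  have hjump0 : ∀ ω, 0 ≤ Real.exp (-pairing c (state θ S 0 ω)) *
      ∑ j, (1 - Real.exp (-gain θ c j)) * rate θ (state θ S 0 ω) j := fun ω =>
    mul_nonneg (Real.exp_pos _).le
      (Finset.sum_nonneg fun j _ => mul_nonneg (hpos j) (rate_nonneg hμ (hX0 ω) j))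
  have hdecay0 : ∀ ω, 0 ≤ Real.exp (-pairing c (state θ S 0 ω)) *
      pairing (θ.β * c) (state θ S 0 ω) := fun ω =>
    mul_nonneg (Real.exp_pos _).le
      (pairing_nonneg (fun k i => mul_nonneg (hβ k i).le (hc k i)) (hX0 ω))
  have hdecay : Integrable (fun ω => Real.exp (-pairing c (state θ S 0 ω)) *
      pairing (θ.β * c) (state θ S 0 ω)) P := by
    simpa only [one_mul] using integrable_exp_neg_mul_pairing_mul_pairing hβ hX hX0 hc one_pos
  have hmeas : AEStronglyMeasurable (fun ω => Real.exp (-pairing c (state θ S 0 ω)) *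
      ∑ j, (1 - Real.exp (-gain θ c j)) * rate θ (state θ S 0 ω) j) P :=
    Measurable.aestronglyMeasurable (by fun_prop)
  have heq : ∫⁻ ω, ENNReal.ofReal (Real.exp (-pairing c (state θ S 0 ω)) *
      ∑ j, (1 - Real.exp (-gain θ c j)) * rate θ (state θ S 0 ω) j) ∂P =
        ∫⁻ ω, ENNReal.ofReal (Real.exp (-pairing c (state θ S 0 ω)) *
          pairing (θ.β * c) (state θ S 0 ω)) ∂P := by
    rw [← hS.sum_lintegral_exp_neg_pairing_mul_rate hss hα hβ hc,
      ← lintegral_finsetSum _ fun j _ => by fun_prop]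
    refine lintegral_congr fun ω => ?_
    rw [Finset.mul_sum, ENNReal.ofReal_sum_of_nonneg fun j _ => mul_nonneg (Real.exp_pos _).le
      (mul_nonneg (hpos j) (rate_nonneg hμ (hX0 ω) j))]
    refine Finset.sum_congr rfl fun j _ => ?_
    rw [← ENNReal.ofReal_mul' (rate_nonneg hμ (hX0 ω) j), mul_assoc]
  refine ⟨⟨hmeas, (hasFiniteIntegral_iff_ofReal (ae_of_all _ hjump0)).2 ?_⟩, ?_⟩
  · exact heq ▸ hdecay.lintegral_lt_top
  · rw [integral_eq_lintegral_of_nonneg_ae (ae_of_all _ hjump0) hmeas, heq,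
      integral_eq_lintegral_of_nonneg_ae (ae_of_all _ hdecay0) hdecay.aestronglyMeasurable]

end SteadyState

section SecondMoment

variable {Ω : Type*} {mΩ : MeasurableSpace Ω} {P : Measure Ω} {ℱ : Filtration ℝ mΩ} {K : ℕ}
  {θ : Params K} {S : Fin 2 → Ω → Set ℝ}

lemma two_mul_add_one_mul_ofReal_le {t : ℝ} (ht : 0 < t) {x : ℝ≥0∞} (hx : x ≠ ∞) {r : ℝ}
    (hr : 0 ≤ r) : (2 * x + 1) * ENNReal.ofReal r ≤
      ENNReal.ofReal (2 * t)⁻¹ * x ^ 2 + ENNReal.ofReal (2 * t * r ^ 2 + r) := by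
  have hamgm : ∀ y, (2 * y + 1) * r ≤ (2 * t)⁻¹ * y ^ 2 + (2 * t * r ^ 2 + r) := fun y => by
    have hsq : 0 ≤ (2 * t)⁻¹ * (y - 2 * t * r) ^ 2 := by positivity
    have hexpand : (2 * t)⁻¹ * (y - 2 * t * r) ^ 2 =
        (2 * t)⁻¹ * y ^ 2 + 2 * t * r ^ 2 - 2 * y * r := by
      field_simp
      ring
    linarith
  lift x to NNReal using hx
  calc (2 * (x : ℝ≥0∞) + 1) * ENNReal.ofReal r = ENNReal.ofReal ((2 * x + 1) * r) := by
        rw [ENNReal.ofReal_mul (by positivity), ENNReal.ofReal_add (by positivity) zero_le_one,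
          ENNReal.ofReal_mul zero_le_two, ENNReal.ofReal_coe_nnreal, ENNReal.ofReal_ofNat,
          ENNReal.ofReal_one]
    _ ≤ ENNReal.ofReal ((2 * t)⁻¹ * x ^ 2 + (2 * t * r ^ 2 + r)) :=
        ENNReal.ofReal_le_ofReal (hamgm x)
    _ = _ := by
        rw [ENNReal.ofReal_add (by positivity) (by positivity), ENNReal.ofReal_mul (by positivity),
          ENNReal.ofReal_pow x.coe_nonneg, ENNReal.ofReal_coe_nnreal]

lemma IsPointProcess.measurable_countBefore_apply (hS : IsPointProcess P ℱ S) (j : Fin 2)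
    (t : ℝ) : Measurable fun ω => countBefore S j t ω :=
  ((hS.measurable_countBefore j).mono (predictable_le ℱ) le_rfl).comp measurable_prodMk_left

lemma IsHawkes.lintegral_min_countBefore_sq_le [SFinite P] (hS : IsHawkes θ P ℱ S)
    (hss : IsSteadyState θ P S) (hμ : ∀ i, 0 < θ.μ i) (hα : ∀ k i j, 0 ≤ θ.α k i j) (j : Fin 2)
    (n : ℕ) {t : ℝ} (ht : 0 < t) :
    ∫⁻ ω, min (countBefore S j t ω) n ^ 2 ∂P ≤ ENNReal.ofReal t *
      (ENNReal.ofReal (2 * t)⁻¹ * ∫⁻ ω, min (countBefore S j t ω) n ^ 2 ∂P +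
        ∫⁻ ω, ENNReal.ofReal
          (2 * t * rate θ (state θ S 0 ω) j ^ 2 + rate θ (state θ S 0 ω) j) ∂P) := by
  have hC : Measurable[predictable ℱ] fun p : ℝ × Ω => 2 * min (countBefore S j p.1 p.2) n + 1 :=
    (((hS.pointProcess.measurable_countBefore j).min measurable_const).const_mul 2).add_const 1
  have hcount := hS.pointProcess.measurable_countBefore_apply j t
  calc ∫⁻ ω, min (countBefore S j t ω) n ^ 2 ∂P
      ≤ ∫⁻ ω, ∫⁻ v in Ico 0 t, (2 * min (countBefore S j v ω) n + 1)
          ∂(eventMeasure S j ω) ∂P :=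
        lintegral_mono fun ω => hS.pointProcess.min_countBefore_sq_le j n ht ω
    _ = ∫⁻ v in Ico 0 t, ∫⁻ ω, (2 * min (countBefore S j v ω) n + 1) *
          ENNReal.ofReal (intensity θ S v ω j) ∂P :=
        hS.lintegral_eventMeasure (C := fun v ω => 2 * min (countBefore S j v ω) n + 1) hα j hC
          measurableSet_Ico
    _ ≤ ∫⁻ v in Ico 0 t, ∫⁻ ω, (ENNReal.ofReal (2 * t)⁻¹ * min (countBefore S j t ω) n ^ 2 +
          ENNReal.ofReal (2 * t * rate θ (state θ S v ω) j ^ 2 + rate θ (state θ S v ω) j)) ∂P := by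
        refine setLIntegral_mono' measurableSet_Ico fun v hv => lintegral_mono fun ω => ?_
        have hne : min (countBefore S j t ω) n ≠ ∞ :=
          ((min_le_right _ _).trans_lt (ENNReal.natCast_lt_top n)).ne
        refine le_trans ?_ (two_mul_add_one_mul_ofReal_le ht hne
          (rate_nonneg hμ (state_nonneg hα v ω) j))
        rw [intensity_eq_rate]
        gcongr
        exact countBefore_mono j hv.2.le ω
    _ = _ := by
        simp_rw [lintegral_add_left
          (((hcount.min measurable_const).pow_const 2).const_mul (ENNReal.ofReal (2 * t)⁻¹)),
          lintegral_const_mul' _ _ ENNReal.ofReal_ne_top]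
        rw [lintegral_add_left measurable_const, setLIntegral_const, Real.volume_Ico, sub_zero,
          hss.setLIntegral_Ico
            (f := fun x => ENNReal.ofReal (2 * t * rate θ x j ^ 2 + rate θ x j)) (by fun_prop) t]
        ring

/- The truncation makes the term absorbed into the left-hand side finite. -/
lemma IsHawkes.lintegral_countBefore_sq_le [IsFiniteMeasure P] (hS : IsHawkes θ P ℱ S)
    (hss : IsSteadyState θ P S) (hμ : ∀ i, 0 < θ.μ i) (hα : ∀ k i j, 0 ≤ θ.α k i j) (j : Fin 2)
    {t : ℝ} (ht : 0 < t) :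
    ∫⁻ ω, countBefore S j t ω ^ 2 ∂P ≤ 2 * (ENNReal.ofReal t * ∫⁻ ω, ENNReal.ofReal
      (2 * t * rate θ (state θ S 0 ω) j ^ 2 + rate θ (state θ S 0 ω) j) ∂P) := by
  have hcount := hS.pointProcess.measurable_countBefore_apply j t
  set D := ENNReal.ofReal t * ∫⁻ ω, ENNReal.ofReal
      (2 * t * rate θ (state θ S 0 ω) j ^ 2 + rate θ (state θ S 0 ω) j) ∂P with hD
  have htrunc : ∀ n : ℕ, ∫⁻ ω, min (countBefore S j t ω) n ^ 2 ∂P ≤ 2 * D := by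
    intro n
    have habsorb := hS.lintegral_min_countBefore_sq_le hss hμ hα j n ht
    set a := ∫⁻ ω, min (countBefore S j t ω) n ^ 2 ∂P with ha
    have hfin : a ≠ ∞ := by
      refine ((lintegral_mono fun ω =>
        pow_le_pow_left₀ zero_le (min_le_right _ (n : ℝ≥0∞)) 2).trans_lt ?_).ne
      rw [lintegral_const]
      exact ENNReal.mul_lt_top (ENNReal.pow_lt_top (ENNReal.natCast_lt_top n))
        (measure_lt_top _ _)
    have hhalf : ENNReal.ofReal t * (ENNReal.ofReal (2 * t)⁻¹ * a) = a / 2 := by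
      rw [← mul_assoc, ← ENNReal.ofReal_mul ht.le, show t * (2 * t)⁻¹ = 2⁻¹ by field_simp,
        ENNReal.ofReal_inv_of_pos two_pos, ENNReal.ofReal_ofNat, mul_comm, div_eq_mul_inv]
    rw [mul_add, hhalf, ← hD] at habsorb
    nth_rewrite 1 [← ENNReal.add_halves a] at habsorb
    have hle := ENNReal.le_of_add_le_add_left (ENNReal.div_ne_top hfin two_ne_zero) habsorb
    calc a = 2 * (a / 2) := (ENNReal.mul_div_cancel two_ne_zero ENNReal.ofNat_ne_top).symm
      _ ≤ 2 * D := by gcongr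
  refine le_of_tendsto' (lintegral_tendsto_of_tendsto_of_monotone
    (fun n => ((hcount.min measurable_const).pow_const 2).aemeasurable)
    (ae_of_all _ fun ω m n hmn => ?_) (ae_of_all _ fun ω => ?_)) htrunc
  · dsimp only
    gcongr
  · have hmin := (tendsto_const_nhds (x := countBefore S j t ω)).min ENNReal.tendsto_nat_nhds_top
    simpa only [min_top_right] using ENNReal.Tendsto.pow hmin

lemma IsHawkes.lintegral_countBefore_sq_lt_top [IsFiniteMeasure P] (hS : IsHawkes θ P ℱ S)
    (hss : IsSteadyState θ P S) (hμ : ∀ i, 0 < θ.μ i) (hα : ∀ k i j, 0 ≤ θ.α k i j) {j : Fin 2}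
    (hR : Integrable (fun ω => rate θ (state θ S 0 ω) j) P)
    (hR2 : Integrable (fun ω => rate θ (state θ S 0 ω) j ^ 2) P) (t : ℝ) :
    ∫⁻ ω, countBefore S j t ω ^ 2 ∂P < ∞ := by
  rcases le_or_gt t 0 with ht | ht
  · simp [countBefore, Ico_eq_empty_of_le ht]
  · exact (hS.lintegral_countBefore_sq_le hss hμ hα j ht).trans_lt (ENNReal.mul_lt_top
      ENNReal.ofNat_lt_top (ENNReal.mul_lt_top ENNReal.ofReal_lt_top
        ((hR2.const_mul _).add hR).lintegral_lt_top))

end SecondMoment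

section CrossMoment

variable {Ω : Type*} {mΩ : MeasurableSpace Ω} {P : Measure Ω} {ℱ : Filtration ℝ mΩ} {K : ℕ}
  {θ : Params K} {S : Fin 2 → Ω → Set ℝ}

/-- The cross moment `E[λ_i(t) N_j(t)]` as an integral with values in `[0, ∞]`, which does not
presuppose integrability. Events are counted in `[0, t)`, which is predictable and, at a fixed time,
almost surely the same as `(0, t]`. -/
def crossE (θ : Params K) (P : Measure Ω) (S : Fin 2 → Ω → Set ℝ) (i j : Fin 2) (t : ℝ) : ℝ≥0∞ :=
  ∫⁻ ω, countBefore S j t ω * ENNReal.ofReal (intensity θ S t ω i) ∂P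

lemma IsPointProcess.measurable_crossE [SFinite P] (hS : IsPointProcess P ℱ S)
    (hα : ∀ k i j, 0 ≤ θ.α k i j) (i j : Fin 2) : Measurable (crossE θ P S i j) := by
  have h := ((hS.measurable_countBefore j).mul
    (hS.measurable_intensity hα i).ennreal_ofReal).mono (predictable_le ℱ) le_rfl
  exact h.lintegral_prod_right'

lemma IsHawkes.crossE_le (hS : IsHawkes θ P ℱ S) (hss : IsSteadyState θ P S)
    (i j : Fin 2) {t T : ℝ} (ht : 0 ≤ t) (htT : t ≤ T) :
    crossE θ P S i j t ≤ ∫⁻ ω, countBefore S j T ω ^ 2 ∂P +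
      ∫⁻ ω, ENNReal.ofReal (rate θ (state θ S 0 ω) i) ^ 2 ∂P := by
  have hmul : ∀ x y : ℝ≥0∞, x * y ≤ x ^ 2 + y ^ 2 := fun x y => by
    rcases le_total x y with h | h
    · exact (mul_le_mul_left h y).trans (by rw [← sq]; exact le_add_self)
    · exact (mul_le_mul_right h x).trans (by rw [← sq]; exact le_self_add)
  calc crossE θ P S i j t
      ≤ ∫⁻ ω, (countBefore S j T ω ^ 2 + ENNReal.ofReal (rate θ (state θ S t ω) i) ^ 2) ∂P := by
        refine lintegral_mono fun ω => (hmul _ _).trans ?_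
        rw [intensity_eq_rate]
        gcongr
        exact countBefore_mono j htT ω
    _ = _ := by
        rw [lintegral_add_left ((hS.pointProcess.measurable_countBefore_apply j T).pow_const 2),
          (hss.identDistrib_comp (f := fun x => ENNReal.ofReal (rate θ x i) ^ 2) (by fun_prop)
            ht).lintegral_eq]

lemma N_nonneg (t : ℝ) (ω : Ω) (j : Fin 2) : 0 ≤ N S t ω j := Nat.cast_nonneg _

lemma intensity_nonneg (hμ : ∀ i, 0 < θ.μ i) (hα : ∀ k i j, 0 ≤ θ.α k i j) (t : ℝ) (ω : Ω)
    (i : Fin 2) : 0 ≤ intensity θ S t ω i :=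
  rate_nonneg hμ (state_nonneg hα t ω) i

lemma IsHawkes.lintegral_intensity_mul_N [SFinite P] (hS : IsHawkes θ P ℱ S)
    (hα : ∀ k i j, 0 ≤ θ.α k i j) (t : ℝ) (i j : Fin 2) :
    ∫⁻ ω, ENNReal.ofReal (intensity θ S t ω i * N S t ω j) ∂P = crossE θ P S i j t := by
  refine lintegral_congr_ae ?_
  filter_upwards [hS.ae_countBefore hα j t] with ω hω
  rw [← hω, mul_comm, ENNReal.ofReal_mul (N_nonneg t ω j)]

lemma IsPointProcess.measurable_intensity_mul_N (hS : IsPointProcess P ℱ S)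
    (hα : ∀ k i j, 0 ≤ θ.α k i j) (t : ℝ) (i j : Fin 2) :
    Measurable fun ω => intensity θ S t ω i * N S t ω j := by
  have hint : Measurable fun ω => intensity θ S t ω i :=
    (measurable_rate θ i).comp (hS.measurable_state hα t)
  have hN : Measurable fun ω => N S t ω j :=
    (measurable_from_top (f := fun n : ℕ => (n : ℝ))).comp
      ((hS.adapted j 0 t).mono (ℱ.le t) le_rfl)
  exact hint.mul hN

lemma IsHawkes.crossMoment_eq [SFinite P] (hS : IsHawkes θ P ℱ S) (hμ : ∀ i, 0 < θ.μ i)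
    (hα : ∀ k i j, 0 ≤ θ.α k i j) (t : ℝ) (i j : Fin 2) :
    crossMoment θ P S t i j = (crossE θ P S i j t).toReal := by
  rw [crossMoment, Matrix.of_apply, integral_eq_lintegral_of_nonneg_ae
    (ae_of_all _ fun ω => mul_nonneg (intensity_nonneg hμ hα t ω i) (N_nonneg t ω j))
    (hS.pointProcess.measurable_intensity_mul_N hα t i j).aestronglyMeasurable,
    hS.lintegral_intensity_mul_N hα]

lemma IsHawkes.integrable_intensity_mul_N [SFinite P] (hS : IsHawkes θ P ℱ S)
    (hμ : ∀ i, 0 < θ.μ i) (hα : ∀ k i j, 0 ≤ θ.α k i j) {t : ℝ} {i j : Fin 2}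
    (hfin : crossE θ P S i j t < ∞) : Integrable (fun ω => intensity θ S t ω i * N S t ω j) P := by
  refine ⟨(hS.pointProcess.measurable_intensity_mul_N hα t i j).aestronglyMeasurable, ?_⟩
  rw [hasFiniteIntegral_iff_ofReal (ae_of_all _ fun ω =>
    mul_nonneg (intensity_nonneg hμ hα t ω i) (N_nonneg t ω j)), hS.lintegral_intensity_mul_N hα]
  exact hfin

end CrossMoment

section RenewalTerms

variable {Ω : Type*} {mΩ : MeasurableSpace Ω} {P : Measure Ω} {ℱ : Filtration ℝ mΩ} {K : ℕ}
  {θ : Params K} {S : Fin 2 → Ω → Set ℝ}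

lemma IsPointProcess.measurable_componentE_add_kernel (hS : IsPointProcess P ℱ S) (k : Fin K)
    (i j : Fin 2) (t : ℝ) : Measurable[predictable ℱ] fun p : ℝ × Ω =>
      ENNReal.ofReal (Real.exp (-θ.β k i * (t - p.1))) * componentE θ S k p.1 p.2 i +
        ENNReal.ofReal (θ.kernel k (t - p.1) i j) := by
  have hexp : Measurable fun v => ENNReal.ofReal (Real.exp (-θ.β k i * (t - v))) := by fun_prop
  have hkernel : Measurable fun v => ENNReal.ofReal (θ.kernel k (t - v) i j) := by fun_prop
  exact ((hexp.comp (measurable_predictable_fst ℱ)).mul (hS.measurable_componentE k i)).add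
    (hkernel.comp (measurable_predictable_fst ℱ))

lemma IsHawkes.lintegral_componentE_add_kernel [SFinite P] (hS : IsHawkes θ P ℱ S)
    (hss : IsSteadyState θ P S) (hα : ∀ k i j, 0 ≤ θ.α k i j) (k : Fin K) (i j : Fin 2) (t : ℝ) :
    ∫⁻ ω, ∫⁻ v in Ico 0 t, (ENNReal.ofReal (Real.exp (-θ.β k i * (t - v))) *
        componentE θ S k v ω i + ENNReal.ofReal (θ.kernel k (t - v) i j))
          ∂(eventMeasure S j ω) ∂P =
      ∫⁻ v in Ico 0 t, ENNReal.ofReal (Real.exp (-θ.β k i * (t - v))) * ∫⁻ ω, ENNReal.ofReal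
        ((state θ S 0 ω k i + θ.α k i j) * rate θ (state θ S 0 ω) j) ∂P := by
  rw [hS.lintegral_eventMeasure (C := fun v ω => _) hα j
    (hS.pointProcess.measurable_componentE_add_kernel k i j t) measurableSet_Ico]
  refine setLIntegral_congr_fun measurableSet_Ico fun v hv => ?_
  rw [← (hss.identDistrib_comp (f := fun x => ENNReal.ofReal ((x k i + θ.α k i j) * rate θ x j))
      (by fun_prop) hv.1).lintegral_eq, ← lintegral_const_mul' _ _ ENNReal.ofReal_ne_top]
  refine lintegral_congr_ae (hS.ae_regular.mono fun ω hω => ?_)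
  have hcomp := component_nonneg (S := S) hα k v ω i
  dsimp only
  rw [← hω.ofReal_component hα, intensity_eq_rate, kernel_apply, mul_comm (θ.α k i j),
    ENNReal.ofReal_mul (Real.exp_pos _).le, ← mul_add, ← ENNReal.ofReal_add hcomp (hα k i j),
    mul_assoc, ← ENNReal.ofReal_mul (add_nonneg hcomp (hα k i j))]
  rfl

lemma IsPointProcess.measurable_ofReal_mul_countBefore (hS : IsPointProcess P ℱ S) {g : ℝ → ℝ}
    (hg : Measurable g) (j : Fin 2) :
    Measurable[predictable ℱ] fun p : ℝ × Ω => ENNReal.ofReal (g p.1) * countBefore S j p.1 p.2 :=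
  (hg.ennreal_ofReal.comp (measurable_predictable_fst ℱ)).mul (hS.measurable_countBefore j)

lemma IsHawkes.lintegral_ofReal_mul_countBefore [SFinite P] (hS : IsHawkes θ P ℱ S)
    (hα : ∀ k i j, 0 ≤ θ.α k i j) {g : ℝ → ℝ} (hg : Measurable g) (l j : Fin 2) (t : ℝ) :
    ∫⁻ ω, ∫⁻ u in Ico 0 t, ENNReal.ofReal (g u) * countBefore S j u ω ∂(eventMeasure S l ω) ∂P =
      ∫⁻ u in Ico 0 t, ENNReal.ofReal (g u) * crossE θ P S l j u := by
  rw [hS.lintegral_eventMeasure (C := fun u ω => _) hα l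
    (hS.pointProcess.measurable_ofReal_mul_countBefore hg j) measurableSet_Ico]
  simp only [mul_assoc, lintegral_const_mul' _ _ ENNReal.ofReal_ne_top, crossE]

lemma IsHawkes.lintegral_componentE_mul_countBefore [SFinite P] (hS : IsHawkes θ P ℱ S)
    (hss : IsSteadyState θ P S) (hα : ∀ k i j, 0 ≤ θ.α k i j) (k : Fin K) (i j : Fin 2) (t : ℝ) :
    ∫⁻ ω, componentE θ S k t ω i * countBefore S j t ω ∂P =
      ∫⁻ v in Ico 0 t, ENNReal.ofReal (Real.exp (-θ.β k i * (t - v))) *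
        (∫⁻ ω, ENNReal.ofReal ((state θ S 0 ω k i + θ.α k i j) * rate θ (state θ S 0 ω) j) ∂P +
          ∑ l, ENNReal.ofReal (θ.α k i l) * crossE θ P S l j v) := by
  have hS' := hS.pointProcess
  have hkernel : ∀ l, Measurable fun u => θ.kernel k (t - u) i l := fun l => by fun_prop
  have hcross : ∀ l, Measurable (crossE θ P S l j) := fun l => hS'.measurable_crossE hα l j
  rw [lintegral_congr_ae (hS.ae_regular.mono fun ω hω =>
      hS'.componentE_mul_countBefore hω k i j t),
    lintegral_add_left (hS'.measurable_lintegral_Ico j (C := fun v ω => _)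
      (hS'.measurable_componentE_add_kernel k i j t) 0 t),
    lintegral_finsetSum _ fun l _ => hS'.measurable_lintegral_Ico l (C := fun u ω => _)
      (hS'.measurable_ofReal_mul_countBefore (hkernel l) j) 0 t,
    hS.lintegral_componentE_add_kernel hss hα,
    Finset.sum_congr rfl fun l _ => hS.lintegral_ofReal_mul_countBefore hα (hkernel l) l j t,
    ← lintegral_finsetSum _ fun l _ => by fun_prop, ← lintegral_add_left (by fun_prop)]
  refine lintegral_congr fun v => ?_
  simp_rw [kernel_apply, ENNReal.ofReal_mul' (Real.exp_pos _).le, mul_add, Finset.mul_sum]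
  congr 1
  exact Finset.sum_congr rfl fun l _ => by ring

lemma IsHawkes.crossE_eq [SFinite P] (hS : IsHawkes θ P ℱ S) (hss : IsSteadyState θ P S)
    (hμ : ∀ i, 0 < θ.μ i) (hα : ∀ k i j, 0 ≤ θ.α k i j) (i j : Fin 2) (t : ℝ) :
    crossE θ P S i j t =
      ENNReal.ofReal (θ.μ i) *
          (ENNReal.ofReal t * ∫⁻ ω, ENNReal.ofReal (rate θ (state θ S 0 ω) j) ∂P) +
        ∑ k, ∫⁻ v in Ico 0 t, ENNReal.ofReal (Real.exp (-θ.β k i * (t - v))) *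
          (∫⁻ ω, ENNReal.ofReal ((state θ S 0 ω k i + θ.α k i j) * rate θ (state θ S 0 ω) j) ∂P +
            ∑ l, ENNReal.ofReal (θ.α k i l) * crossE θ P S l j v) := by
  have hcount := hS.pointProcess.measurable_countBefore_apply j t
  have hcomp : ∀ k, Measurable fun ω => componentE θ S k t ω i := fun k =>
    ((hS.pointProcess.measurable_componentE k i).mono (predictable_le ℱ) le_rfl).comp
      measurable_prodMk_left
  have hexpand : ∀ᵐ ω ∂P, countBefore S j t ω * ENNReal.ofReal (intensity θ S t ω i) =
      ENNReal.ofReal (θ.μ i) * countBefore S j t ω +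
        ∑ k, componentE θ S k t ω i * countBefore S j t ω := by
    filter_upwards [hS.ae_regular] with ω hω
    have hpos : ∀ k ∈ Finset.univ, 0 ≤ component θ S k t ω i := fun k _ => component_nonneg hα ..
    rw [intensity, ENNReal.ofReal_add (hμ i).le (Finset.sum_nonneg hpos),
      ENNReal.ofReal_sum_of_nonneg hpos]
    simp only [hω.ofReal_component hα]
    rw [mul_comm, add_mul, Finset.sum_mul]
  rw [crossE, lintegral_congr_ae hexpand, lintegral_add_left (hcount.const_mul _),
    lintegral_const_mul _ hcount, lintegral_finsetSum _ fun k _ => by fun_prop,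
    hS.lintegral_countBefore hss hα]
  simp only [hS.lintegral_componentE_mul_countBefore hss hα]

end RenewalTerms

section RenewalEquation

variable {Ω : Type*} {mΩ : MeasurableSpace Ω} {P : Measure Ω} {ℱ : Filtration ℝ mΩ} {K : ℕ}
  {θ : Params K} {S : Fin 2 → Ω → Set ℝ}

lemma toReal_setLIntegral_exp_mul (b : ℝ) {F : ℝ → ℝ≥0∞} (hF : Measurable F) {f : ℝ → ℝ} {t : ℝ}
    (ht : 0 ≤ t) (hfin : ∀ v ∈ Ico 0 t, F v ≠ ∞) (hFf : ∀ v ∈ Ico 0 t, (F v).toReal = f v) :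
    (∫⁻ v in Ico 0 t, ENNReal.ofReal (Real.exp (-b * (t - v))) * F v).toReal =
      expConv b f t := by
  rw [← integral_toReal (by fun_prop) ((ae_restrict_iff' measurableSet_Ico).2 (ae_of_all _
      fun v hv => ENNReal.mul_lt_top ENNReal.ofReal_lt_top (hfin v hv).lt_top)),
    expConv, intervalIntegral.integral_of_le ht, ← integral_Ico_eq_integral_Ioc]
  refine setIntegral_congr_fun measurableSet_Ico fun v hv => ?_
  simp only [ENNReal.toReal_mul, ENNReal.toReal_ofReal (Real.exp_pos _).le, hFf v hv]

lemma toReal_lintegral_ofReal {f : Ω → ℝ} (hf : Integrable f P) (hf0 : 0 ≤ f) :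
    (∫⁻ ω, ENNReal.ofReal (f ω) ∂P).toReal = ∫ ω, f ω ∂P :=
  (integral_eq_lintegral_of_nonneg_ae (ae_of_all _ hf0) hf.aestronglyMeasurable).symm

lemma IsHawkes.crossMoment_renewal [SFinite P] (hS : IsHawkes θ P ℱ S)
    (hss : IsSteadyState θ P S) (hμ : ∀ i, 0 < θ.μ i) (hα : ∀ k i j, 0 ≤ θ.α k i j) {j : Fin 2}
    (hR : Integrable (fun ω => rate θ (state θ S 0 ω) j) P)
    (hXR : ∀ k i, Integrable (fun ω => state θ S 0 ω k i * rate θ (state θ S 0 ω) j) P)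
    (hfin : ∀ i t, 0 ≤ t → crossE θ P S i j t ≠ ∞) (i : Fin 2) {t : ℝ} (ht : 0 ≤ t) :
    crossMoment θ P S t i j = (θ.μ i * ∫ ω, rate θ (state θ S 0 ω) j ∂P) * t +
      ∑ k, expConv (θ.β k i) (fun v =>
        ∫ ω, (state θ S 0 ω k i + θ.α k i j) * rate θ (state θ S 0 ω) j ∂P +
          (θ.α k *ᵥ fun l => crossMoment θ P S v l j) i) t := by
  have hrate0 : 0 ≤ fun ω => rate θ (state θ S 0 ω) j := fun ω =>
    rate_nonneg hμ (state_nonneg hα 0 ω) j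
  have hsource : ∀ k, Integrable
      (fun ω => (state θ S 0 ω k i + θ.α k i j) * rate θ (state θ S 0 ω) j) P := fun k => by
    simp only [add_mul]
    exact (hXR k i).add (hR.const_mul _)
  have hsource0 : ∀ k, 0 ≤ fun ω => (state θ S 0 ω k i + θ.α k i j) * rate θ (state θ S 0 ω) j :=
    fun k ω => mul_nonneg (add_nonneg (state_nonneg hα 0 ω k i) (hα k i j)) (hrate0 ω)
  have hcross : ∀ l, Measurable (crossE θ P S l j) := fun l =>
    hS.pointProcess.measurable_crossE hα l j
  have hterm : ∀ k l, ∀ v ∈ Ico 0 t, ENNReal.ofReal (θ.α k i l) * crossE θ P S l j v ≠ ∞ :=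
    fun k l v hv => ENNReal.mul_ne_top ENNReal.ofReal_ne_top (hfin l v hv.1)
  have hsum : ∀ k, ∀ v ∈ Ico 0 t, ∑ l, ENNReal.ofReal (θ.α k i l) * crossE θ P S l j v ≠ ∞ :=
    fun k v hv => ENNReal.sum_ne_top.2 fun l _ => hterm k l v hv
  obtain ⟨hbase, hconv⟩ := ENNReal.add_ne_top.1 (hS.crossE_eq hss hμ hα i j t ▸ hfin i t ht)
  simp only [hS.crossMoment_eq hμ hα]
  rw [hS.crossE_eq hss hμ hα, ENNReal.toReal_add hbase hconv,
    ENNReal.toReal_sum (ENNReal.sum_ne_top.1 hconv)]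
  congr 1
  · rw [ENNReal.toReal_mul, ENNReal.toReal_mul, ENNReal.toReal_ofReal (hμ i).le,
      ENNReal.toReal_ofReal ht, toReal_lintegral_ofReal hR hrate0]
    ring
  · refine Finset.sum_congr rfl fun k _ => toReal_setLIntegral_exp_mul _ (by fun_prop) ht
      (fun v hv => ENNReal.add_ne_top.2 ⟨(hsource k).lintegral_lt_top.ne, hsum k v hv⟩)
      fun v hv => ?_
    rw [ENNReal.toReal_add (hsource k).lintegral_lt_top.ne (hsum k v hv),
      toReal_lintegral_ofReal (hsource k) (hsource0 k),
      ENNReal.toReal_sum fun l _ => hterm k l v hv]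
    simp only [ENNReal.toReal_mul, ENNReal.toReal_ofReal (hα _ _ _), Matrix.mulVec, dotProduct]

end RenewalEquation

section Asymptotics

variable {Ω : Type*} {mΩ : MeasurableSpace Ω} {P : Measure Ω} {ℱ : Filtration ℝ mΩ} {K : ℕ}
  {θ : Params K} {S : Fin 2 → Ω → Set ℝ}

lemma IsHawkes.subcritical [IsProbabilityMeasure P] (hS : IsHawkes θ P ℱ S)
    (hss : IsSteadyState θ P S) (hμ : ∀ i, 0 < θ.μ i) (hα : ∀ k i j, 0 ≤ θ.α k i j)
    (hβ : ∀ k i, 0 < θ.β k i) : Subcritical θ.branching :=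
  (hS.laplaceIdentity hss hμ hα hβ).subcritical hμ hα hβ (hS.pointProcess.measurable_state hα 0)
    (state_nonneg hα 0)

lemma IsHawkes.integrable_state [IsProbabilityMeasure P] (hS : IsHawkes θ P ℱ S)
    (hss : IsSteadyState θ P S) (hμ : ∀ i, 0 < θ.μ i) (hα : ∀ k i j, 0 ≤ θ.α k i j)
    (hβ : ∀ k i, 0 < θ.β k i) (k : Fin K) (i : Fin 2) :
    Integrable (fun ω => state θ S 0 ω k i) P :=
  (hS.laplaceIdentity hss hμ hα hβ).integrable_apply hμ hα hβ
    (hS.pointProcess.measurable_state hα 0) (state_nonneg hα 0) k i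

lemma IsHawkes.integrable_rate_state [IsProbabilityMeasure P] (hS : IsHawkes θ P ℱ S)
    (hss : IsSteadyState θ P S) (hμ : ∀ i, 0 < θ.μ i) (hα : ∀ k i j, 0 ≤ θ.α k i j)
    (hβ : ∀ k i, 0 < θ.β k i) (j : Fin 2) : Integrable (fun ω => rate θ (state θ S 0 ω) j) P :=
  integrable_rate (hS.integrable_state hss hμ hα hβ) j

lemma IsHawkes.integrable_state_mul_rate [IsProbabilityMeasure P] (hS : IsHawkes θ P ℱ S)
    (hss : IsSteadyState θ P S) (hμ : ∀ i, 0 < θ.μ i) (hα : ∀ k i j, 0 ≤ θ.α k i j)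
    (hβ : ∀ k i, 0 < θ.β k i) (k : Fin K) (i j : Fin 2) :
    Integrable (fun ω => state θ S 0 ω k i * rate θ (state θ S 0 ω) j) P := by
  simp only [rate, mul_add, Finset.mul_sum]
  exact ((hS.integrable_state hss hμ hα hβ k i).mul_const _).add (integrable_finsetSum _ fun l _ =>
    (hS.laplaceIdentity hss hμ hα hβ).integrable_apply_mul_apply hμ hα hβ
      (hS.pointProcess.measurable_state hα 0) (state_nonneg hα 0) k l i j)

lemma IsHawkes.integrable_rate_state_sq [IsProbabilityMeasure P] (hS : IsHawkes θ P ℱ S)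
    (hss : IsSteadyState θ P S) (hμ : ∀ i, 0 < θ.μ i) (hα : ∀ k i j, 0 ≤ θ.α k i j)
    (hβ : ∀ k i, 0 < θ.β k i) (j : Fin 2) :
    Integrable (fun ω => rate θ (state θ S 0 ω) j ^ 2) P := by
  have hexpand : ∀ x, rate θ x j ^ 2 = θ.μ j * rate θ x j + ∑ k, x k j * rate θ x j := fun x => by
    rw [← Finset.sum_mul, ← add_mul, sq, rate]
  simp only [hexpand]
  exact ((hS.integrable_rate_state hss hμ hα hβ j).const_mul _).add
    (integrable_finsetSum _ fun k _ => hS.integrable_state_mul_rate hss hμ hα hβ k j j)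

lemma IsHawkes.integrable_intensity [IsProbabilityMeasure P] (hS : IsHawkes θ P ℱ S)
    (hss : IsSteadyState θ P S) (hμ : ∀ i, 0 < θ.μ i) (hα : ∀ k i j, 0 ≤ θ.α k i j)
    (hβ : ∀ k i, 0 < θ.β k i) {t : ℝ} (ht : 0 ≤ t) (i : Fin 2) :
    Integrable (fun ω => intensity θ S t ω i) P :=
  (hss.identDistrib_comp (measurable_rate θ i) ht).integrable_iff.2
    (hS.integrable_rate_state hss hμ hα hβ i)

lemma IsHawkes.integrable_component_mul_intensity [IsProbabilityMeasure P] (hS : IsHawkes θ P ℱ S)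
    (hss : IsSteadyState θ P S) (hμ : ∀ i, 0 < θ.μ i) (hα : ∀ k i j, 0 ≤ θ.α k i j)
    (hβ : ∀ k i, 0 < θ.β k i) {t : ℝ} (ht : 0 ≤ t) (k : Fin K) (i j : Fin 2) :
    Integrable (fun ω => component θ S k t ω i * intensity θ S t ω j) P :=
  (hss.identDistrib_comp (f := fun x => x k i * rate θ x j) (by fun_prop) ht).integrable_iff.2
    (hS.integrable_state_mul_rate hss hμ hα hβ k i j)

lemma IsHawkes.exists_crossE_le [IsProbabilityMeasure P] (hS : IsHawkes θ P ℱ S)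
    (hss : IsSteadyState θ P S) (hμ : ∀ i, 0 < θ.μ i) (hα : ∀ k i j, 0 ≤ θ.α k i j)
    (hβ : ∀ k i, 0 < θ.β k i) (i j : Fin 2) (T : ℝ) :
    ∃ M ≠ ∞, ∀ t ∈ Icc 0 T, crossE θ P S i j t ≤ M := by
  refine ⟨_, (ENNReal.add_lt_top.2 ⟨hS.lintegral_countBefore_sq_lt_top hss hμ hα
    (hS.integrable_rate_state hss hμ hα hβ j) (hS.integrable_rate_state_sq hss hμ hα hβ j) T,
    ?_⟩).ne, fun t ht => hS.crossE_le hss i j ht.1 ht.2⟩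
  simpa only [ENNReal.ofReal_pow (rate_nonneg hμ (state_nonneg hα 0 _) i)]
    using (hS.integrable_rate_state_sq hss hμ hα hβ i).lintegral_lt_top

lemma IsHawkes.crossE_lt_top [IsProbabilityMeasure P] (hS : IsHawkes θ P ℱ S)
    (hss : IsSteadyState θ P S) (hμ : ∀ i, 0 < θ.μ i) (hα : ∀ k i j, 0 ≤ θ.α k i j)
    (hβ : ∀ k i, 0 < θ.β k i) (i j : Fin 2) {t : ℝ} (ht : 0 ≤ t) : crossE θ P S i j t < ∞ := by
  obtain ⟨M, hM, hle⟩ := hS.exists_crossE_le hss hμ hα hβ i j t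
  exact (hle t ⟨ht, le_rfl⟩).trans_lt hM.lt_top

lemma IsHawkes.exists_abs_crossMoment_le [IsProbabilityMeasure P] (hS : IsHawkes θ P ℱ S)
    (hss : IsSteadyState θ P S) (hμ : ∀ i, 0 < θ.μ i) (hα : ∀ k i j, 0 ≤ θ.α k i j)
    (hβ : ∀ k i, 0 < θ.β k i) (i j : Fin 2) (T : ℝ) :
    ∃ M, ∀ t ∈ Icc 0 T, |crossMoment θ P S t i j| ≤ M := by
  obtain ⟨M, hM, hle⟩ := hS.exists_crossE_le hss hμ hα hβ i j T
  refine ⟨M.toReal, fun t ht => ?_⟩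
  rw [hS.crossMoment_eq hμ hα, abs_of_nonneg ENNReal.toReal_nonneg]
  exact ENNReal.toReal_mono hM (hle t ht)

lemma IsHawkes.intervalIntegrable_crossMoment [IsProbabilityMeasure P] (hS : IsHawkes θ P ℱ S)
    (hss : IsSteadyState θ P S) (hμ : ∀ i, 0 < θ.μ i) (hα : ∀ k i j, 0 ≤ θ.α k i j)
    (hβ : ∀ k i, 0 < θ.β k i) (i j : Fin 2) {t : ℝ} (ht : 0 ≤ t) :
    IntervalIntegrable (fun v => crossMoment θ P S v i j) volume 0 t := by
  obtain ⟨M, hM⟩ := hS.exists_abs_crossMoment_le hss hμ hα hβ i j t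
  refine (intervalIntegrable_iff_integrableOn_Icc_of_le ht).2 (Measure.integrableOn_of_bounded
    (M := M) (by simp) ?_ ((ae_restrict_iff' measurableSet_Icc).2 (ae_of_all _ hM)))
  simp only [hS.crossMoment_eq hμ hα]
  exact (hS.pointProcess.measurable_crossE hα i j).ennreal_toReal.aestronglyMeasurable

lemma IsSteadyState.meanIntensity_eq (hss : IsSteadyState θ P S) {t : ℝ} (ht : 0 ≤ t) :
    meanIntensity θ P S t = fun i => ∫ ω, rate θ (state θ S 0 ω) i ∂P :=
  funext fun i => (hss.identDistrib_comp (measurable_rate θ i) ht).integral_eq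

lemma IsSteadyState.componentMoment_apply (hss : IsSteadyState θ P S) {t : ℝ} (ht : 0 ≤ t)
    (k : Fin K) (i j : Fin 2) : componentMoment θ P S k t i j =
      ∫ ω, state θ S 0 ω k i * rate θ (state θ S 0 ω) j ∂P :=
  (hss.identDistrib_comp (f := fun x => x k i * rate θ x j) (by fun_prop) ht).integral_eq

lemma IsHawkes.meanIntensity_eq_add [IsProbabilityMeasure P] (hS : IsHawkes θ P ℱ S)
    (hss : IsSteadyState θ P S) (hμ : ∀ i, 0 < θ.μ i) (hα : ∀ k i j, 0 ≤ θ.α k i j)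
    (hβ : ∀ k i, 0 < θ.β k i) {t : ℝ} (ht : 0 ≤ t) :
    meanIntensity θ P S t = θ.μ + θ.branching *ᵥ meanIntensity θ P S t := by
  rw [hss.meanIntensity_eq ht]
  exact (hS.laplaceIdentity hss hμ hα hβ).integral_rate hμ hα hβ
    (hS.pointProcess.measurable_state hα 0) (state_nonneg hα 0)

lemma IsHawkes.inv_mul_vecMulVec_eq_slopeMat [IsProbabilityMeasure P] (hS : IsHawkes θ P ℱ S)
    (hss : IsSteadyState θ P S) (hμ : ∀ i, 0 < θ.μ i) (hα : ∀ k i j, 0 ≤ θ.α k i j)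
    (hβ : ∀ k i, 0 < θ.β k i) {s : ℝ} (hs : 0 ≤ s) :
    (1 - θ.branching)⁻¹ * Matrix.vecMulVec θ.μ (meanIntensity θ P S s) = slopeMat θ P S s := by
  have hunit := (hS.subcritical hss hμ hα hβ).isUnit_one_sub (branching_nonneg hα hβ)
  have hmean : (1 - θ.branching) *ᵥ meanIntensity θ P S s = θ.μ := by
    rw [Matrix.sub_mulVec, Matrix.one_mulVec, sub_eq_iff_eq_add]
    exact hS.meanIntensity_eq_add hss hμ hα hβ hs
  conv_lhs => rw [← hmean]
  rw [← Matrix.mul_vecMulVec, ← slopeMat,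
    Matrix.nonsing_inv_mul_cancel_left _ _ ((Matrix.isUnit_iff_isUnit_det _).1 hunit)]

lemma offsetMat_apply (hβ : ∀ k i, 0 < θ.β k i) (hunit : IsUnit (1 - θ.branching)) (s : ℝ)
    (i j : Fin 2) : offsetMat θ P S s i j =
      (θ.branching *ᵥ fun l => offsetMat θ P S s l j) i + ∑ k, (θ.β k i)⁻¹ *
        (componentMoment θ P S k s i j + θ.α k i j * meanIntensity θ P S s j -
          (θ.β k i)⁻¹ * (θ.α k *ᵥ fun l => slopeMat θ P S s l j) i) := by
  have hsolve : (1 - θ.branching) * offsetMat θ P S s = ∑ k, (θ.βMat k)⁻¹ *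
      (-((θ.βMat k)⁻¹ * θ.α k * slopeMat θ P S s) + componentMoment θ P S k s +
        θ.α k * Matrix.diagonal (meanIntensity θ P S s)) :=
    Matrix.mul_nonsing_inv_cancel_left _ _ ((Matrix.isUnit_iff_isUnit_det _).1 hunit)
  rw [sub_mul, one_mul, sub_eq_iff_eq_add'] at hsolve
  conv_lhs => rw [hsolve]
  rw [Matrix.add_apply, Matrix.sum_apply]
  refine congrArg₂ _ rfl (Finset.sum_congr rfl fun k _ => ?_)
  simp only [βMat_inv hβ, Matrix.diagonal_mul, Matrix.add_apply, Matrix.neg_apply,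
    Matrix.mul_assoc, Matrix.mul_diagonal]
  simp only [Matrix.mul_apply, Matrix.mulVec, dotProduct]
  ring

lemma IsHawkes.slopeMat_apply_eq_add [IsProbabilityMeasure P] (hS : IsHawkes θ P ℱ S)
    (hss : IsSteadyState θ P S) (hμ : ∀ i, 0 < θ.μ i) (hα : ∀ k i j, 0 ≤ θ.α k i j)
    (hβ : ∀ k i, 0 < θ.β k i) {s : ℝ} (hs : 0 ≤ s) (i j : Fin 2) :
    slopeMat θ P S s i j = θ.μ i * meanIntensity θ P S s j +
      (θ.branching *ᵥ fun l => slopeMat θ P S s l j) i := by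
  simp only [slopeMat, Matrix.vecMulVec_apply, Matrix.mulVec, dotProduct, ← mul_assoc]
  rw [← Finset.sum_mul, ← add_mul]
  exact congrArg (· * _) (congrFun (hS.meanIntensity_eq_add hss hμ hα hβ hs) i)

lemma IsHawkes.componentMoment_add_mul_meanIntensity [IsProbabilityMeasure P]
    (hS : IsHawkes θ P ℱ S) (hss : IsSteadyState θ P S) (hμ : ∀ i, 0 < θ.μ i)
    (hα : ∀ k i j, 0 ≤ θ.α k i j) (hβ : ∀ k i, 0 < θ.β k i) {s : ℝ} (hs : 0 ≤ s) (k : Fin K)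
    (i j : Fin 2) : componentMoment θ P S k s i j + θ.α k i j * meanIntensity θ P S s j =
      ∫ ω, (state θ S 0 ω k i + θ.α k i j) * rate θ (state θ S 0 ω) j ∂P := by
  simp only [add_mul]
  rw [integral_add (hS.integrable_state_mul_rate hss hμ hα hβ k i j)
    ((hS.integrable_rate_state hss hμ hα hβ j).const_mul _), integral_const_mul,
    hss.componentMoment_apply hs, hss.meanIntensity_eq hs]

lemma IsHawkes.tendsto_crossMoment_sub_affine [IsProbabilityMeasure P] (hS : IsHawkes θ P ℱ S)
    (hss : IsSteadyState θ P S) (hμ : ∀ i, 0 < θ.μ i) (hα : ∀ k i j, 0 ≤ θ.α k i j)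
    (hβ : ∀ k i, 0 < θ.β k i) {s : ℝ} (hs : 0 ≤ s) :
    Tendsto (fun t : ℝ => crossMoment θ P S t - (t • slopeMat θ P S s + offsetMat θ P S s))
      atTop (𝓝 0) := by
  have hsub := hS.subcritical hss hμ hα hβ
  have hunit := hsub.isUnit_one_sub (branching_nonneg hα hβ)
  refine tendsto_pi_nhds.2 fun i => tendsto_pi_nhds.2 fun j => ?_
  have hR := hS.integrable_rate_state hss hμ hα hβ j
  have hXR := fun k i => hS.integrable_state_mul_rate hss hμ hα hβ k i j
  have hfin : ∀ i t, 0 ≤ t → crossE θ P S i j t ≠ ∞ := fun i t ht =>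
    (hS.crossE_lt_top hss hμ hα hβ i j ht).ne
  refine hsub.tendsto_sub_affine_of_renewal hα hβ (Z := fun t i => crossMoment θ P S t i j)
    (A := fun i => slopeMat θ P S s i j) (B := fun i => offsetMat θ P S s i j)
    (fun i => hS.exists_abs_crossMoment_le hss hμ hα hβ i j)
    (fun i t ht => hS.intervalIntegrable_crossMoment hss hμ hα hβ i j ht)
    (fun i t ht => hS.crossMoment_renewal hss hμ hα hR hXR hfin i ht)
    (funext fun i => ?_) (fun i => ?_) i
  · simpa only [hss.meanIntensity_eq hs, Pi.add_apply] using
      hS.slopeMat_apply_eq_add hss hμ hα hβ hs i j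
  · simpa only [hS.componentMoment_add_mul_meanIntensity hss hμ hα hβ hs]
      using offsetMat_apply (P := P) (S := S) hβ hunit s i j

end Asymptotics

end MultiKernelHawkes

end

theorem proposition3 {Ω : Type*} [mΩ : MeasurableSpace Ω] (P : Measure Ω) [IsProbabilityMeasure P]
    (ℱ : Filtration ℝ mΩ) {K : ℕ} (θ : MultiKernelHawkes.Params K)
    (hμ : ∀ i, 0 < θ.μ i) (hα : ∀ k i j, 0 ≤ θ.α k i j) (hβ : ∀ k i, 0 < θ.β k i)
    (S : Fin 2 → Ω → Set ℝ) (hS : MultiKernelHawkes.IsHawkes θ P ℱ S)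
    (hss : MultiKernelHawkes.IsSteadyState θ P S) :
    -- the inverse matrix in the formulas exists
    IsUnit (1 - θ.branching) ∧
    -- all the moments in the formulas are finite
    (∀ t, 0 ≤ t → ∀ i j,
      Integrable (fun ω => MultiKernelHawkes.intensity θ S t ω i) P ∧
      (∀ k, Integrable (fun ω => MultiKernelHawkes.component θ S k t ω i *
        MultiKernelHawkes.intensity θ S t ω j) P) ∧
      Integrable (fun ω => MultiKernelHawkes.intensity θ S t ω i *
        MultiKernelHawkes.N S t ω j) P) ∧
    -- the formulas, with `A` and `B` computed at an arbitrary time `s`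
    ∀ s, 0 ≤ s →
      (1 - θ.branching)⁻¹ * Matrix.vecMulVec θ.μ (MultiKernelHawkes.meanIntensity θ P S s) =
        MultiKernelHawkes.slopeMat θ P S s ∧
      Tendsto (fun t : ℝ => MultiKernelHawkes.crossMoment θ P S t -
          (t • MultiKernelHawkes.slopeMat θ P S s + MultiKernelHawkes.offsetMat θ P S s))
        atTop (𝓝 0) := by
  refine ⟨(hS.subcritical hss hμ hα hβ).isUnit_one_sub (MultiKernelHawkes.branching_nonneg hα hβ),
    fun t ht i j => ⟨hS.integrable_intensity hss hμ hα hβ ht i, fun k => ?_, ?_⟩,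
    fun s hs => ⟨?_, hS.tendsto_crossMoment_sub_affine hss hμ hα hβ hs⟩⟩
  · exact hS.integrable_component_mul_intensity hss hμ hα hβ ht k i j
  · exact hS.integrable_intensity_mul_N hμ hα (hS.crossE_lt_top hss hμ hα hβ i j ht)
  · exact hS.inv_mul_vecMulVec_eq_slopeMat hss hμ hα hβ hs
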